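/- Let $M^3=\mathbb H^3/\Gamma$ be an almost Fuchsian manifold: a hyperbolic three-manifold, where $\Gamma\subset PSL(2,\mathbb C)$ is isomorphic to the fundamental group of a closed oriented surface of genus at least two, which contains a closed minimal surface $\Sigma$ (the inclusion $\Sigma\to M^3$ being a homotopy equivalence) whose principal curvatures $\pm\lambda(x)$ lie in $(-1,1)$. Let $\vec n$ be a unit normal field of $\Sigma$, let $A_\Sigma$ be the second fundamental form of $\Sigma$, $\lambda_{max}=\max_\Sigma\lambda\in[0,1)$, and $\|A_\Sigma\|_{C^1(\Sigma)}=\max\{\sup_\Sigma|A_\Sigma|,\sup_\Sigma|\nabla A_\Sigma|\}$. The map $(x,r)\mapsto\exp_x(r\vec n)$ is a diffeomorphism $\Sigma\times\mathbb R\to M^3$; let $\Sigma(r)=\{\exp_x(r\vec n):x\in\Sigma\}$ be the equidistant surfaces, and write $\vec n=\partial/\partial r$ also for the unit normal field on $M^3$ of the foliation by them. Let $\epsilon_1>0$, let $$\epsilon\in\Big[0,\,1-\frac1{(1+\frac{\epsilon_1}{16})^2}\Big)\cap\Big[0,\frac{\sqrt{\epsilon_1}}{12}\Big]\cap\big[0,\,7\times10^{-6}\big],$$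 and suppose that $\|A_\Sigma\|_{C^1(\Sigma)}\le\epsilon$. Let $c\in[0,2-\frac{\epsilon_1}2]$ and $$r\in\left[\tanh^{-1}\!\Big(\frac{c}{2-(2-\frac{c^2}2)\lambda_{max}^2}\Big),\ \frac12\cosh^{-1}\!\Big(\frac18\ln\Big(\frac{\epsilon_1}{\epsilon(16+\epsilon_1)}\Big)\Big)\right],$$ where the upper end is $+\infty$ if $\epsilon=0$, and where the range is empty if the argument of $\cosh^{-1}$ is less than $1$. Let $F:\Sigma\times[0,T)\to M^3$ be a smooth solution, by immersions, of the modified mean curvature flow $$\frac{\partial F}{\partial t}=-(H-c)\,\vec\nu,\qquad F(x,0)=\exp_x(r\vec n),$$ starting from the equidistant surface $\Sigma(r)$. Here $\vec\nu$ is the continuous unit normal field along $F$ with $\vec\nu=\partial/\partial r$ at $t=0$, and $H=\mathrm{tr}\,\overline\nabla\vec\nu$ is the mean curvature (the sum of the principal curvatures) of the evolving surface. Then the angle function $\Theta=\langle\vec\nu,\vec n\rangle$ satisfies $$\Theta(x,t)\ \ge\ \frac1{1+\frac{\epsilon_1}8}\qquad\text{for all }x\in\Sigma,\ t\in[0,T).$$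 In particular every evolving surface is a geodesic graph over $\Sigma$, meaning that its angle function is bounded below by a positive constant. -/

import Mathlib

open scoped ContDiff

/-! Differential geometry of surfaces in hyperbolic 3-space, in the hyperboloid model, and of
closed surfaces in hyperbolic 3-manifolds `ℍ³ / Γ`, described through their `Γ`-equivariant lifts
`ℝ² → ℍ³` to the universal covers. -/

noncomputable section

/-- The coordinate plane `ℝ²`, the universal cover of a closed surface of genus at least two.
It is only used as a smooth manifold (its norm plays no role). -/
abbrev Plane : Type := Fin 2 → ℝ

/-- Minkowski space `ℝ^{3,1}`, which contains hyperbolic 3-space as a hyperboloid. -/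
abbrev Minkowski : Type := Fin 4 → ℝ

/-- The Minkowski inner product, of signature `(-,+,+,+)`. -/
def mink (v w : Minkowski) : ℝ := -(v 0 * w 0) + v 1 * w 1 + v 2 * w 2 + v 3 * w 3

/-- Hyperbolic 3-space: the upper sheet of the hyperboloid `⟨p, p⟩ = -1`. Its tangent space at `p`
is `{v | ⟨v, p⟩ = 0}`, with the Riemannian metric given by `mink`. -/
def Hyp3 : Set Minkowski := {p | mink p p = -1 ∧ 0 < p 0}

/-- The linear maps that restrict to orientation preserving isometries of `ℍ³`,
i.e. the elements of `SO⁺(3,1) ≅ PSL(2,ℂ)`. -/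
structure IsHypIsometry (γ : Minkowski ≃ₗ[ℝ] Minkowski) : Prop where
  mink_map : ∀ v w, mink (γ v) (γ w) = mink v w
  map_mem : ∀ p ∈ Hyp3, γ p ∈ Hyp3
  det_eq_one : LinearMap.det (γ : Minkowski →ₗ[ℝ] Minkowski) = 1

/-- The partial derivative `∂ᵢ G` of a map on the coordinate plane. -/
def pd {E : Type*} [NormedAddCommGroup E] [NormedSpace ℝ E] (i : Fin 2) (G : Plane → E)
    (x : Plane) : E :=
  fderiv ℝ G x (Pi.single i 1)

/-- `F : ℝ² → ℍ³` is an immersion at `x`, and `N x` is a unit vector normal to it in `T ℍ³`. -/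
structure IsImmersedWithNormalAt (F N : Plane → Minkowski) (x : Plane) : Prop where
  mem : F x ∈ Hyp3
  immersion : Function.Injective (fderiv ℝ F x)
  normal_tangent : mink (N x) (F x) = 0
  normal_orthogonal : ∀ i, mink (N x) (pd i F x) = 0
  normal_unit : mink (N x) (N x) = 1

/-- The induced metric `gᵢⱼ = ⟨∂ᵢF, ∂ⱼF⟩`. -/
def metric (F : Plane → Minkowski) (x : Plane) : Matrix (Fin 2) (Fin 2) ℝ :=
  Matrix.of fun i j => mink (pd i F x) (pd j F x)

/-- The second fundamental form `hᵢⱼ = ⟨∇̄ᵢ N, ∂ⱼF⟩ = -⟨N, ∇̄ᵢ ∂ⱼF⟩` of the surface `F` in `ℍ³` with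
respect to the unit normal `N`. As `∇̄ᵢ ∂ⱼF = ∂ᵢ∂ⱼF - gᵢⱼ F` on the hyperboloid and `⟨N, F⟩ = 0`,
it equals `-⟨N, ∂ᵢ∂ⱼF⟩`. -/
def secondFF (F N : Plane → Minkowski) (x : Plane) : Matrix (Fin 2) (Fin 2) ℝ :=
  Matrix.of fun i j => -mink (N x) (pd i (pd j F) x)

/-- The mean curvature `H = gⁱʲ hᵢⱼ`, the sum of the principal curvatures. -/
def meanCurvature (F N : Plane → Minkowski) (x : Plane) : ℝ :=
  ((metric F x)⁻¹ * secondFF F N x).trace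

/-- `κ` is a principal curvature at `x`: an eigenvalue of the second fundamental form relative to
the induced metric. -/
def IsPrincipalCurvature (F N : Plane → Minkowski) (x : Plane) (κ : ℝ) : Prop :=
  ∃ v : Fin 2 → ℝ, v ≠ 0 ∧ (secondFF F N x).mulVec v = κ • (metric F x).mulVec v

/-- The Christoffel symbols `Γᵏᵢⱼ = ½ gᵏˡ (∂ᵢ gⱼₗ + ∂ⱼ gᵢₗ - ∂ₗ gᵢⱼ)` of the induced metric. -/
def christoffel (F : Plane → Minkowski) (x : Plane) (k i j : Fin 2) : ℝ :=
  (1 / 2) * ∑ l, (metric F x)⁻¹ k l *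
    (pd i (fun y => metric F y j l) x + pd j (fun y => metric F y i l) x
      - pd l (fun y => metric F y i j) x)

/-- The covariant derivative `∇ₖ hᵢⱼ` of the second fundamental form. -/
def covDerivSecondFF (F N : Plane → Minkowski) (x : Plane) (k i j : Fin 2) : ℝ :=
  pd k (fun y => secondFF F N y i j) x
    - ∑ l, christoffel F x l k i * secondFF F N x l j
    - ∑ l, christoffel F x l k j * secondFF F N x i l

/-- `|A|² = gⁱᵏ gʲˡ hᵢⱼ hₖₗ`. -/
def normSqA (F N : Plane → Minkowski) (x : Plane) : ℝ :=
  ∑ i, ∑ j, ∑ k, ∑ l, (metric F x)⁻¹ i k * (metric F x)⁻¹ j l *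
    secondFF F N x i j * secondFF F N x k l

/-- `|∇A|² = gᵃᵇ gⁱᵏ gʲˡ ∇ₐhᵢⱼ ∇_b hₖₗ`. -/
def normSqGradA (F N : Plane → Minkowski) (x : Plane) : ℝ :=
  ∑ a, ∑ b, ∑ i, ∑ j, ∑ k, ∑ l,
    (metric F x)⁻¹ a b * (metric F x)⁻¹ i k * (metric F x)⁻¹ j l *
      covDerivSecondFF F N x a i j * covDerivSecondFF F N x b k l

/-- An almost Fuchsian manifold `M = ℍ³ / Γ` with its closed minimal surface `Σ`.

`Γ` is the fundamental group of the closed surface `Σ = ℝ² / Γ` (`Γ` acts on `ℝ²` by the deck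
transformations `deck`), the inclusion `Σ → M` is a homotopy equivalence and lifts to the
equivariant immersion `f : ℝ² → ℍ³`, and `n` is the lift of the unit normal field of `Σ`.
That `Γ` acts freely and properly discontinuously on `ℝ²` is a consequence of the same property
of its action on `ℍ³`; that the genus of `Σ` is at least two follows from Gauss-Bonnet. -/
structure AlmostFuchsian where
  Γ : Subgroup (Minkowski ≃ₗ[ℝ] Minkowski)
  isometry : ∀ γ ∈ Γ, IsHypIsometry γ
  free : ∀ γ ∈ Γ, ∀ p ∈ Hyp3, γ p = p → γ = 1
  properlyDiscontinuous : ∀ K ⊆ Hyp3, IsCompact K →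
    {γ : Minkowski ≃ₗ[ℝ] Minkowski | γ ∈ Γ ∧ ((γ '' K) ∩ K).Nonempty}.Finite
  /-- the action of `Γ` on the universal cover of `Σ` -/
  deck : Γ →* Equiv.Perm Plane
  deck_smooth : ∀ γ, ContDiff ℝ ∞ (deck γ)
  /-- `Σ` is closed -/
  cocompact : ∃ K : Set Plane, IsCompact K ∧ ∀ x, ∃ γ, deck γ x ∈ K
  f : Plane → Minkowski
  n : Plane → Minkowski
  f_smooth : ContDiff ℝ ∞ f
  n_smooth : ContDiff ℝ ∞ n
  surface : ∀ x, IsImmersedWithNormalAt f n x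
  f_equivariant : ∀ (γ : Γ) x, f (deck γ x) = (γ : Minkowski ≃ₗ[ℝ] Minkowski) (f x)
  n_equivariant : ∀ (γ : Γ) x, n (deck γ x) = (γ : Minkowski ≃ₗ[ℝ] Minkowski) (n x)
  minimal : ∀ x, meanCurvature f n x = 0
  principal_lt_one : ∀ x κ, IsPrincipalCurvature f n x κ → |κ| < 1

namespace AlmostFuchsian

variable (M : AlmostFuchsian)

/-- `λ_max`, the maximum over `Σ` of the absolute values of the principal curvatures. -/
def lambdaMax : ℝ := sSup {a | ∃ x κ, IsPrincipalCurvature M.f M.n x κ ∧ a = |κ|}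

/-- `‖A_Σ‖_{C¹(Σ)} = max (sup |A_Σ|, sup |∇ A_Σ|)`. (Both functions are continuous and invariant
under the cocompact group of deck transformations, so the suprema are finite.) -/
def c1NormA : ℝ :=
  max (⨆ x, Real.sqrt (normSqA M.f M.n x)) (⨆ x, Real.sqrt (normSqGradA M.f M.n x))

/-- The normal exponential map `(x, r) ↦ exp_x (r n)` of `Σ`, lifted to `ℍ³`. For fixed `r` it
parametrizes the equidistant surface `Σ(r)`. As the principal curvatures of `Σ` are less than one
in absolute value, it is a diffeomorphism from `ℝ² × ℝ` onto `ℍ³`. -/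
def normalExp (x : Plane) (r : ℝ) : Minkowski := Real.cosh r • M.f x + Real.sinh r • M.n x

/-- The vector `∂/∂r` at `exp_x (r n)`: the velocity of the geodesic `r ↦ exp_x (r n)`. -/
def normalExpVelocity (x : Plane) (r : ℝ) : Minkowski :=
  Real.sinh r • M.f x + Real.cosh r • M.n x

/-- The vector field `∂/∂r` on `ℍ³` (the lift of the one on `M`), where `r` is the signed distance
to `Σ`: the unit normal field of the foliation by the equidistant surfaces. -/
def radialField (p : Minkowski) : Minkowski :=
  let q : Plane × ℝ := Function.invFun (fun q : Plane × ℝ => M.normalExp q.1 q.2) p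
  M.normalExpVelocity q.1 q.2

/-- The angle function `Θ = ⟨ν, ∂/∂r⟩` of a surface `F` with unit normal `ν`. -/
def angle (F ν : Plane → Minkowski) (x : Plane) : ℝ := mink (ν x) (M.radialField (F x))

/-- A closed surface is a geodesic graph over `Σ` if its angle function has a positive lower
bound. -/
def IsGeodesicGraph (F ν : Plane → Minkowski) : Prop := ∃ c₀ > 0, ∀ x, c₀ ≤ M.angle F ν x

/-- `F : [0,T) × Σ → M` (lifted to the universal covers) is a smooth solution of the modified mean
curvature flow `∂F/∂t = -(H - c) ν`, where `ν` is a continuous unit normal field along `F` and `H`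
is the mean curvature with respect to `ν`. -/
structure IsMMCF (c T : ℝ) (F ν : ℝ → Plane → Minkowski) : Prop where
  smooth : ContDiffOn ℝ ∞ (fun q : ℝ × Plane => F q.1 q.2) (Set.Ico 0 T ×ˢ Set.univ)
  normal_continuous :
    ContinuousOn (fun q : ℝ × Plane => ν q.1 q.2) (Set.Ico 0 T ×ˢ Set.univ)
  surface : ∀ t ∈ Set.Ico 0 T, ∀ x, IsImmersedWithNormalAt (F t) (ν t) x
  equivariant : ∀ t ∈ Set.Ico 0 T, ∀ (γ : M.Γ) x,
    F t (M.deck γ x) = (γ : Minkowski ≃ₗ[ℝ] Minkowski) (F t x)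
  evolution : ∀ t ∈ Set.Ico 0 T, ∀ x,
    HasDerivWithinAt (fun s => F s x) (-(meanCurvature (F t) (ν t) x - c) • ν t x)
      (Set.Ico 0 T) t

end AlmostFuchsian

end

/-! The flow is studied in the hyperboloid model. Every point `p` of `ℍ³` has a unique foot point on
the minimal surface: the function `φ(x) = -⟨f x, p⟩`, the hyperbolic cosine of the distance to `p`,
is proper, and as the principal curvatures of `Σ` lie in `(-1, 1)`, all its critical points are
nondegenerate minima, so that by the mountain pass principle there is only one
(`critical_point_unique`, `AlmostFuchsian.isFoot_unique`). The nearest point projection is smooth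
(`AlmostFuchsian.contDiffAt_foot`), and so is the function `m(p)`, the normal of `Σ` at the foot
point of `p` (`AlmostFuchsian.footNormal`). The geometry of the foliation by equidistant surfaces is
encoded in `m`: at signed distance `r` from `Σ` one has `⟨p, m⟩ = sinh r`, and the tangential part of
`m` at `p` is `cosh r ∂/∂r`. Hence the angle of a surface `F` with normal `ν` is
`Θ = ⟨ν, m⟩ / cosh r` (`AlmostFuchsian.angle_eq`).

The vector `m` would be constant if `Σ` were totally geodesic. In general its first and second
derivatives in unit directions are `O(ε / cosh r)`, where `ε` bounds `|A_Σ|` and `|∇A_Σ|`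
(`AlmostFuchsian.abs_dd_footNormal_le`, `AlmostFuchsian.abs_dd_dd_footNormal_le`). Along the flow the
height `s = ⟨F, m⟩ = sinh r` and the function `p = ⟨ν, m⟩` satisfy parabolic equations
(`IsNormalFlow.dd_height_time`, `IsNormalFlow.laplacian_height`, `IsNormalFlow.angle_evolution`),
whose error terms contain only these derivatives of `m`. The equations are computed in space-time,
where position and normal are functions on `ℝ × ℝ²`.

The theorem follows from the maximum principle on the compact surface, applied at the first time at
which one of the following barriers is reached (`AlmostFuchsian.exists_first_contact`,
`contact_derivatives`). As long as `p > 0`, the surface stays in the region `2 tanh r ≥ c` and below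
its initial leaf (`AlmostFuchsian.IsMMCF.height_lower`, `AlmostFuchsian.IsMMCF.height_upper`). As long
as this holds, `p` stays above the barrier `cosh r - δ / cosh² r`, where `δ = ε₁ / (3 (16 + ε₁))`:
at a first contact the evolution equation has a gain of `1.1 δ / cosh⁴ r`, against errors of size
at most `80 ε / cosh r` (`barrier_strict`), and the upper bound for the initial `r` is what
makes `80 ε cosh³ r < 1.1 δ` along the flow (`curvature_small`). As the barrier is positive, the
three bounds support each other for all times (`AlmostFuchsian.IsMMCF.barrier_lt`). They imply
`Θ ≥ 1 - δ / cosh³ r ≥ 1 - δ ≥ 1 / (1 + ε₁ / 8)`. -/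

section

open Filter Topology Set

/-! ### Minkowski space -/

lemma mink_comm (v w : Minkowski) : mink v w = mink w v := by simp only [mink]; ring

lemma mink_add_left (u v w : Minkowski) : mink (u + v) w = mink u w + mink v w := by
  simp only [mink, Pi.add_apply]; ring

lemma mink_add_right (u v w : Minkowski) : mink w (u + v) = mink w u + mink w v := by
  simp only [mink, Pi.add_apply]; ring

lemma mink_sub_left (u v w : Minkowski) : mink (u - v) w = mink u w - mink v w := by
  simp only [mink, Pi.sub_apply]; ring

lemma mink_sub_right (u v w : Minkowski) : mink w (u - v) = mink w u - mink w v := by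
  simp only [mink, Pi.sub_apply]; ring

lemma mink_smul_left (a : ℝ) (v w : Minkowski) : mink (a • v) w = a * mink v w := by
  simp only [mink, Pi.smul_apply, smul_eq_mul]; ring

lemma mink_smul_right (a : ℝ) (v w : Minkowski) : mink w (a • v) = a * mink w v := by
  simp only [mink, Pi.smul_apply, smul_eq_mul]; ring

lemma mink_neg_left (v w : Minkowski) : mink (-v) w = -mink v w := by
  simp only [mink, Pi.neg_apply]; ring

lemma mink_neg_right (v w : Minkowski) : mink w (-v) = -mink w v := by
  simp only [mink, Pi.neg_apply]; ring

lemma mink_zero_left (w : Minkowski) : mink 0 w = 0 := by simp [mink]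

lemma mink_zero_right (w : Minkowski) : mink w 0 = 0 := by simp [mink]

/-- The Minkowski inner product as a continuous bilinear map. -/
noncomputable def minkCLM : Minkowski →L[ℝ] Minkowski →L[ℝ] ℝ :=
  (LinearMap.mk₂ ℝ mink mink_add_left mink_smul_left (fun w u v => mink_add_right u v w)
    (fun a w v => mink_smul_right a v w)).toContinuousBilinearMap

@[simp] lemma minkCLM_apply (v w : Minkowski) : minkCLM v w = mink v w := rfl

lemma eq_zero_of_mink_eq_zero {v : Minkowski} (h : ∀ w, mink v w = 0) : v = 0 := by
  have h0 := h (Pi.single 0 1)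
  have h1 := h (Pi.single 1 1)
  have h2 := h (Pi.single 2 1)
  have h3 := h (Pi.single 3 1)
  simp [mink] at h0 h1 h2 h3
  ext i
  fin_cases i <;> simp [h0, h1, h2, h3]

lemma eq_of_mink_eq {u v : Minkowski} (h : ∀ w, mink u w = mink v w) : u = v :=
  sub_eq_zero.1 (eq_zero_of_mink_eq_zero fun w => by rw [mink_sub_left, h, sub_self])

/-- A Lorentz orthonormal basis of Minkowski space, with the timelike vector first. -/
structure IsLorentzFrame (e₀ e₁ e₂ e₃ : Minkowski) : Prop where
  h00 : mink e₀ e₀ = -1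
  h01 : mink e₀ e₁ = 0
  h02 : mink e₀ e₂ = 0
  h03 : mink e₀ e₃ = 0
  h11 : mink e₁ e₁ = 1
  h12 : mink e₁ e₂ = 0
  h13 : mink e₁ e₃ = 0
  h22 : mink e₂ e₂ = 1
  h23 : mink e₂ e₃ = 0
  h33 : mink e₃ e₃ = 1

/-- Parseval's identity for a Lorentz frame. -/
lemma IsLorentzFrame.parseval {e₀ e₁ e₂ e₃ : Minkowski} (h : IsLorentzFrame e₀ e₁ e₂ e₃)
    (v w : Minkowski) :
    mink v w = -(mink v e₀ * mink w e₀) + mink v e₁ * mink w e₁ + mink v e₂ * mink w e₂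
      + mink v e₃ * mink w e₃ := by
  let B : Matrix (Fin 4) (Fin 4) ℝ := fun i => ![e₀, e₁, e₂, e₃] i
  let η : Matrix (Fin 4) (Fin 4) ℝ := Matrix.diagonal ![-1, 1, 1, 1]
  have hη : η * η = 1 := by
    simp only [η, Matrix.diagonal_mul_diagonal, ← Matrix.diagonal_one]
    congr 1; ext i; fin_cases i <;> simp
  have hB : B * η * B.transpose = η := by
    ext i j
    have e : ∀ i j, (B * η * B.transpose) i j = mink (B i) (B j) := by
      intro i j
      simp only [η, Matrix.mul_apply, Matrix.transpose_apply, Matrix.mul_diagonal, mink,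
        Fin.sum_univ_four]
      simp
    rw [e]
    obtain ⟨h00, h01, h02, h03, h11, h12, h13, h22, h23, h33⟩ := h
    fin_cases i <;> fin_cases j <;>
      simp [B, η, h00, h01, h02, h03, h11, h12, h13, h22, h23, h33, mink_comm e₁ e₀,
        mink_comm e₂ e₀, mink_comm e₃ e₀, mink_comm e₂ e₁, mink_comm e₃ e₁, mink_comm e₃ e₂]
  have h1 : (B * η) * (B.transpose * η) = 1 := by
    rw [← Matrix.mul_assoc, hB, hη]
  have h2 := mul_eq_one_comm.1 h1
  have h3 : B.transpose * η * B = η := by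
    calc B.transpose * η * B = (B.transpose * η * (B * η)) * η := by
          simp only [Matrix.mul_assoc, hη, Matrix.mul_one]
      _ = η := by rw [h2, Matrix.one_mul]
  have key : ∀ i j, -(e₀ i * e₀ j) + e₁ i * e₁ j + e₂ i * e₂ j + e₃ i * e₃ j = η i j := by
    intro i j
    have e : (B.transpose * η * B) i j
        = -(B 0 i * B 0 j) + B 1 i * B 1 j + B 2 i * B 2 j + B 3 i * B 3 j := by
      simp only [η, Matrix.mul_apply, Matrix.transpose_apply, Fin.sum_univ_four]
      simp
    rw [← h3, e]
    simp [B]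
  have k00 := key 0 0
  have k01 := key 0 1
  have k02 := key 0 2
  have k03 := key 0 3
  have k11 := key 1 1
  have k12 := key 1 2
  have k13 := key 1 3
  have k22 := key 2 2
  have k23 := key 2 3
  have k33 := key 3 3
  simp [η] at k00 k01 k02 k03 k11 k12 k13 k22 k23 k33
  simp only [mink]
  linear_combination (-1 : ℝ) * (v 0 * w 0) * k00 + (v 0 * w 1 + v 1 * w 0) * k01
    + (v 0 * w 2 + v 2 * w 0) * k02 + (v 0 * w 3 + v 3 * w 0) * k03 - v 1 * w 1 * k11
    - (v 1 * w 2 + v 2 * w 1) * k12 - (v 1 * w 3 + v 3 * w 1) * k13 - v 2 * w 2 * k22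
    - (v 2 * w 3 + v 3 * w 2) * k23 - v 3 * w 3 * k33

/-- The expansion of a vector in a Lorentz frame. -/
lemma IsLorentzFrame.expand {e₀ e₁ e₂ e₃ : Minkowski} (h : IsLorentzFrame e₀ e₁ e₂ e₃)
    (v : Minkowski) :
    v = -(mink v e₀ • e₀) + mink v e₁ • e₁ + mink v e₂ • e₂ + mink v e₃ • e₃ := by
  refine eq_of_mink_eq fun w => ?_
  rw [h.parseval v w]
  simp only [mink_add_left, mink_smul_left, mink_neg_left]
  rw [mink_comm w e₀, mink_comm w e₁, mink_comm w e₂, mink_comm w e₃]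

/-- The open future cone of timelike vectors. -/
def futureCone : Set Minkowski := {p | mink p p < 0 ∧ 0 < p 0}

lemma Hyp3_subset_futureCone : Hyp3 ⊆ futureCone := fun p hp => ⟨by rw [hp.1]; norm_num, hp.2⟩

lemma continuous_mink : Continuous fun q : Minkowski × Minkowski => mink q.1 q.2 := by
  unfold mink; fun_prop

lemma isOpen_futureCone : IsOpen futureCone := by
  refine IsOpen.and (isOpen_lt ?_ continuous_const) (isOpen_lt continuous_const ?_)
  · exact continuous_mink.comp (continuous_id.prodMk continuous_id)
  · exact continuous_apply 0

lemma spatial_lt_of_timelike {p : Minkowski} (hp : mink p p < 0) :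
    p 1 ^ 2 + p 2 ^ 2 + p 3 ^ 2 < p 0 ^ 2 := by simp only [mink] at hp; nlinarith

/-- A nonzero vector orthogonal to a timelike one is spacelike. -/
lemma mink_self_pos {p v : Minkowski} (hp : mink p p < 0) (hv : mink v p = 0) (h0 : v ≠ 0) :
    0 < mink v v := by
  have hlt := spatial_lt_of_timelike hp
  have hcs : (v 0 * p 0) ^ 2 ≤ (v 1 ^ 2 + v 2 ^ 2 + v 3 ^ 2) * (p 1 ^ 2 + p 2 ^ 2 + p 3 ^ 2) := by
    have : v 0 * p 0 = v 1 * p 1 + v 2 * p 2 + v 3 * p 3 := by simp only [mink] at hv; linarith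
    rw [this]
    nlinarith [sq_nonneg (v 1 * p 2 - v 2 * p 1), sq_nonneg (v 1 * p 3 - v 3 * p 1),
      sq_nonneg (v 2 * p 3 - v 3 * p 2)]
  have hp0 : 0 < p 0 ^ 2 := lt_of_le_of_lt (by positivity) hlt
  have hs : 0 < v 1 ^ 2 + v 2 ^ 2 + v 3 ^ 2 := by
    rcases (show 0 ≤ v 1 ^ 2 + v 2 ^ 2 + v 3 ^ 2 by positivity).lt_or_eq with h | h
    · exact h
    · exfalso
      apply h0
      rw [← h, zero_mul] at hcs
      have h1 : v 1 ^ 2 = 0 := by nlinarith [sq_nonneg (v 1), sq_nonneg (v 2), sq_nonneg (v 3)]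
      have h2 : v 2 ^ 2 = 0 := by nlinarith [sq_nonneg (v 1), sq_nonneg (v 2), sq_nonneg (v 3)]
      have h3 : v 3 ^ 2 = 0 := by nlinarith [sq_nonneg (v 1), sq_nonneg (v 2), sq_nonneg (v 3)]
      have h4 : v 0 * p 0 = 0 := by nlinarith [sq_nonneg (v 0 * p 0)]
      have h5 : v 0 = 0 := by
        rcases mul_eq_zero.1 h4 with h | h
        · exact h
        · rw [h] at hp0; norm_num at hp0
      ext i
      fin_cases i
      · exact h5
      · simpa using h1
      · simpa using h2
      · simpa using h3
  have : v 0 ^ 2 * p 0 ^ 2 < (v 1 ^ 2 + v 2 ^ 2 + v 3 ^ 2) * p 0 ^ 2 := by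
    nlinarith [mul_lt_mul_of_pos_left hlt hs]
  have := lt_of_mul_lt_mul_right this hp0.le
  simp only [mink]; nlinarith

/-- Vectors of the future cone have negative inner product with points of `ℍ³`; more precisely the
time coordinate of a point `q` of `ℍ³` is controlled by `-⟨q, p⟩`. -/
lemma exists_time_le_mink {p : Minkowski} (hp : p ∈ futureCone) :
    ∃ a > 0, ∀ q ∈ Hyp3, a * q 0 ≤ -mink q p := by
  have hlt := spatial_lt_of_timelike hp.1
  set b := Real.sqrt (p 1 ^ 2 + p 2 ^ 2 + p 3 ^ 2) with hb
  have hb2 : b ^ 2 = p 1 ^ 2 + p 2 ^ 2 + p 3 ^ 2 := Real.sq_sqrt (by positivity)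
  have hb0 : 0 ≤ b := Real.sqrt_nonneg _
  have hbp : b < p 0 := by
    refine lt_of_pow_lt_pow_left₀ 2 hp.2.le (by rw [hb2]; exact hlt)
  refine ⟨p 0 - b, by linarith, fun q hq => ?_⟩
  have hq1 : q 1 ^ 2 + q 2 ^ 2 + q 3 ^ 2 ≤ q 0 ^ 2 := by
    have := hq.1; simp only [mink] at this; nlinarith
  have : q 1 * p 1 + q 2 * p 2 + q 3 * p 3 ≤ q 0 * b := by
    refine le_of_sq_le_sq ?_ (mul_nonneg hq.2.le hb0) |> fun h => h
    rw [mul_pow, hb2]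
    calc (q 1 * p 1 + q 2 * p 2 + q 3 * p 3) ^ 2
        ≤ (q 1 ^ 2 + q 2 ^ 2 + q 3 ^ 2) * (p 1 ^ 2 + p 2 ^ 2 + p 3 ^ 2) := by
          nlinarith [sq_nonneg (q 1 * p 2 - q 2 * p 1), sq_nonneg (q 1 * p 3 - q 3 * p 1),
            sq_nonneg (q 2 * p 3 - q 3 * p 2)]
      _ ≤ _ := by gcongr
  simp only [mink]; nlinarith

/-! ### Directional derivatives -/

section DirectionalDerivatives

variable {E F G : Type*} [NormedAddCommGroup E] [NormedSpace ℝ E] [NormedAddCommGroup F]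
  [NormedSpace ℝ F] [NormedAddCommGroup G] [NormedSpace ℝ G]

/-- The derivative of `A` in the constant direction `v`. -/
noncomputable def dd (v : E) (A : E → F) (x : E) : F := fderiv ℝ A x v

lemma pd_eq_dd (i : Fin 2) (A : Plane → F) : pd i A = dd (Pi.single i 1) A := rfl

lemma dd_add_dir (v w : E) (A : E → F) (x : E) : dd (v + w) A x = dd v A x + dd w A x := by
  simp [dd]

lemma dd_smul_dir (a : ℝ) (v : E) (A : E → F) (x : E) : dd (a • v) A x = a • dd v A x := by
  simp [dd]

lemma Filter.EventuallyEq.dd_eq {A B : E → F} {x : E} (h : A =ᶠ[𝓝 x] B) (v : E) :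
    dd v A x = dd v B x := by simp only [dd, h.fderiv_eq (𝕜 := ℝ)]

@[simp] lemma dd_const (v : E) (c : F) (x : E) : dd v (fun _ => c) x = 0 := by simp [dd]

lemma dd_add {A B : E → F} {x : E} (hA : DifferentiableAt ℝ A x) (hB : DifferentiableAt ℝ B x)
    (v : E) : dd v (fun y => A y + B y) x = dd v A x + dd v B x := by
  simp [dd, fderiv_fun_add hA hB]

lemma dd_sub {A B : E → F} {x : E} (hA : DifferentiableAt ℝ A x) (hB : DifferentiableAt ℝ B x)
    (v : E) : dd v (fun y => A y - B y) x = dd v A x - dd v B x := by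
  simp [dd, fderiv_fun_sub hA hB]

lemma dd_mul {A B : E → ℝ} {x : E} (hA : DifferentiableAt ℝ A x) (hB : DifferentiableAt ℝ B x)
    (v : E) : dd v (fun y => A y * B y) x = dd v A x * B x + A x * dd v B x := by
  simp only [dd, fderiv_fun_mul hA hB]
  simp
  ring

lemma dd_smul {a : E → ℝ} {B : E → F} {x : E} (hA : DifferentiableAt ℝ a x)
    (hB : DifferentiableAt ℝ B x) (v : E) :
    dd v (fun y => a y • B y) x = dd v a x • B x + a x • dd v B x := by
  simp only [dd, fderiv_fun_smul hA hB]
  simp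
  abel

lemma dd_mink {A B : E → Minkowski} {x : E} (hA : DifferentiableAt ℝ A x)
    (hB : DifferentiableAt ℝ B x) (v : E) :
    dd v (fun y => mink (A y) (B y)) x = mink (dd v A x) (B x) + mink (A x) (dd v B x) := by
  have h := (minkCLM.hasFDerivAt_of_bilinear hA.hasFDerivAt hB.hasFDerivAt).fderiv
  simp only [minkCLM_apply] at h
  simp only [dd, h]
  simp
  ring

lemma dd_clm (L : F →L[ℝ] G) {A : E → F} {x : E} (hA : DifferentiableAt ℝ A x) (v : E) :
    dd v (fun y => L (A y)) x = L (dd v A x) := by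
  have := (L.hasFDerivAt.comp x hA.hasFDerivAt).fderiv
  simp only [dd]
  rw [show (fun y => L (A y)) = L ∘ A from rfl, this]; rfl

lemma dd_comp {A : F → G} {u : E → F} {x : E} (hA : DifferentiableAt ℝ A (u x))
    (hu : DifferentiableAt ℝ u x) (v : E) :
    dd v (fun y => A (u y)) x = dd (dd v u x) A (u x) := by
  have := (hA.hasFDerivAt.comp x hu.hasFDerivAt).fderiv
  simp only [dd]
  rw [show (fun y => A (u y)) = A ∘ u from rfl, this]; rfl

lemma ContDiffAt.dd {A : E → F} {x : E} (h : ContDiffAt ℝ ∞ A x) (v : E) :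
    ContDiffAt ℝ ∞ (dd v A) x :=
  (h.fderiv_right (m := ∞) (by simp)).clm_apply contDiffAt_const

lemma ContDiff.dd {A : E → F} (h : ContDiff ℝ ∞ A) (v : E) : ContDiff ℝ ∞ (dd v A) :=
  contDiff_iff_contDiffAt.2 fun _ => h.contDiffAt.dd v

lemma ContDiffAt.diffAt {A : E → F} {x : E} (h : ContDiffAt ℝ ∞ A x) : DifferentiableAt ℝ A x :=
  h.differentiableAt (by simp)

lemma ContDiff.diffAt {A : E → F} (h : ContDiff ℝ ∞ A) (x : E) : DifferentiableAt ℝ A x :=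
  h.contDiffAt.diffAt

lemma dd_dd_eq {A : E → F} {x : E} (h : ContDiffAt ℝ ∞ A x) (v w : E) :
    dd v (dd w A) x = fderiv ℝ (fderiv ℝ A) x v w := by
  have hd : DifferentiableAt ℝ (fderiv ℝ A) x := (h.fderiv_right (m := ∞) (by simp)).diffAt
  change fderiv ℝ (fun y => fderiv ℝ A y w) x v = _
  rw [fderiv_clm_apply hd (differentiableAt_const w)]
  simp

/-- Directional derivatives commute. -/
lemma dd_comm {A : E → F} {x : E} (h : ContDiffAt ℝ ∞ A x) (v w : E) :
    dd v (dd w A) x = dd w (dd v A) x := by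
  rw [dd_dd_eq h, dd_dd_eq h]
  exact (h.isSymmSndFDerivAt (by simpa using ENat.LEInfty.out)) v w

lemma ContDiffAt.mink {A B : E → Minkowski} {x : E} (hA : ContDiffAt ℝ ∞ A x)
    (hB : ContDiffAt ℝ ∞ B x) : ContDiffAt ℝ ∞ (fun y => mink (A y) (B y)) x := by
  have := (minkCLM.contDiff.contDiffAt.comp x hA).clm_apply hB
  exact this

lemma ContDiff.mink {A B : E → Minkowski} (hA : ContDiff ℝ ∞ A)
    (hB : ContDiff ℝ ∞ B) : ContDiff ℝ ∞ (fun y => mink (A y) (B y)) :=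
  contDiff_iff_contDiffAt.2 fun _ => hA.contDiffAt.mink hB.contDiffAt

lemma dd_eq_zero_of_eventually_const {A : E → F} {x : E} {c : F} (h : ∀ᶠ y in 𝓝 x, A y = c)
    (v : E) : dd v A x = 0 := by
  rw [Filter.EventuallyEq.dd_eq (B := fun _ => c) h]; simp

lemma plane_eq (v : Plane) : v = v 0 • (Pi.single 0 1 : Plane) + v 1 • (Pi.single 1 1 : Plane) := by
  ext i; fin_cases i <;> simp

lemma dd_eq_pd (v : Plane) (A : Plane → F) (x : Plane) :
    dd v A x = v 0 • pd 0 A x + v 1 • pd 1 A x := by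
  conv_lhs => rw [plane_eq v]
  rw [dd_add_dir, dd_smul_dir, dd_smul_dir]; rfl

end DirectionalDerivatives

/-! ### Critical points of proper functions -/

section CriticalPoints

variable {E : Type*} [NormedAddCommGroup E] [NormedSpace ℝ E]

lemma hasDerivAt_line {φ : E → ℝ} (hφ : Differentiable ℝ φ) (y v : E) (t : ℝ) :
    HasDerivAt (fun t : ℝ => φ (y + t • v)) (fderiv ℝ φ (y + t • v) v) t := by
  have h1 : HasDerivAt (fun t : ℝ => y + t • v) v t := by
    simpa using ((hasDerivAt_id t).smul_const v).const_add y
  exact (hφ _).hasFDerivAt.comp_hasDerivAt t h1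

/-- At a nondegenerate critical point with positive Hessian a function has a strict local minimum. -/
lemma strict_min_of_hessian_pos [FiniteDimensional ℝ E] {φ : E → ℝ} (hφ : ContDiff ℝ ∞ φ) {x : E}
    (hx : fderiv ℝ φ x = 0) (hpos : ∀ v ≠ 0, 0 < fderiv ℝ (fderiv ℝ φ) x v v) :
    ∀ᶠ y in 𝓝[≠] x, φ x < φ y := by
  have hφ1 : ContDiff ℝ ∞ (fderiv ℝ φ) := hφ.fderiv_right (by simp)
  have hφ2 : ContDiff ℝ ∞ (fderiv ℝ (fderiv ℝ φ)) := hφ1.fderiv_right (by simp)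
  have hd : Differentiable ℝ φ := hφ.differentiable (by simp)
  have hd1 : Differentiable ℝ (fderiv ℝ φ) := hφ1.differentiable (by simp)
  have hc2 : Continuous fun q : E × E => fderiv ℝ (fderiv ℝ φ) q.1 q.2 q.2 :=
    ((hφ2.continuous.comp continuous_fst).clm_apply continuous_snd).clm_apply continuous_snd
  have hev : ∀ᶠ z in 𝓝 x, ∀ v ∈ Metric.sphere (0 : E) 1, 0 < fderiv ℝ (fderiv ℝ φ) z v v := by
    refine (isCompact_sphere (0 : E) 1).eventually_forall_of_forall_eventually fun v hv => ?_
    refine continuousAt_const.eventually_lt hc2.continuousAt (hpos v ?_)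
    rintro rfl
    simp at hv
  obtain ⟨ρ, hρ, hball⟩ := Metric.eventually_nhds_iff_ball.1 hev
  rw [eventually_nhdsWithin_iff]
  filter_upwards [Metric.ball_mem_nhds x hρ] with y hy hyx
  set v := y - x with hv
  have hv0 : v ≠ 0 := sub_ne_zero.2 hyx
  have hvn : 0 < ‖v‖ := norm_pos_iff.2 hv0
  have hvρ : ‖v‖ < ρ := by simpa [hv, dist_eq_norm] using hy
  have g1 : ∀ t : ℝ, HasDerivAt (fun t : ℝ => φ (x + t • v)) (fderiv ℝ φ (x + t • v) v) t :=
    hasDerivAt_line hd x v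
  have g2 : ∀ t : ℝ, HasDerivAt (fun t : ℝ => fderiv ℝ φ (x + t • v) v)
      (fderiv ℝ (fderiv ℝ φ) (x + t • v) v v) t := by
    intro t
    have h1 : HasDerivAt (fun t : ℝ => x + t • v) v t := by
      simpa using ((hasDerivAt_id t).smul_const v).const_add x
    have h2 := (hd1 (x + t • v)).hasFDerivAt.comp_hasDerivAt t h1
    simpa using h2.clm_apply (hasDerivAt_const t v)
  obtain ⟨c, hc, hc'⟩ := exists_hasDerivAt_eq_slope (fun t : ℝ => φ (x + t • v))
    (fun t => fderiv ℝ φ (x + t • v) v) one_pos (fun t _ => (g1 t).continuousAt.continuousWithinAt)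
    (fun t _ => g1 t)
  obtain ⟨d, hdc, hd'⟩ := exists_hasDerivAt_eq_slope (fun t : ℝ => fderiv ℝ φ (x + t • v) v)
    (fun t => fderiv ℝ (fderiv ℝ φ) (x + t • v) v v) hc.1
    (fun t _ => (g2 t).continuousAt.continuousWithinAt) (fun t _ => g2 t)
  have hpos2 : 0 < fderiv ℝ (fderiv ℝ φ) (x + d • v) v v := by
    have hz : x + d • v ∈ Metric.ball x ρ := by
      rw [mem_ball_iff_norm, add_sub_cancel_left, norm_smul, Real.norm_eq_abs, abs_of_pos hdc.1]
      have : d < 1 := hdc.2.trans hc.2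
      nlinarith [hdc.1]
    have h1 := hball _ hz (‖v‖⁻¹ • v) (by simp [norm_smul, hvn.ne'])
    simp only [map_smul, _root_.smul_apply, smul_eq_mul] at h1
    have h2 : (0 : ℝ) < ‖v‖⁻¹ := inv_pos.2 hvn
    exact (mul_pos_iff_of_pos_left h2).1 ((mul_pos_iff_of_pos_left h2).1 h1)
  have hpos1 : 0 < fderiv ℝ φ (x + c • v) v := by
    simp only [zero_smul, add_zero, hx, _root_.zero_apply, sub_zero] at hd'
    rw [hd'] at hpos2
    exact (div_pos_iff_of_pos_right hc.1).1 hpos2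
  rw [hc'] at hpos1
  simpa [hv] using hpos1

/-- The second derivatives of a function are nonnegative at a local minimum. -/
lemma IsLocalMin.dd_dd_nonneg {φ : E → ℝ} {x : E} (hφ : ContDiffAt ℝ ∞ φ x)
    (h : IsLocalMin φ x) (w : E) : 0 ≤ dd w (dd w φ) x := by
  by_contra! hneg
  have hl : ContinuousAt (fun t : ℝ => x + t • w) 0 := by fun_prop
  have hl' : Tendsto (fun t : ℝ => x + t • w) (𝓝 0) (𝓝 x) := by
    simpa [ContinuousAt] using hl
  have hline : ∀ t : ℝ, HasDerivAt (fun t : ℝ => x + t • w) w t := fun t => by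
    simpa using ((hasDerivAt_id t).smul_const w).const_add x
  have hev : ∀ᶠ y in 𝓝 x, DifferentiableAt ℝ φ y := by
    have := (hφ.of_le (show (1 : WithTop ℕ∞) ≤ ∞ from WithTop.coe_le_coe.2 le_top)).eventually
      (by simp)
    exact this.mono fun y hy => hy.differentiableAt (by simp)
  have h1 : deriv (fun t : ℝ => φ (x + t • w)) =ᶠ[𝓝 0] fun t => dd w φ (x + t • w) := by
    filter_upwards [hl'.eventually hev] with t ht
    exact (ht.hasFDerivAt.comp_hasDerivAt t (hline t)).deriv
  have h2 : deriv (deriv (fun t : ℝ => φ (x + t • w))) 0 = dd w (dd w φ) x := by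
    rw [h1.deriv_eq]
    have := (hφ.dd w).diffAt
    rw [show x = x + (0 : ℝ) • w by simp] at this
    have := (this.hasFDerivAt.comp_hasDerivAt (0 : ℝ) (hline 0)).deriv
    simpa [dd, Function.comp_def] using this
  have h3 : deriv (fun t : ℝ => φ (x + t • w)) 0 = 0 := by
    rw [h1.eq_of_nhds]
    simp [dd, h.fderiv_eq_zero]
  have hmax : IsLocalMax (fun t : ℝ => φ (x + t • w)) 0 := by
    have := isLocalMin_of_deriv_deriv_pos (f := fun t : ℝ => -φ (x + t • w)) (x₀ := 0)
      (by simpa [h2] using hneg) (by simpa using h3)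
      (by
        have : ContinuousAt φ (x + (0 : ℝ) • w) := by simpa using hφ.continuousAt
        exact (this.comp (f := fun t : ℝ => x + t • w) hl).neg)
    simpa using this.neg
  have hmin : IsLocalMin (fun t : ℝ => φ (x + t • w)) 0 := by
    have := hl'.eventually h
    simpa [IsLocalMin, IsMinFilter] using this
  have hconst : (fun t : ℝ => φ (x + t • w)) =ᶠ[𝓝 0] fun _ => φ x := by
    filter_upwards [hmax, hmin] with t h1 h2
    simp only [zero_smul, add_zero] at h1 h2
    exact le_antisymm h1 h2
  have : deriv (deriv (fun t : ℝ => φ (x + t • w))) 0 = 0 := by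
    rw [hconst.deriv.deriv_eq]; simp
  rw [h2] at this
  linarith

lemma lt_of_mem_component {φ : E → ℝ} {s : ℝ} {a y : E}
    (h : y ∈ connectedComponentIn {y | φ y < s} a) : φ y < s := by
  have := connectedComponentIn_subset _ _ h
  exact this

/-- Near a regular point of its boundary, an open component of a strict sublevel set is dense in the
closed sublevel set. -/
lemma sublevel_subset_closure_of_regular {φ : E → ℝ} (hφ : ContDiff ℝ ∞ φ) {s : ℝ} {a x : E}
    (hxs : φ x = s) (hx : fderiv ℝ φ x ≠ 0)
    (hcl : x ∈ closure (connectedComponentIn {y | φ y < s} a)) :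
    ∀ᶠ y in 𝓝 x, φ y ≤ s → y ∈ closure (connectedComponentIn {y | φ y < s} a) := by
  set V := connectedComponentIn {y | φ y < s} a with hV
  have hd : Differentiable ℝ φ := hφ.differentiable (by simp)
  -- a descent direction `v`: near `x`, moving along `v` for the time `t ≤ t₀` lowers `φ` by `η t`
  obtain ⟨v, hv⟩ : ∃ v, fderiv ℝ φ x v < 0 := by
    by_contra! h
    refine hx (ContinuousLinearMap.ext fun v => le_antisymm ?_ (h v))
    have := h (-v)
    simp only [map_neg] at this
    simpa using this
  set η := -(fderiv ℝ φ x v) / 2 with hη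
  have hη0 : 0 < η := by rw [hη]; linarith
  have hc1 : Continuous fun z => fderiv ℝ φ z v :=
    (hφ.continuous_fderiv (by simp)).clm_apply continuous_const
  have hev : ∀ᶠ z in 𝓝 x, fderiv ℝ φ z v < -η :=
    hc1.continuousAt.eventually_lt continuousAt_const (by rw [hη]; linarith)
  obtain ⟨ρ, hρ, hball⟩ := Metric.eventually_nhds_iff_ball.1 hev
  obtain ⟨t₀, ht₀, ht₀v⟩ : ∃ t₀ > 0, t₀ * ‖v‖ < ρ / 2 := by
    refine ⟨ρ / 2 / (‖v‖ + 1), by positivity, ?_⟩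
    rw [div_mul_eq_mul_div, div_lt_iff₀ (by positivity)]
    nlinarith [norm_nonneg v]
  have desc : ∀ y ∈ Metric.ball x (ρ / 2), ∀ t, 0 < t → t ≤ t₀ → φ (y + t • v) < φ y - η * t := by
    intro y hy t ht htt
    obtain ⟨c, hc, hc'⟩ := exists_hasDerivAt_eq_slope (fun t : ℝ => φ (y + t • v))
      (fun t => fderiv ℝ φ (y + t • v) v) ht
      (fun t _ => (hasDerivAt_line hd y v t).continuousAt.continuousWithinAt)
      (fun t _ => hasDerivAt_line hd y v t)
    have hz : y + c • v ∈ Metric.ball x ρ := by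
      rw [mem_ball_iff_norm] at hy ⊢
      calc ‖y + c • v - x‖ = ‖(y - x) + c • v‖ := by congr 1; abel
        _ ≤ ‖y - x‖ + c * ‖v‖ := by
          refine (norm_add_le _ _).trans ?_
          rw [norm_smul, Real.norm_eq_abs, abs_of_pos hc.1]
        _ ≤ ‖y - x‖ + t₀ * ‖v‖ := by
          gcongr
          exact hc.2.le.trans htt
        _ < ρ := by linarith
    have := hball _ hz
    rw [hc', div_lt_iff₀ (by linarith)] at this
    simp only [zero_smul, add_zero] at this
    linarith
  have hev2 : ∀ᶠ y in 𝓝 x, φ y < s + η * t₀ :=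
    hφ.continuous.continuousAt.eventually_lt continuousAt_const
      (by rw [hxs]; have := mul_pos hη0 ht₀; linarith)
  obtain ⟨r₀, hr₀, hball2⟩ := Metric.eventually_nhds_iff_ball.1 hev2
  set r₁ := min r₀ (ρ / 2) with hr₁
  have hr₁0 : 0 < r₁ := lt_min hr₀ (by linarith)
  have hr₁ρ : Metric.ball x r₁ ⊆ Metric.ball x (ρ / 2) := Metric.ball_subset_ball (min_le_right _ _)
  obtain ⟨z, hzV, hz⟩ := Metric.mem_closure_iff.1 hcl r₁ hr₁0
  rw [dist_comm] at hz
  have hzs : φ z < s := lt_of_mem_component hzV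
  have hVeq : V = connectedComponentIn {y | φ y < s} z := connectedComponentIn_eq hzV
  have lineconn : ∀ (y : E) (t : ℝ), IsPreconnected ((fun τ : ℝ => y + τ • v) '' Icc t t₀) :=
    fun y t => isPreconnected_Icc.image _ (by fun_prop)
  filter_upwards [Metric.ball_mem_nhds x hr₁0] with y hy hys
  -- `z` and `y + t v` are joined below the level `s`: descend from `z` for the time `t₀`, cross the
  -- translated ball, and go back up to `y + t v`
  have key : ∀ t, 0 < t → t ≤ t₀ → y + t • v ∈ V := by
    intro t ht htt
    set A := (fun τ : ℝ => z + τ • v) '' Icc 0 t₀ with hA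
    set B := (fun u => u + t₀ • v) '' Metric.ball x r₁ with hB
    set D := (fun τ : ℝ => y + τ • v) '' Icc t t₀ with hD
    have hBc : IsPreconnected B :=
      (convex_ball x r₁).isPreconnected.image _ (by fun_prop)
    have hAB : IsPreconnected (A ∪ B) :=
      (lineconn z 0).union (z + t₀ • v) ⟨t₀, ⟨ht₀.le, le_rfl⟩, rfl⟩ ⟨z, hz, rfl⟩ hBc
    have hABD : IsPreconnected (A ∪ B ∪ D) :=
      hAB.union (y + t₀ • v) (Or.inr ⟨y, hy, rfl⟩) ⟨t₀, ⟨htt, le_rfl⟩, rfl⟩ (lineconn y t)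
    have hsub : A ∪ B ∪ D ⊆ {y | φ y < s} := by
      rintro u ((⟨τ, hτ, rfl⟩ | ⟨u, hu, rfl⟩) | ⟨τ, hτ, rfl⟩)
      · rcases hτ.1.eq_or_lt with h | h
        · simpa [← h] using hzs
        · have := desc z (hr₁ρ hz) τ h hτ.2
          have := mul_pos hη0 h
          simp only [mem_ofPred_eq]; linarith
      · have := desc u (hr₁ρ hu) t₀ ht₀ le_rfl
        have := hball2 u (Metric.ball_subset_ball (min_le_left _ _) hu)
        simp only [mem_ofPred_eq]; linarith
      · have h : 0 < τ := ht.trans_le hτ.1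
        have := desc y (hr₁ρ hy) τ h hτ.2
        have := mul_pos hη0 h
        simp only [mem_ofPred_eq]; linarith
    rw [hVeq]
    exact hABD.subset_connectedComponentIn (Or.inl (Or.inl ⟨0, ⟨le_rfl, ht₀.le⟩, by simp⟩)) hsub
      (Or.inr ⟨t, ⟨le_rfl, htt⟩, rfl⟩)
  have hlim : Tendsto (fun t : ℝ => y + t • v) (𝓝[>] 0) (𝓝 y) := by
    have : ContinuousAt (fun t : ℝ => y + t • v) 0 := by fun_prop
    have h := this.tendsto
    simp only [zero_smul, add_zero] at h
    exact h.mono_left nhdsWithin_le_nhds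
  refine mem_closure_of_tendsto hlim ?_
  filter_upwards [Ioc_mem_nhdsGT ht₀] with t ht
  exact key t ht.1 ht.2

/-- The mountain pass principle: a proper function all of whose critical points are strict local
minima has at most one critical point. -/
theorem critical_point_unique {φ : E → ℝ} (hφ : ContDiff ℝ ∞ φ)
    (hproper : ∀ B, IsCompact {x | φ x ≤ B})
    (hcrit : ∀ x, fderiv ℝ φ x = 0 → ∀ᶠ y in 𝓝[≠] x, φ x < φ y) {a b : E}
    (ha : fderiv ℝ φ a = 0) (hb : fderiv ℝ φ b = 0) : a = b := by
  by_contra hab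
  have hcont := hφ.continuous
  -- the levels at which `a` and `b` can be joined
  set S := {s : ℝ | b ∈ connectedComponentIn {y | φ y < s} a} with hS
  have hSa : ∀ s ∈ S, φ a < s := by
    intro s hs
    by_contra h
    rw [hS, mem_ofPred_eq, connectedComponentIn_eq_empty (by simpa using h)] at hs
    exact hs
  have hbdd : BddBelow S := ⟨φ a, fun s hs => (hSa s hs).le⟩
  have hjoin : ∀ (s : ℝ) (A : Set E), IsPreconnected A → a ∈ A → b ∈ A → (∀ y ∈ A, φ y < s) →
      s ∈ S := fun s A hA haA hbA h => hA.subset_connectedComponentIn haA h hbA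
  have hne : S.Nonempty := by
    obtain ⟨B, hB⟩ := (isCompact_Icc (a := (0 : ℝ)) (b := 1)).bddAbove_image
      (f := fun t : ℝ => φ (AffineMap.lineMap a b t)) (by
        exact (hcont.comp AffineMap.lineMap_continuous).continuousOn)
    refine ⟨B + 1, hjoin _ (segment ℝ a b) (convex_segment a b).isPreconnected
      (left_mem_segment ℝ a b) (right_mem_segment ℝ a b) fun y hy => ?_⟩
    rw [segment_eq_image_lineMap] at hy
    obtain ⟨t, ht, rfl⟩ := hy
    have := hB ⟨t, ht, rfl⟩
    simp only at this
    linarith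
  set s₀ := sInf S with hs₀
  have hgt : ∀ s, s₀ < s → s ∈ S := by
    intro s hs
    obtain ⟨s', hs', hlt⟩ := exists_lt_of_csInf_lt hne hs
    exact connectedComponentIn_mono a (fun y hy => lt_trans hy hlt) hs'
  set K := {y | φ y ≤ s₀} with hK
  have haK : φ a ≤ s₀ := le_csInf hne fun s hs => (hSa s hs).le
  have hbK : φ b ≤ s₀ := le_csInf hne fun s hs =>
    (lt_of_mem_component hs).le
  have hKclosed : IsClosed K := isClosed_le hcont continuous_const
  -- a relatively clopen part of the sublevel set which contains `a` also contains `b`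
  have hsep : ∀ D ⊆ K, IsClosed D → IsClosed (K \ D) → a ∈ D → b ∈ D := by
    intro D hDK hD hKD haD
    by_contra hbD
    obtain ⟨O₁, O₂, hO₁, hO₂, hDO, hKO, hdisj⟩ := normal_separation hD hKD disjoint_sdiff_right
    -- otherwise `a` and `b` are separated already at a level above `s₀`, by compactness
    obtain ⟨s, hs, hsO⟩ : ∃ s, s₀ < s ∧ {y | φ y ≤ s} ⊆ O₁ ∪ O₂ := by
      by_contra! hcon
      have hex : ∀ k : ℕ, ((⋂ i ∈ Finset.range (k + 1), {y | φ y ≤ s₀ + 1 / ((i : ℝ) + 1)})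
          ∩ (O₁ ∪ O₂)ᶜ).Nonempty := by
        intro k
        obtain ⟨y, hy, hyO⟩ := not_subset.1 (hcon (s₀ + 1 / ((k : ℝ) + 1))
          (by have : (0 : ℝ) < 1 / ((k : ℝ) + 1) := by positivity
              linarith))
        refine ⟨y, mem_iInter₂.2 fun i hi => ?_, hyO⟩
        have hik : (i : ℝ) ≤ k := by
          exact_mod_cast Nat.lt_succ_iff.1 (Finset.mem_range.1 hi)
        have : 1 / ((k : ℝ) + 1) ≤ 1 / ((i : ℝ) + 1) := by gcongr
        simp only [mem_ofPred_eq] at hy ⊢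
        linarith
      have hcl : IsClosed (O₁ ∪ O₂)ᶜ := (hO₁.union hO₂).isClosed_compl
      obtain ⟨y, hy⟩ := IsCompact.nonempty_iInter_of_sequence_nonempty_isCompact_isClosed
        (fun k : ℕ => {y | φ y ≤ s₀ + 1 / ((k : ℝ) + 1)} ∩ (O₁ ∪ O₂)ᶜ)
        (fun k y hy => ⟨by
          have : 1 / (((k + 1 : ℕ) : ℝ) + 1) ≤ 1 / ((k : ℝ) + 1) := by
            push_cast; gcongr; linarith
          have h1 := hy.1
          simp only [mem_ofPred_eq] at h1 ⊢
          linarith, hy.2⟩)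
        (fun k => by
          obtain ⟨y, hy, hyO⟩ := hex k
          exact ⟨y, mem_iInter₂.1 hy k (Finset.mem_range.2 (Nat.lt_succ_self k)), hyO⟩)
        ((hproper _).inter_right hcl)
        (fun k => (isClosed_le hcont continuous_const).inter hcl)
      rw [mem_iInter] at hy
      have hyK : y ∈ K := by
        refine ge_of_tendsto' (f := fun k : ℕ => s₀ + 1 / ((k : ℝ) + 1)) (a := s₀) (b := φ y)
          (x := atTop) ?_ fun k => (hy k).1
        simpa using tendsto_one_div_add_atTop_nhds_zero_nat.const_add s₀
      refine (hy 0).2 ?_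
      by_cases hyD : y ∈ D
      · exact Or.inl (hDO hyD)
      · exact Or.inr (hKO ⟨hyK, hyD⟩)
    have hbs : b ∈ connectedComponentIn {y | φ y < s} a := hgt s hs
    obtain ⟨y, -, hy1, hy2⟩ := (isPreconnected_connectedComponentIn (x := a) (F := {y | φ y < s}))
      O₁ O₂ hO₁ hO₂ (fun y hy => hsO (show φ y ≤ s from
        (lt_of_mem_component hy).le))
      ⟨a, mem_connectedComponentIn (show φ a < s by linarith), hDO haD⟩ ⟨b, hbs, hKO ⟨hbK, hbD⟩⟩
    exact hdisj.le_bot ⟨hy1, hy2⟩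
  -- critical points at the level `s₀` are isolated in the sublevel set
  have hiso : ∀ x, fderiv ℝ φ x = 0 → φ x = s₀ → ∀ᶠ y in 𝓝 x, φ y ≤ s₀ → y = x := by
    intro x hx hxs
    have := hcrit x hx
    rw [eventually_nhdsWithin_iff] at this
    filter_upwards [this] with y hy hys
    by_contra hyx
    have := hy hyx
    linarith
  rcases haK.eq_or_lt with has | has
  · have := hsep {a} (singleton_subset_iff.2 haK) isClosed_singleton (by
      rw [← isOpen_compl_iff, isOpen_iff_mem_nhds]
      intro y hy
      rcases eq_or_ne y a with rfl | hya
      · filter_upwards [hiso y ha has] with z hz hzK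
        exact hzK.2 (hz hzK.1)
      · have : y ∉ K := fun h => hy ⟨h, hya⟩
        filter_upwards [hKclosed.isOpen_compl.mem_nhds this] with z hz hzK
        exact hz hzK.1) rfl
    exact hab (by simpa using this.symm)
  -- the closure of the component `V` of `a` below the level `s₀` is relatively clopen in `K`, as its
  -- boundary contains no critical points
  set V := connectedComponentIn {y | φ y < s₀} a with hV
  have hU : IsOpen {y | φ y < s₀} := isOpen_lt hcont continuous_const
  have hVo : IsOpen V := hU.connectedComponentIn
  have haV : a ∈ V := mem_connectedComponentIn has
  have hclK : closure V ⊆ K :=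
    closure_minimal (fun y hy => (lt_of_mem_component hy).le)
      hKclosed
  have hVU : ∀ y ∈ closure V, φ y < s₀ → y ∈ V := by
    intro y hy hys
    have ho : IsOpen (connectedComponentIn {y | φ y < s₀} y) := hU.connectedComponentIn
    obtain ⟨z, hz1, hz2⟩ := mem_closure_iff.1 hy _ ho (mem_connectedComponentIn hys)
    rw [hV, connectedComponentIn_eq hz2, ← connectedComponentIn_eq hz1]
    exact mem_connectedComponentIn hys
  have hnotcrit : ∀ y ∈ closure V, φ y = s₀ → fderiv ℝ φ y ≠ 0 := by
    intro y hy hys h0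
    obtain ⟨z, hz1, hz2⟩ := mem_closure_iff_nhds.1 hy _ (hiso y h0 hys)
    have hzs : φ z < s₀ := lt_of_mem_component hz2
    have := hz1 hzs.le
    rw [this] at hzs
    linarith
  have hbV' : b ∈ closure V := by
    refine hsep _ hclK isClosed_closure ?_ (subset_closure haV)
    rw [← isOpen_compl_iff, isOpen_iff_mem_nhds]
    intro y hy
    by_cases hyK : y ∈ K
    · have hyV : y ∈ closure V := by
        by_contra h
        exact hy ⟨hyK, h⟩
      rcases (show φ y ≤ s₀ from hyK).eq_or_lt with h | h
      · filter_upwards [sublevel_subset_closure_of_regular hφ h (hnotcrit y hyV h) hyV]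
          with z hz hzK
        exact hzK.2 (hz hzK.1)
      · filter_upwards [hVo.mem_nhds (hVU y hyV h)] with z hz hzK
        exact hzK.2 (subset_closure hz)
    · filter_upwards [hKclosed.isOpen_compl.mem_nhds hyK] with z hz hzK
      exact hz hzK.1
  have hbV : b ∈ V := by
    rcases hbK.eq_or_lt with h | h
    · exact absurd hb (hnotcrit b hbV' h)
    · exact hVU b hbV' h
  -- a path from `a` to `b` in `V` stays strictly below the level `s₀`
  have hpath : IsPathConnected V :=
    (hVo.isConnected_iff_isPathConnected).1 ⟨⟨a, haV⟩, isPreconnected_connectedComponentIn⟩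
  obtain ⟨γ, hγ⟩ := hpath.joinedIn a haV b hbV
  obtain ⟨t, -, ht⟩ := (isCompact_univ (X := unitInterval)).exists_isMaxOn univ_nonempty
    (f := fun t => φ (γ t)) (hcont.comp γ.continuous).continuousOn
  have hts : φ (γ t) < s₀ := lt_of_mem_component (hγ t)
  obtain ⟨s, hs1, hs2⟩ := exists_between hts
  have : s ∈ S := hjoin s (range γ) (isPreconnected_range γ.continuous) ⟨0, γ.source⟩ ⟨1, γ.target⟩
    (by
      rintro _ ⟨τ, rfl⟩
      exact lt_of_le_of_lt (ht (mem_univ τ)) hs1)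
  exact absurd (csInf_le hbdd this) (not_le.2 hs2)

end CriticalPoints

/-! ### Surfaces in `ℍ³`: orthonormal frames and the fundamental forms -/

section Surfaces

/-- A basis `w` of the coordinate plane whose image under `dF` is orthonormal at `x`. -/
def IsTangentFrame (F : Plane → Minkowski) (x : Plane) (w : Fin 2 → Plane) : Prop :=
  ∀ p q, mink (dd (w p) F x) (dd (w q) F x) = if p = q then 1 else 0

/-- The second fundamental form `h(u, v) = -⟨N, D²F(u, v)⟩` as a bilinear form. -/
noncomputable def sff (F N : Plane → Minkowski) (x u v : Plane) : ℝ :=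
  -mink (N x) (dd u (dd v F) x)

/-- The covariant derivative `(∇ᵤ h)(v, z)` of the second fundamental form, expressed in a frame `w`
which is orthonormal at `x`:
the third derivative of `F` in the direction of the normal, corrected by Christoffel terms. The
expression is manifestly symmetric (the Codazzi equation). -/
noncomputable def covSff (F N : Plane → Minkowski) (w : Fin 2 → Plane) (x u v z : Plane) : ℝ :=
  -mink (N x) (dd u (dd v (dd z F)) x)
    - ∑ q, (mink (dd v (dd z F) x) (dd (w q) F x) * sff F N x u (w q)
      + mink (dd u (dd v F) x) (dd (w q) F x) * sff F N x (w q) z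
      + mink (dd u (dd z F) x) (dd (w q) F x) * sff F N x v (w q))

variable {F N : Plane → Minkowski}

section Algebra

lemma dd_lincomb {E' : Type*} [NormedAddCommGroup E'] [NormedSpace ℝ E'] {A B : Plane → E'}
    {x : Plane} (hA : DifferentiableAt ℝ A x) (hB : DifferentiableAt ℝ B x) (a b : ℝ) (v : Plane) :
    dd v (fun y => a • A y + b • B y) x = a • dd v A x + b • dd v B x := by
  rw [dd_add (A := fun y => a • A y) (B := fun y => b • B y) ((differentiableAt_const a).smul hA) ((differentiableAt_const b).smul hB),
    dd_smul (differentiableAt_const a) hA, dd_smul (differentiableAt_const b) hB]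
  simp

lemma dd_comb_dir {E' : Type*} [NormedAddCommGroup E'] [NormedSpace ℝ E'] {A : Plane → E'}
    (u : Plane) : dd u A = fun y => u 0 • dd (Pi.single 0 1) A y + u 1 • dd (Pi.single 1 1) A y := by
  funext y
  rw [dd_eq_pd]; rfl

lemma dd_dd_expand {A : Plane → Minkowski} (hA : ContDiff ℝ ∞ A) (u v x : Plane) :
    dd u (dd v A) x = ∑ i, ∑ j, (u i * v j) • pd i (pd j A) x := by
  have h0 := (hA.dd (Pi.single 0 1)).diffAt x
  have h1 := (hA.dd (Pi.single 1 1)).diffAt x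
  rw [dd_comb_dir (A := A) v, dd_eq_pd]
  simp only [pd_eq_dd, Fin.sum_univ_two]
  have e : ∀ i : Fin 2, dd (Pi.single i 1) (fun y => v 0 • dd (Pi.single 0 1) A y
      + v 1 • dd (Pi.single 1 1) A y) x = v 0 • dd (Pi.single i 1) (dd (Pi.single 0 1) A) x
      + v 1 • dd (Pi.single i 1) (dd (Pi.single 1 1) A) x := by
    intro i
    exact dd_lincomb h0 h1 _ _ _
  rw [e, e]
  simp only [smul_add, smul_smul]

lemma dd_dd_dd_expand {A : Plane → Minkowski} (hA : ContDiff ℝ ∞ A) (u v z x : Plane) :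
    dd u (dd v (dd z A)) x = ∑ k, ∑ i, ∑ j, (u k * v i * z j) • pd k (pd i (pd j A)) x := by
  have h0 := hA.dd (Pi.single 0 1)
  have h1 := hA.dd (Pi.single 1 1)
  have e : dd v (dd z A) = fun y => z 0 • dd v (dd (Pi.single 0 1) A) y
      + z 1 • dd v (dd (Pi.single 1 1) A) y := by
    funext y
    rw [dd_comb_dir (A := A) z]
    exact dd_lincomb (h0.diffAt y) (h1.diffAt y) _ _ _
  have e2 : dd u (dd v (dd z A)) x = z 0 • dd u (dd v (dd (Pi.single 0 1) A)) x
      + z 1 • dd u (dd v (dd (Pi.single 1 1) A)) x := by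
    rw [e]
    exact dd_lincomb ((h0.dd v).diffAt x) ((h1.dd v).diffAt x) _ _ _
  rw [e2, dd_dd_expand h0, dd_dd_expand h1]
  simp only [Fin.sum_univ_two, pd_eq_dd, smul_add, smul_smul]
  have c : ∀ a b c : ℝ, c * (a * b) = a * b * c := fun a b c => by ring
  simp only [c]
  abel

end Algebra

lemma sff_expand (hF : ContDiff ℝ ∞ F) (x u v : Plane) :
    sff F N x u v = ∑ i, ∑ j, u i * v j * secondFF F N x i j := by
  rw [sff, dd_dd_expand hF]
  simp only [Fin.sum_univ_two, mink_add_right, mink_smul_right, secondFF, Matrix.of_apply]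
  ring

lemma sff_single (i j : Fin 2) (x : Plane) :
    sff F N x (Pi.single i 1) (Pi.single j 1) = secondFF F N x i j := rfl

lemma sff_comm (hF : ContDiff ℝ ∞ F) (x u v : Plane) : sff F N x u v = sff F N x v u := by
  rw [sff, sff, dd_comm hF.contDiffAt]

lemma mink_dd_dd_expand (x u v : Plane) :
    mink (dd u F x) (dd v F x) = ∑ i, ∑ j, u i * v j * metric F x i j := by
  rw [dd_eq_pd u, dd_eq_pd v]
  simp only [Fin.sum_univ_two, mink_add_right, mink_smul_right, mink_add_left, mink_smul_left,
    metric, Matrix.of_apply]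
  ring

section Frame

variable {x : Plane} {w : Fin 2 → Plane}

lemma IsTangentFrame.matrix (hw : IsTangentFrame F x w) :
    (Matrix.of w * metric F x) * (Matrix.of w).transpose = 1 := by
  ext p q
  have := hw p q
  rw [mink_dd_dd_expand] at this
  simp only [Fin.sum_univ_two] at this
  simp only [Matrix.mul_apply, Matrix.transpose_apply, Fin.sum_univ_two, Matrix.of_apply,
    Matrix.one_apply]
  rw [← this]
  ring

lemma IsTangentFrame.metric_inv (hw : IsTangentFrame F x w) (i j : Fin 2) :
    (metric F x)⁻¹ i j = ∑ p, w p i * w p j := by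
  have h1 := hw.matrix
  have h2 : (Matrix.of w).transpose * (Matrix.of w * metric F x) = 1 := mul_eq_one_comm.1 h1
  rw [← Matrix.mul_assoc] at h2
  have h3 : (metric F x)⁻¹ = (Matrix.of w).transpose * Matrix.of w := Matrix.inv_eq_left_inv h2
  rw [h3]
  simp [Matrix.mul_apply]

/-- A tangent vector is the sum of its components in an orthonormal frame. -/
lemma IsTangentFrame.expand (hw : IsTangentFrame F x w) (a : Plane) :
    a = ∑ q, mink (dd a F x) (dd (w q) F x) • w q := by
  have h1 := hw.matrix
  rw [Matrix.mul_assoc] at h1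
  have h2 : (metric F x * (Matrix.of w).transpose) * Matrix.of w = 1 := mul_eq_one_comm.1 h1
  have h3 := congrArg (fun B => Matrix.vecMul a B) h2
  simp only [Matrix.vecMul_one] at h3
  conv_lhs => rw [← h3]
  ext k
  simp only [mink_dd_dd_expand, Matrix.vecMul, dotProduct, Matrix.mul_apply,
    Matrix.transpose_apply, Fin.sum_univ_two, Matrix.of_apply, Pi.add_apply, Pi.smul_apply,
    smul_eq_mul]
  ring

lemma meanCurvature_eq (hF : ContDiff ℝ ∞ F) (hw : IsTangentFrame F x w) :
    meanCurvature F N x = ∑ p, sff F N x (w p) (w p) := by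
  simp only [meanCurvature, Matrix.trace, Matrix.diag, Matrix.mul_apply, hw.metric_inv,
    sff_expand hF, Fin.sum_univ_two]
  have : secondFF F N x 0 1 = secondFF F N x 1 0 := by
    rw [← sff_single, ← sff_single, sff_comm hF]
  rw [this]
  ring

lemma normSqA_eq (hF : ContDiff ℝ ∞ F) (hw : IsTangentFrame F x w) :
    normSqA F N x = ∑ p, ∑ q, sff F N x (w p) (w q) ^ 2 := by
  simp only [normSqA, hw.metric_inv, sff_expand hF, Fin.sum_univ_two]
  ring

end Frame

/-- The data of an immersed surface with unit normal field, without smoothness of the normal. -/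
structure IsSurface (F N : Plane → Minkowski) : Prop where
  smooth : ContDiff ℝ ∞ F
  surface : ∀ x, IsImmersedWithNormalAt F N x

namespace IsSurface

variable (h : IsSurface F N)
include h

lemma mink_dd_self (x v : Plane) : mink (dd v F x) (F x) = 0 := by
  have h1 := dd_mink (h.smooth.diffAt x) (h.smooth.diffAt x) v
  rw [dd_eq_zero_of_eventually_const (c := -1) (Eventually.of_forall fun y => (h.surface y).mem.1),
    mink_comm (F x)] at h1
  linarith

lemma mink_normal_dd (x v : Plane) : mink (N x) (dd v F x) = 0 := by
  rw [dd_eq_pd, mink_add_right, mink_smul_right, mink_smul_right,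
    (h.surface x).normal_orthogonal, (h.surface x).normal_orthogonal]
  ring

lemma dd_ne_zero (x : Plane) {v : Plane} (hv : v ≠ 0) : dd v F x ≠ 0 := by
  intro h0
  apply hv
  apply (h.surface x).immersion
  rw [map_zero]
  exact h0

lemma mink_dd_pos (x : Plane) {v : Plane} (hv : v ≠ 0) : 0 < mink (dd v F x) (dd v F x) :=
  mink_self_pos (by rw [(h.surface x).mem.1]; norm_num) (h.mink_dd_self x v) (h.dd_ne_zero x hv)

/-- The Gram-Schmidt process. -/
lemma exists_frame (x : Plane) : ∃ w, IsTangentFrame F x w := by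
  set a : Plane := Pi.single 0 1
  set b : Plane := Pi.single 1 1
  have ha : a ≠ 0 := by simp [a]
  have hE := h.mink_dd_pos x ha
  set E := mink (dd a F x) (dd a F x) with hEdef
  set G := mink (dd a F x) (dd b F x) with hGdef
  set c : Plane := b + (-(G / E)) • a with hc
  have hc0 : c ≠ 0 := by
    intro h0
    have := congrFun h0 1
    simp [hc, a, b] at this
  have hD := h.mink_dd_pos x hc0
  set D := mink (dd c F x) (dd c F x) with hDdef
  have hac : mink (dd a F x) (dd c F x) = 0 := by
    rw [hc, dd_add_dir, dd_smul_dir, mink_add_right, mink_smul_right, ← hEdef, ← hGdef]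
    field_simp
    ring
  have hsE : Real.sqrt E ^ 2 = E := Real.sq_sqrt hE.le
  have hsD : Real.sqrt D ^ 2 = D := Real.sq_sqrt hD.le
  have hE0 : Real.sqrt E ≠ 0 := (Real.sqrt_pos.2 hE).ne'
  have hD0 : Real.sqrt D ≠ 0 := (Real.sqrt_pos.2 hD).ne'
  refine ⟨![(Real.sqrt E)⁻¹ • a, (Real.sqrt D)⁻¹ • c], fun p q => ?_⟩
  fin_cases p <;> fin_cases q <;>
    simp only [Fin.zero_eta, Fin.mk_one, Matrix.cons_val_zero, Matrix.cons_val_one, dd_smul_dir,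
      mink_smul_left, mink_smul_right, hac, mink_comm (dd c F x) (dd a F x)]
  · rw [← hEdef]; simp; field_simp; rw [hsE]
  · simp
  · simp
  · rw [← hDdef]; simp; field_simp; rw [hsD]

lemma lorentzFrame {x : Plane} {w : Fin 2 → Plane} (hw : IsTangentFrame F x w) :
    IsLorentzFrame (F x) (dd (w 0) F x) (dd (w 1) F x) (N x) where
  h00 := (h.surface x).mem.1
  h01 := by rw [mink_comm, h.mink_dd_self]
  h02 := by rw [mink_comm, h.mink_dd_self]
  h03 := by rw [mink_comm, (h.surface x).normal_tangent]
  h11 := by simpa using hw 0 0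
  h12 := by simpa using hw 0 1
  h13 := by rw [mink_comm, h.mink_normal_dd]
  h22 := by simpa using hw 1 1
  h23 := by rw [mink_comm, h.mink_normal_dd]
  h33 := (h.surface x).normal_unit

/-- The part of the Gauss formula along the position vector. -/
lemma mink_dd_dd_self (x u v : Plane) :
    mink (dd u (dd v F) x) (F x) = -mink (dd u F x) (dd v F x) := by
  have h1 := dd_mink ((h.smooth.dd v).diffAt x) (h.smooth.diffAt x) u
  rw [dd_eq_zero_of_eventually_const (c := 0)
    (Eventually.of_forall fun y => h.mink_dd_self y v)] at h1
  rw [mink_comm (dd u F x)]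
  linarith

/-- The third derivatives along the position vector. -/
lemma mink_dd_dd_dd_self (x u v z : Plane) :
    mink (dd u (dd v (dd z F)) x) (F x) = -(mink (dd v (dd z F) x) (dd u F x)
      + mink (dd u (dd v F) x) (dd z F x) + mink (dd u (dd z F) x) (dd v F x)) := by
  have h1 := dd_mink (((h.smooth.dd z).dd v).diffAt x) (h.smooth.diffAt x) u
  have h2 := dd_mink ((h.smooth.dd v).diffAt x) ((h.smooth.dd z).diffAt x) u
  have h3 : dd u (fun y => mink (dd v (dd z F) y) (F y)) x
      = -dd u (fun y => mink (dd v F y) (dd z F y)) x := by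
    have : (fun y => mink (dd v (dd z F) y) (F y))
        = fun y => (-1 : ℝ) * mink (dd v F y) (dd z F y) := by
      funext y; rw [h.mink_dd_dd_self]; ring
    rw [this, dd_mul (differentiableAt_const _)
      (((h.smooth.dd v).mink (h.smooth.dd z)).diffAt x)]
    simp
  rw [h1, h2, mink_comm (dd v F x)] at h3
  linarith

section SmoothNormal

variable (hN : ContDiff ℝ ∞ N)
include hN

lemma mink_dd_normal_self (x v : Plane) : mink (dd v N x) (N x) = 0 := by
  have h1 := dd_mink (hN.diffAt x) (hN.diffAt x) v
  rw [dd_eq_zero_of_eventually_const (c := 1)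
    (Eventually.of_forall fun y => (h.surface y).normal_unit), mink_comm (N x)] at h1
  linarith

lemma mink_dd_normal_pos (x v : Plane) : mink (dd v N x) (F x) = 0 := by
  have h1 := dd_mink (hN.diffAt x) (h.smooth.diffAt x) v
  rw [dd_eq_zero_of_eventually_const (c := 0)
    (Eventually.of_forall fun y => (h.surface y).normal_tangent), h.mink_normal_dd] at h1
  linarith

lemma mink_dd_normal_dd (x u v : Plane) : mink (dd u N x) (dd v F x) = sff F N x u v := by
  have h1 := dd_mink (hN.diffAt x) ((h.smooth.dd v).diffAt x) u
  rw [dd_eq_zero_of_eventually_const (c := 0)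
    (Eventually.of_forall fun y => h.mink_normal_dd y v)] at h1
  rw [sff]
  linarith

/-- The Weingarten equation. -/
lemma dd_normal {x : Plane} {w : Fin 2 → Plane} (hw : IsTangentFrame F x w) (u : Plane) :
    dd u N x = sff F N x u (w 0) • dd (w 0) F x + sff F N x u (w 1) • dd (w 1) F x := by
  conv_lhs => rw [(h.lorentzFrame hw).expand (dd u N x)]
  rw [h.mink_dd_normal_self hN, h.mink_dd_normal_pos hN, h.mink_dd_normal_dd hN,
    h.mink_dd_normal_dd hN]
  simp

lemma mink_dd_normal_eq {x : Plane} {w : Fin 2 → Plane} (hw : IsTangentFrame F x w) (u : Plane)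
    (V : Minkowski) : mink (dd u N x) V
      = ∑ q, mink V (dd (w q) F x) * sff F N x u (w q) := by
  rw [h.dd_normal hN hw, mink_add_left, mink_smul_left, mink_smul_left, Fin.sum_univ_two,
    mink_comm V, mink_comm V]
  ring

lemma dd_sff {x : Plane} {w : Fin 2 → Plane} (hw : IsTangentFrame F x w) (u v z : Plane) :
    dd u (fun y => sff F N y v z) x = -mink (N x) (dd u (dd v (dd z F)) x)
      - ∑ q, mink (dd v (dd z F) x) (dd (w q) F x) * sff F N x u (w q) := by
  have h1 := dd_mink (hN.diffAt x) (((h.smooth.dd z).dd v).diffAt x) u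
  have h2 : (fun y => sff F N y v z) = fun y => (-1 : ℝ) * mink (N y) (dd v (dd z F) y) := by
    funext y; rw [sff]; ring
  rw [h2, dd_mul (differentiableAt_const _) ((hN.mink ((h.smooth.dd z).dd v)).diffAt x), h1,
    h.mink_dd_normal_eq hN hw]
  simp
  ring

omit hN in
lemma christoffel_eq {x : Plane} {w : Fin 2 → Plane} (hw : IsTangentFrame F x w) (k i j : Fin 2) :
    christoffel F x k i j = ∑ q, w q k * mink (pd i (pd j F) x) (dd (w q) F x) := by
  have hg : ∀ a b c : Fin 2, pd a (fun y => metric F y b c) x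
      = mink (pd a (pd b F) x) (pd c F x) + mink (pd b F x) (pd a (pd c F) x) := fun a b c =>
    dd_mink ((h.smooth.dd _).diffAt x) ((h.smooth.dd _).diffAt x) _
  have hs : ∀ a b : Fin 2, pd a (pd b F) x = pd b (pd a F) x := fun a b =>
    dd_comm h.smooth.contDiffAt _ _
  have e : ∀ l : Fin 2, pd i (fun y => metric F y j l) x + pd j (fun y => metric F y i l) x
      - pd l (fun y => metric F y i j) x = 2 * mink (pd i (pd j F) x) (pd l F x) := by
    intro l
    rw [hg, hg, hg, hs j i, hs l i, hs l j, mink_comm (pd j F x), mink_comm (pd i F x)]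
    ring
  simp only [christoffel, e, hw.metric_inv]
  simp only [dd_eq_pd (w _) F, mink_add_right, mink_smul_right, Fin.sum_univ_two]
  ring

lemma covDerivSecondFF_eq {x : Plane} {w : Fin 2 → Plane} (hw : IsTangentFrame F x w)
    (k i j : Fin 2) : covDerivSecondFF F N x k i j
      = covSff F N w x (Pi.single k 1) (Pi.single i 1) (Pi.single j 1) := by
  have h1 := h.dd_sff hN hw (Pi.single k 1) (Pi.single i 1) (Pi.single j 1)
  have h2 : ∀ (V : Minkowski) (j : Fin 2), ∑ l, (∑ q, w q l * mink V (dd (w q) F x))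
      * secondFF F N x l j = ∑ q, mink V (dd (w q) F x) * sff F N x (w q) (Pi.single j 1) := by
    intro V j
    simp only [sff_expand h.smooth, Fin.sum_univ_two]
    fin_cases j <;> simp <;> ring
  have h3 : ∀ l i : Fin 2, secondFF F N x i l = secondFF F N x l i := by
    intro l i
    rw [← sff_single, ← sff_single, sff_comm h.smooth]
  simp only [covDerivSecondFF, h.christoffel_eq hw]
  rw [h2]
  simp only [h3 _ i]
  rw [h2]
  change dd (Pi.single k 1) (fun y => sff F N y (Pi.single i 1) (Pi.single j 1)) x - _ - _ = _
  rw [h1, covSff]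
  simp only [pd_eq_dd, Fin.sum_univ_two, sff_comm h.smooth x (Pi.single i 1)]
  ring

omit hN in
lemma covSff_expand (w : Fin 2 → Plane) (x u v z : Plane) :
    covSff F N w x u v z = ∑ k, ∑ i, ∑ j, u k * v i * z j *
      covSff F N w x (Pi.single k 1) (Pi.single i 1) (Pi.single j 1) := by
  have hs : ∀ (s u v : Plane), sff F N x (s) (u) = u 0 * sff F N x s (Pi.single 0 1)
      + u 1 * sff F N x s (Pi.single 1 1) := by
    intro s u v
    simp only [sff_expand h.smooth, Fin.sum_univ_two]
    simp
    ring
  simp only [covSff]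
  rw [dd_dd_dd_expand h.smooth u v z, dd_dd_expand h.smooth v z, dd_dd_expand h.smooth u v,
    dd_dd_expand h.smooth u z]
  simp only [sff_comm h.smooth x u, sff_comm h.smooth x v, fun q => hs (w q) u 0,
    fun q => hs (w q) v 0, fun q => hs (w q) z 0, sff_comm h.smooth x (Pi.single _ _)]
  simp only [Fin.sum_univ_two, mink_add_right, mink_add_left, mink_smul_left, mink_smul_right,
    pd_eq_dd]
  ring

lemma normSqGradA_eq {x : Plane} {w : Fin 2 → Plane} (hw : IsTangentFrame F x w) :
    normSqGradA F N x = ∑ p, ∑ q, ∑ r, covSff F N w x (w p) (w q) (w r) ^ 2 := by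
  have key : ∀ (g : Fin 2 → Fin 2 → ℝ) (W : Fin 2 → Fin 2 → ℝ) (T : Fin 2 → Fin 2 → Fin 2 → ℝ),
      (∀ i j, g i j = ∑ p, W p i * W p j) →
      ∑ a, ∑ b, ∑ i, ∑ j, ∑ k, ∑ l, g a b * g i k * g j l * T a i j * T b k l
        = ∑ p, ∑ q, ∑ r, (∑ k, ∑ i, ∑ j, W p k * W q i * W r j * T k i j) ^ 2 := by
    intro g W T hg
    simp only [hg, Fin.sum_univ_two]
    ring
  have h1 : ∀ p q r, covSff F N w x (w p) (w q) (w r) = ∑ k, ∑ i, ∑ j, w p k * w q i * w r j *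
      covSff F N w x (Pi.single k 1) (Pi.single i 1) (Pi.single j 1) :=
    fun p q r => h.covSff_expand w x _ _ _
  simp only [normSqGradA, h.covDerivSecondFF_eq hN hw]
  rw [key _ (fun p i => w p i) _ hw.metric_inv]
  simp only [h1]

end SmoothNormal

end IsSurface

end Surfaces

/-! ### Reparametrization -/

section Reparametrization

variable {F N : Plane → Minkowski}

lemma dd_dd_dd_eq {A : Plane → Minkowski} (hA : ContDiff ℝ ∞ A) (u v z x : Plane) :
    dd u (dd v (dd z A)) x = fderiv ℝ (fderiv ℝ (fderiv ℝ A)) x u v z := by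
  have h1 : ContDiff ℝ ∞ (fderiv ℝ A) := hA.fderiv_right (by simp)
  have h2 : ContDiff ℝ ∞ (fderiv ℝ (fderiv ℝ A)) := h1.fderiv_right (by simp)
  have e : dd v (dd z A) = fun y => fderiv ℝ (fderiv ℝ A) y v z := by
    funext y; exact dd_dd_eq hA.contDiffAt v z
  rw [e]
  change fderiv ℝ (fun y => fderiv ℝ (fderiv ℝ A) y v z) x u = _
  rw [fderiv_clm_apply ((h2.diffAt x).clm_apply (differentiableAt_const v))
    (differentiableAt_const z), fderiv_clm_apply (h2.diffAt x) (differentiableAt_const v)]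
  simp

lemma dd_clm_apply {E' G' : Type*} [NormedAddCommGroup E'] [NormedSpace ℝ E']
    [NormedAddCommGroup G'] [NormedSpace ℝ G'] {B : E' → Plane →L[ℝ] G'} {c : E' → Plane} {x : E'}
    (hB : DifferentiableAt ℝ B x) (hc : DifferentiableAt ℝ c x) (u : E') :
    dd u (fun y => B y (c y)) x = dd u B x (c x) + B x (dd u c x) := by
  simp only [dd, (hB.hasFDerivAt.clm_apply hc.hasFDerivAt).fderiv]
  simp [add_comm]

lemma dd_clm_comp {E' G' : Type*} [NormedAddCommGroup E'] [NormedSpace ℝ E']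
    [NormedAddCommGroup G'] [NormedSpace ℝ G'] {B : Plane → Plane →L[ℝ] G'} {ψ c : E' → Plane}
    {x : E'}
    (hB : DifferentiableAt ℝ B (ψ x)) (hψ : DifferentiableAt ℝ ψ x) (hc : DifferentiableAt ℝ c x)
    (u : E') : dd u (fun y => B (ψ y) (c y)) x
      = fderiv ℝ B (ψ x) (dd u ψ x) (c x) + B (ψ x) (dd u c x) := by
  rw [dd_clm_apply (B := fun y => B (ψ y)) (hB.comp x hψ) hc]
  congr 1
  exact congrArg (fun L => L (c x)) (dd_comp hB hψ u)

lemma sff_sum_frame (h : IsSurface F N) {x : Plane} {w : Fin 2 → Plane}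
    (hw : IsTangentFrame F x w) (u a : Plane) :
    ∑ q, mink (dd a F x) (dd (w q) F x) * sff F N x u (w q) = sff F N x u a := by
  conv_rhs => rw [hw.expand a]
  simp only [Fin.sum_univ_two, sff_expand h.smooth, Pi.add_apply, Pi.smul_apply, smul_eq_mul]
  ring

/-- The covariant derivative of the second fundamental form is natural under reparametrizations. -/
lemma covSff_comp (h : IsSurface F N) {ψ : Plane → Plane} (hψ : ContDiff ℝ ∞ ψ) {x : Plane}
    {w : Fin 2 → Plane} (hw : IsTangentFrame F (ψ x) (fun p => dd (w p) ψ x)) (u v z : Plane) :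
    covSff (fun y => F (ψ y)) (fun y => N (ψ y)) w x u v z
      = covSff F N (fun p => dd (w p) ψ x) (ψ x) (dd u ψ x) (dd v ψ x) (dd z ψ x) := by
  have hD : ContDiff ℝ ∞ (fderiv ℝ F) := h.smooth.fderiv_right (by simp)
  have hD2 : ContDiff ℝ ∞ (fderiv ℝ (fderiv ℝ F)) := hD.fderiv_right (by simp)
  have e1 : ∀ z, dd z (fun y => F (ψ y)) = fun y => fderiv ℝ F (ψ y) (dd z ψ y) := fun z => by
    funext y; exact dd_comp (h.smooth.diffAt _) (hψ.diffAt y) z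
  have e2 : ∀ v z, dd v (dd z (fun y => F (ψ y)))
      = fun y => fderiv ℝ (fderiv ℝ F) (ψ y) (dd v ψ y) (dd z ψ y)
        + fderiv ℝ F (ψ y) (dd v (dd z ψ) y) := fun v z => by
    funext y
    rw [e1]
    exact dd_clm_comp (hD.diffAt _) (hψ.diffAt y) ((hψ.dd z).diffAt y) v
  have e3 : dd u (dd v (dd z (fun y => F (ψ y)))) x
      = fderiv ℝ (fderiv ℝ (fderiv ℝ F)) (ψ x) (dd u ψ x) (dd v ψ x) (dd z ψ x)
        + fderiv ℝ (fderiv ℝ F) (ψ x) (dd u (dd v ψ) x) (dd z ψ x)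
        + fderiv ℝ (fderiv ℝ F) (ψ x) (dd v ψ x) (dd u (dd z ψ) x)
        + (fderiv ℝ (fderiv ℝ F) (ψ x) (dd u ψ x) (dd v (dd z ψ) x)
        + fderiv ℝ F (ψ x) (dd u (dd v (dd z ψ)) x)) := by
    have hc1 : ContDiff ℝ ∞ fun y => fderiv ℝ (fderiv ℝ F) (ψ y) (dd v ψ y) :=
      (hD2.comp hψ).clm_apply (hψ.dd v)
    have hc2 : ContDiff ℝ ∞ fun y => fderiv ℝ (fderiv ℝ F) (ψ y) (dd v ψ y) (dd z ψ y) :=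
      hc1.clm_apply (hψ.dd z)
    have hc3 : ContDiff ℝ ∞ fun y => fderiv ℝ F (ψ y) (dd v (dd z ψ) y) :=
      (hD.comp hψ).clm_apply ((hψ.dd z).dd v)
    rw [e2, dd_add (hc2.diffAt x) (hc3.diffAt x),
      dd_clm_comp (hD.diffAt _) (hψ.diffAt x) (((hψ.dd z).dd v).diffAt x)]
    congr 1
    have h1 := dd_clm_apply (hc1.diffAt x) ((hψ.dd z).diffAt x) u
    rw [h1, dd_clm_comp (hD2.diffAt (ψ x)) (hψ.diffAt x) ((hψ.dd v).diffAt x) u]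
    simp
  have hs : ∀ u v, sff (fun y => F (ψ y)) (fun y => N (ψ y)) x u v
      = sff F N (ψ x) (dd u ψ x) (dd v ψ x) := by
    intro u v
    have h0 := h.mink_normal_dd (ψ x) (dd u (dd v ψ) x)
    simp only [sff, e2, mink_add_right, dd_dd_eq h.smooth.contDiffAt]
    simp only [dd] at h0 ⊢
    rw [h0, add_zero]
  have hn : ∀ a, mink (N (ψ x)) (fderiv ℝ F (ψ x) a) = 0 := fun a => h.mink_normal_dd (ψ x) a
  have hH : ∀ a b, mink (N (ψ x)) (fderiv ℝ (fderiv ℝ F) (ψ x) a b) = -sff F N (ψ x) a b := by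
    intro a b
    rw [sff, dd_dd_eq h.smooth.contDiffAt, neg_neg]
  have hf := fun u a => sff_sum_frame h hw u a
  have hf1 := hf (dd u ψ x) (dd v (dd z ψ) x)
  have hf2 := hf (dd z ψ x) (dd u (dd v ψ) x)
  have hf3 := hf (dd v ψ x) (dd u (dd z ψ) x)
  have hd1 : ∀ a, dd a F (ψ x) = fderiv ℝ F (ψ x) a := fun a => rfl
  have e2' : ∀ v z, dd v (fun y => fderiv ℝ F (ψ y) (dd z ψ y))
      = fun y => fderiv ℝ (fderiv ℝ F) (ψ y) (dd v ψ y) (dd z ψ y)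
        + fderiv ℝ F (ψ y) (dd v (dd z ψ) y) := fun v z => by rw [← e1, e2]
  rw [covSff, covSff, e3, dd_dd_dd_eq h.smooth]
  simp only [e1, e2', hs, dd_dd_eq h.smooth.contDiffAt, mink_add_right, mink_add_left, hn, hH,
    Fin.sum_univ_two, hd1] at hf1 hf2 hf3 ⊢
  simp only [sff_comm h.smooth (ψ x) (dd (w _) ψ x)]
  rw [sff_comm h.smooth (ψ x) _ (dd z ψ x)]
  linear_combination -hf1 - hf2 - hf3

end Reparametrization

namespace AlmostFuchsian

variable (M : AlmostFuchsian)

lemma isSurface : IsSurface M.f M.n := ⟨M.f_smooth, M.surface⟩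

/-! ### The curvature of the minimal surface -/

section Curvature

variable {M} {x : Plane} {w : Fin 2 → Plane} (hw : IsTangentFrame M.f x w)
include hw

lemma sff_trace : sff M.f M.n x (w 1) (w 1) = -sff M.f M.n x (w 0) (w 0) := by
  have h := meanCurvature_eq (N := M.n) M.f_smooth hw
  rw [M.minimal, Fin.sum_univ_two] at h
  linarith

lemma sff_frame_comb (u : Plane) (s t : ℝ) : sff M.f M.n x u (s • w 0 + t • w 1)
    = s * sff M.f M.n x u (w 0) + t * sff M.f M.n x u (w 1) := by
  simp only [sff_expand M.f_smooth, Fin.sum_univ_two, Pi.add_apply, Pi.smul_apply, smul_eq_mul]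
  ring

omit hw in
lemma isPrincipalCurvature_iff (κ : ℝ) : IsPrincipalCurvature M.f M.n x κ ↔
    ∃ v ≠ 0, ∀ u, sff M.f M.n x u v = κ * mink (dd u M.f x) (dd v M.f x) := by
  refine exists_congr fun v => and_congr_right fun _ => ⟨fun h u => ?_, fun h => ?_⟩
  · have h0 := congrFun h 0
    have h1 := congrFun h 1
    simp only [Matrix.mulVec, dotProduct, Fin.sum_univ_two, Pi.smul_apply, smul_eq_mul] at h0 h1
    rw [sff_expand M.f_smooth, mink_dd_dd_expand]
    simp only [Fin.sum_univ_two]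
    linear_combination u 0 * h0 + u 1 * h1
  · ext j
    have := h (Pi.single j 1)
    rw [sff_expand M.f_smooth, mink_dd_dd_expand] at this
    simp only [Matrix.mulVec, dotProduct, Fin.sum_univ_two, Pi.smul_apply, smul_eq_mul] at this ⊢
    fin_cases j <;> simp at this ⊢ <;> linarith

lemma isPrincipalCurvature_sqrt : IsPrincipalCurvature M.f M.n x
    (Real.sqrt (sff M.f M.n x (w 0) (w 0) ^ 2 + sff M.f M.n x (w 0) (w 1) ^ 2)) := by
  set a := sff M.f M.n x (w 0) (w 0) with ha
  set b := sff M.f M.n x (w 0) (w 1) with hb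
  set l := Real.sqrt (a ^ 2 + b ^ 2) with hl
  have hl2 : l ^ 2 = a ^ 2 + b ^ 2 := Real.sq_sqrt (by positivity)
  have key : ∀ s t : ℝ, (s ≠ 0 ∨ t ≠ 0) → a * s + b * t = l * s → b * s - a * t = l * t →
      IsPrincipalCurvature M.f M.n x l := by
    intro s t hst h1 h2
    have hd : dd (s • w 0 + t • w 1) M.f x = s • dd (w 0) M.f x + t • dd (w 1) M.f x := by
      rw [dd_add_dir, dd_smul_dir, dd_smul_dir]
    rw [isPrincipalCurvature_iff]
    refine ⟨s • w 0 + t • w 1, ?_, fun u => ?_⟩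
    · intro h0
      rw [h0] at hd
      simp only [dd, map_zero] at hd
      have e0 := congrArg (fun V => mink V (dd (w 0) M.f x)) hd
      have e1 := congrArg (fun V => mink V (dd (w 1) M.f x)) hd
      simp only [mink_zero_left, mink_add_left, mink_smul_left] at e0 e1
      have f00 := hw 0 0
      have f01 := hw 0 1
      have f10 := hw 1 0
      have f11 := hw 1 1
      simp only [dd] at e0 e1 f00 f01 f10 f11
      simp only [f00, f01, f10, f11] at e0 e1
      norm_num at e0 e1
      rcases hst with h | h
      · exact h e0.symm
      · exact h e1.symm
    · conv_lhs => rw [hw.expand u]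
      rw [sff_comm M.f_smooth, Fin.sum_univ_two, sff_frame_comb hw,
        sff_comm M.f_smooth x _ (w 0), sff_comm M.f_smooth x _ (w 1), sff_frame_comb hw,
        sff_frame_comb hw, sff_trace hw, hd, mink_add_right, mink_smul_right, mink_smul_right,
        sff_comm M.f_smooth x (w 1) (w 0), ← ha, ← hb]
      linear_combination mink (dd u M.f x) (dd (w 0) M.f x) * h1
        + mink (dd u M.f x) (dd (w 1) M.f x) * h2
  by_cases hc : b ≠ 0 ∨ l - a ≠ 0
  · exact key b (l - a) hc (by ring) (by linear_combination (-1 : ℝ) * hl2)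
  · push Not at hc
    exact key 1 0 (Or.inl one_ne_zero) (by linear_combination (-1 : ℝ) * hc.2)
      (by rw [hc.1]; ring)

lemma sq_of_isPrincipalCurvature {κ : ℝ} (h : IsPrincipalCurvature M.f M.n x κ) :
    κ ^ 2 = sff M.f M.n x (w 0) (w 0) ^ 2 + sff M.f M.n x (w 0) (w 1) ^ 2 := by
  obtain ⟨v, hv, h⟩ := (isPrincipalCurvature_iff κ).1 h
  have h0 := h (w 0)
  have h1 := h (w 1)
  have hpos := M.isSurface.mink_dd_pos x hv
  set s := mink (dd v M.f x) (dd (w 0) M.f x) with hs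
  set t := mink (dd v M.f x) (dd (w 1) M.f x) with ht
  have hve : v = s • w 0 + t • w 1 := by
    have := hw.expand v
    rwa [Fin.sum_univ_two] at this
  have hst : mink (dd v M.f x) (dd v M.f x) = s ^ 2 + t ^ 2 := by
    have e : dd v M.f x = s • dd (w 0) M.f x + t • dd (w 1) M.f x := by
      conv_lhs => rw [hve]
      rw [dd_add_dir, dd_smul_dir, dd_smul_dir]
    conv_lhs => rw [e]
    rw [mink_add_right, mink_smul_right, mink_smul_right, ← e, ← hs, ← ht]
    ring
  rw [mink_comm, ← hs] at h0
  rw [mink_comm, ← ht] at h1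
  rw [hve, sff_frame_comb hw] at h0 h1
  rw [sff_trace hw, sff_comm M.f_smooth x (w 1) (w 0)] at h1
  rw [hst] at hpos
  set a := sff M.f M.n x (w 0) (w 0)
  set b := sff M.f M.n x (w 0) (w 1)
  have e : (κ ^ 2 - (a ^ 2 + b ^ 2)) * (s ^ 2 + t ^ 2) = 0 := by
    linear_combination (-(κ + a) * s - b * t) * h0 + (-b * s - (κ - a) * t) * h1
  rcases mul_eq_zero.1 e with h | h
  · linarith
  · exact absurd h hpos.ne'

lemma sff_sq_lt_one : sff M.f M.n x (w 0) (w 0) ^ 2 + sff M.f M.n x (w 0) (w 1) ^ 2 < 1 := by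
  have h := M.principal_lt_one x _ (isPrincipalCurvature_sqrt hw)
  rw [abs_of_nonneg (Real.sqrt_nonneg _)] at h
  rwa [Real.sqrt_lt' one_pos, one_pow] at h

lemma sff_sq_le_lambdaMax_sq :
    sff M.f M.n x (w 0) (w 0) ^ 2 + sff M.f M.n x (w 0) (w 1) ^ 2 ≤ M.lambdaMax ^ 2 := by
  have hbdd : BddAbove {a | ∃ x κ, IsPrincipalCurvature M.f M.n x κ ∧ a = |κ|} :=
    ⟨1, by rintro _ ⟨x, κ, h, rfl⟩; exact (M.principal_lt_one x κ h).le⟩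
  have h := le_csSup hbdd ⟨x, _, isPrincipalCurvature_sqrt hw, rfl⟩
  rw [abs_of_nonneg (Real.sqrt_nonneg _)] at h
  calc _ = Real.sqrt (sff M.f M.n x (w 0) (w 0) ^ 2 + sff M.f M.n x (w 0) (w 1) ^ 2) ^ 2 :=
        (Real.sq_sqrt (by positivity)).symm
    _ ≤ _ := pow_le_pow_left₀ (Real.sqrt_nonneg _) h 2

lemma normSqA_eq_two_mul : normSqA M.f M.n x
    = 2 * (sff M.f M.n x (w 0) (w 0) ^ 2 + sff M.f M.n x (w 0) (w 1) ^ 2) := by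
  rw [normSqA_eq M.f_smooth hw]
  simp only [Fin.sum_univ_two, sff_trace hw, sff_comm M.f_smooth x (w 1) (w 0)]
  ring

/-- `|h(v, v)| ≤ λ |v|²` with `λ < 1`. -/
lemma sff_self_sq_le (v : Plane) : sff M.f M.n x v v ^ 2
    ≤ (sff M.f M.n x (w 0) (w 0) ^ 2 + sff M.f M.n x (w 0) (w 1) ^ 2)
      * mink (dd v M.f x) (dd v M.f x) ^ 2 := by
  set s := mink (dd v M.f x) (dd (w 0) M.f x) with hs
  set t := mink (dd v M.f x) (dd (w 1) M.f x) with ht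
  have hve : v = s • w 0 + t • w 1 := by
    have := hw.expand v
    rwa [Fin.sum_univ_two] at this
  have hst : mink (dd v M.f x) (dd v M.f x) = s ^ 2 + t ^ 2 := by
    have e : dd v M.f x = s • dd (w 0) M.f x + t • dd (w 1) M.f x := by
      conv_lhs => rw [hve]
      rw [dd_add_dir, dd_smul_dir, dd_smul_dir]
    conv_lhs => rw [e]
    rw [mink_add_right, mink_smul_right, mink_smul_right, ← e, ← hs, ← ht]
    ring
  have hsv : sff M.f M.n x v v = s ^ 2 * sff M.f M.n x (w 0) (w 0)
      + 2 * s * t * sff M.f M.n x (w 0) (w 1) - t ^ 2 * sff M.f M.n x (w 0) (w 0) := by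
    conv_lhs => rw [hve]
    rw [sff_frame_comb hw, sff_comm M.f_smooth x _ (w 0), sff_comm M.f_smooth x _ (w 1),
      sff_frame_comb hw, sff_frame_comb hw, sff_trace hw, sff_comm M.f_smooth x (w 1) (w 0)]
    ring
  rw [hst, hsv]
  nlinarith [sq_nonneg ((s ^ 2 - t ^ 2) * sff M.f M.n x (w 0) (w 1)
    - 2 * s * t * sff M.f M.n x (w 0) (w 0))]

end Curvature

lemma lambdaMax_nonneg : 0 ≤ M.lambdaMax := by
  refine Real.sSup_nonneg ?_
  rintro _ ⟨x, κ, -, rfl⟩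
  exact abs_nonneg κ

/-! ### Deck transformations and pointwise curvature bounds -/

lemma deck_isTangentFrame {x : Plane} {w : Fin 2 → Plane} (hw : IsTangentFrame M.f x w) (γ : M.Γ) :
    IsTangentFrame M.f (M.deck γ x) (fun p => dd (w p) (M.deck γ) x) := by
  intro p q
  have hγ := M.isometry γ γ.2
  have e : ∀ p, dd (dd (w p) (M.deck γ) x) M.f (M.deck γ x)
      = (γ : Minkowski ≃ₗ[ℝ] Minkowski) (dd (w p) M.f x) := by
    intro p
    rw [← dd_comp (M.f_smooth.diffAt _) ((M.deck_smooth γ).diffAt x)]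
    simp only [M.f_equivariant]
    exact dd_clm (LinearMap.toContinuousLinearMap
      ((γ : Minkowski ≃ₗ[ℝ] Minkowski) : Minkowski →ₗ[ℝ] Minkowski)) (M.f_smooth.diffAt x) (w p)
  rw [e, e, hγ.mink_map]
  exact hw p q

/-- `|∇A|²` descends to the closed surface; this is needed for its supremum to be finite. -/
lemma normSqGradA_deck (γ : M.Γ) (x : Plane) :
    normSqGradA M.f M.n (M.deck γ x) = normSqGradA M.f M.n x := by
  obtain ⟨w, hw⟩ := M.isSurface.exists_frame x
  have hw' := M.deck_isTangentFrame hw γ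
  have hγ := M.isometry γ γ.2
  rw [M.isSurface.normSqGradA_eq M.n_smooth hw, M.isSurface.normSqGradA_eq M.n_smooth hw']
  simp only [← covSff_comp M.isSurface (M.deck_smooth γ) hw']
  simp only [M.f_equivariant, M.n_equivariant]
  set L : Minkowski →L[ℝ] Minkowski := LinearMap.toContinuousLinearMap
      ((γ : Minkowski ≃ₗ[ℝ] Minkowski) : Minkowski →ₗ[ℝ] Minkowski)
  have hL : ∀ V, (γ : Minkowski ≃ₗ[ℝ] Minkowski) V = L V := fun V => rfl
  have hm : ∀ V W, mink (L V) (L W) = mink V W := hγ.mink_map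
  have d1 : ∀ {A : Plane → Minkowski}, ContDiff ℝ ∞ A → ∀ u,
      dd u (fun y => L (A y)) = fun y => L (dd u A y) := fun hA u => by
    funext y; exact dd_clm L (hA.diffAt y) u
  have c1 := fun u => M.f_smooth.dd u
  have c2 := fun u v => (c1 u).dd v
  simp only [covSff, sff, hL, d1 M.f_smooth, d1 (c1 _), d1 (c2 _ _), hm]

lemma continuous_normSqGradA : Continuous (normSqGradA M.f M.n) := by
  have hg : ∀ i j, ContDiff ℝ ∞ fun x => metric M.f x i j := fun i j =>
    (M.f_smooth.dd _).mink (M.f_smooth.dd _)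
  have hh : ∀ i j, ContDiff ℝ ∞ fun x => secondFF M.f M.n x i j := fun i j =>
    (M.n_smooth.mink ((M.f_smooth.dd _).dd _)).neg
  have hgm : Continuous (metric M.f) := continuous_matrix fun i j => (hg i j).continuous
  have hdet : ∀ x, (metric M.f x).det ≠ 0 := by
    intro x h0
    obtain ⟨w, hw⟩ := M.isSurface.exists_frame x
    have := congrArg Matrix.det hw.matrix
    simp [h0] at this
  have hinv : ∀ i j, Continuous fun x => (metric M.f x)⁻¹ i j := by
    intro i j
    have : (fun x => (metric M.f x)⁻¹ i j)
        = fun x => ((metric M.f x).det)⁻¹ * (metric M.f x).adjugate i j := by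
      funext x
      rw [Matrix.inv_def, Ring.inverse_eq_inv', Matrix.smul_apply, smul_eq_mul]
    rw [this]
    exact (hgm.matrix_det.inv₀ hdet).mul (hgm.matrix_adjugate.matrix_elem i j)
  have hpd : ∀ {A : Plane → ℝ}, ContDiff ℝ ∞ A → ∀ k, Continuous (pd k A) := fun hA k =>
    (hA.dd _).continuous
  have hchr : ∀ k i j, Continuous fun x => christoffel M.f x k i j := by
    intro k i j
    unfold christoffel
    refine continuous_const.mul (continuous_finsetSum _ fun l _ => (hinv k l).mul ?_)
    exact ((hpd (hg j l) i).add (hpd (hg i l) j)).sub (hpd (hg i j) l)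
  have hcov : ∀ k i j, Continuous fun x => covDerivSecondFF M.f M.n x k i j := by
    intro k i j
    unfold covDerivSecondFF
    refine ((hpd (hh i j) k).sub ?_).sub ?_
    · exact continuous_finsetSum _ fun l _ => (hchr l k i).mul (hh l j).continuous
    · exact continuous_finsetSum _ fun l _ => (hchr l k j).mul (hh i l).continuous
  unfold normSqGradA
  refine continuous_finsetSum _ fun a _ => continuous_finsetSum _ fun b _ =>
    continuous_finsetSum _ fun i _ => continuous_finsetSum _ fun j _ =>
    continuous_finsetSum _ fun k _ => continuous_finsetSum _ fun l _ => ?_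
  exact ((((hinv a b).mul (hinv i k)).mul (hinv j l)).mul (hcov a i j)).mul (hcov b k l)

lemma bddAbove_normGradA : BddAbove (range fun x => Real.sqrt (normSqGradA M.f M.n x)) := by
  obtain ⟨K, hK, hKM⟩ := M.cocompact
  obtain ⟨B, hB⟩ := hK.bddAbove_image
    (f := fun x => Real.sqrt (normSqGradA M.f M.n x))
    (Real.continuous_sqrt.comp M.continuous_normSqGradA).continuousOn
  refine ⟨B, ?_⟩
  rintro _ ⟨x, rfl⟩
  obtain ⟨γ, hγ⟩ := hKM x
  have := hB ⟨_, hγ, rfl⟩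
  simpa only [M.normSqGradA_deck] using this

lemma bddAbove_normA : BddAbove (range fun x => Real.sqrt (normSqA M.f M.n x)) := by
  refine ⟨Real.sqrt 2, ?_⟩
  rintro _ ⟨x, rfl⟩
  obtain ⟨w, hw⟩ := M.isSurface.exists_frame x
  refine Real.sqrt_le_sqrt ?_
  rw [normSqA_eq_two_mul hw]
  linarith [sff_sq_lt_one hw]

variable {M} {ε : ℝ} (hA : M.c1NormA ≤ ε)
include hA

lemma eps_nonneg_of_c1NormA_le : 0 ≤ ε := by
  have h := (le_ciSup M.bddAbove_normA 0).trans ((le_max_left _ _).trans hA)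
  exact (Real.sqrt_nonneg _).trans h

lemma two_mul_sff_sq_le {x : Plane} {w : Fin 2 → Plane} (hw : IsTangentFrame M.f x w) :
    2 * (sff M.f M.n x (w 0) (w 0) ^ 2 + sff M.f M.n x (w 0) (w 1) ^ 2) ≤ ε ^ 2 := by
  have h := (le_ciSup M.bddAbove_normA x).trans ((le_max_left _ _).trans hA)
  rw [← normSqA_eq_two_mul hw]
  exact (Real.sqrt_le_left (eps_nonneg_of_c1NormA_le hA)).1 h

lemma abs_sff_le {x : Plane} {w : Fin 2 → Plane} (hw : IsTangentFrame M.f x w) (p q : Fin 2) :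
    |sff M.f M.n x (w p) (w q)| ≤ ε := by
  have h0 := eps_nonneg_of_c1NormA_le hA
  have h := two_mul_sff_sq_le hA hw
  refine abs_le_of_sq_le_sq ?_ h0
  fin_cases p <;> fin_cases q <;>
    simp only [Fin.zero_eta, Fin.mk_one, sff_trace hw, sff_comm M.f_smooth x (w 1) (w 0)] <;>
    nlinarith [sq_nonneg (sff M.f M.n x (w 0) (w 0)), sq_nonneg (sff M.f M.n x (w 0) (w 1))]

lemma abs_covSff_le {x : Plane} {w : Fin 2 → Plane} (hw : IsTangentFrame M.f x w)
    (p q r : Fin 2) : |covSff M.f M.n w x (w p) (w q) (w r)| ≤ ε := by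
  have h0 := eps_nonneg_of_c1NormA_le hA
  have h := (le_ciSup M.bddAbove_normGradA x).trans ((le_max_right _ _).trans hA)
  have h2 := (Real.sqrt_le_left h0).1 h
  rw [M.isSurface.normSqGradA_eq M.n_smooth hw] at h2
  refine abs_le_of_sq_le_sq (le_trans ?_ h2) h0
  calc _ ≤ ∑ r, covSff M.f M.n w x (w p) (w q) (w r) ^ 2 :=
        Finset.single_le_sum (f := fun r => covSff M.f M.n w x (w p) (w q) (w r) ^ 2)
          (fun _ _ => sq_nonneg _) (Finset.mem_univ r)
    _ ≤ ∑ q, ∑ r, covSff M.f M.n w x (w p) (w q) (w r) ^ 2 :=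
        Finset.single_le_sum (f := fun q => ∑ r, covSff M.f M.n w x (w p) (w q) (w r) ^ 2)
          (fun _ _ => Finset.sum_nonneg fun _ _ => sq_nonneg _) (Finset.mem_univ q)
    _ ≤ _ := Finset.single_le_sum
          (f := fun p => ∑ q, ∑ r, covSff M.f M.n w x (w p) (w q) (w r) ^ 2)
          (fun _ _ => Finset.sum_nonneg fun _ _ => Finset.sum_nonneg fun _ _ => sq_nonneg _)
          (Finset.mem_univ p)

lemma lambdaMax_le : M.lambdaMax ≤ ε := by
  have h0 := eps_nonneg_of_c1NormA_le hA
  refine Real.sSup_le ?_ h0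
  rintro _ ⟨x, κ, h, rfl⟩
  obtain ⟨w, hw⟩ := M.isSurface.exists_frame x
  refine abs_le_of_sq_le_sq ?_ h0
  rw [sq_of_isPrincipalCurvature hw h]
  have := two_mul_sff_sq_le hA hw
  nlinarith [sq_nonneg (sff M.f M.n x (w 0) (w 0)), sq_nonneg (sff M.f M.n x (w 0) (w 1))]

end AlmostFuchsian

namespace AlmostFuchsian

variable (M : AlmostFuchsian)

/-! ### The nearest point projection onto the minimal surface -/

lemma isCompact_preimage_f {B : Set Minkowski} (hB : IsCompact B) (hBH : B ⊆ Hyp3) :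
    IsCompact {x | M.f x ∈ B} := by
  obtain ⟨K, hK, hKM⟩ := M.cocompact
  set C := B ∪ M.f '' K with hC
  have hCc : IsCompact C := hB.union (hK.image M.f_smooth.continuous)
  have hCH : C ⊆ Hyp3 := by
    rintro _ (h | ⟨x, -, rfl⟩)
    · exact hBH h
    · exact (M.surface x).mem
  set S := {γ : M.Γ | (((γ : Minkowski ≃ₗ[ℝ] Minkowski) '' C) ∩ C).Nonempty} with hS
  have hfin : S.Finite := by
    refine Set.Finite.of_finite_image (f := Subtype.val) ?_ Subtype.val_injective.injOn
    refine (M.properlyDiscontinuous C hCH hCc).subset ?_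
    rintro _ ⟨γ, hγ, rfl⟩
    exact ⟨γ.2, hγ⟩
  have hU : IsCompact (⋃ γ ∈ S, M.deck γ '' K) :=
    hfin.isCompact_biUnion fun γ _ => hK.image (M.deck_smooth γ).continuous
  refine hU.of_isClosed_subset (hB.isClosed.preimage M.f_smooth.continuous) fun x hx => ?_
  obtain ⟨γ, hγ⟩ := hKM x
  have e1 : M.f x = ((γ⁻¹ : M.Γ) : Minkowski ≃ₗ[ℝ] Minkowski) (M.f (M.deck γ x)) := by
    rw [← M.f_equivariant, map_inv]
    simp
  refine mem_iUnion₂.2 ⟨γ⁻¹, ?_, M.deck γ x, hγ, by rw [map_inv]; simp⟩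
  exact ⟨M.f x, ⟨M.f (M.deck γ x), Or.inr ⟨_, hγ, rfl⟩, e1.symm⟩, Or.inl hx⟩

lemma isCompact_hyp3_inter {p : Minkowski} (hp : p ∈ futureCone) (B : ℝ) :
    IsCompact {q | q ∈ Hyp3 ∧ -mink q p ≤ B} := by
  obtain ⟨a, ha, hap⟩ := exists_time_le_mink hp
  have hcm : ∀ {u v : Minkowski → Minkowski}, Continuous u → Continuous v →
      Continuous fun q => mink (u q) (v q) := fun hu hv => continuous_mink.comp (hu.prodMk hv)
  have heq : {q | q ∈ Hyp3 ∧ -mink q p ≤ B}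
      = {q : Minkowski | mink q q = -1} ∩ {q | 0 ≤ q 0} ∩ {q | -mink q p ≤ B} := by
    ext q
    simp only [Hyp3, mem_ofPred_eq, mem_inter_iff]
    refine and_congr_left fun _ => and_congr_right fun h1 => ⟨le_of_lt, fun h2 => ?_⟩
    refine lt_of_le_of_ne h2 fun h3 => ?_
    simp only [mink] at h1
    rw [← h3] at h1
    nlinarith [sq_nonneg (q 1), sq_nonneg (q 2), sq_nonneg (q 3)]
  have hcl : IsClosed {q | q ∈ Hyp3 ∧ -mink q p ≤ B} := by
    rw [heq]
    refine ((isClosed_eq (hcm continuous_id continuous_id) continuous_const).inter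
      (isClosed_le continuous_const (continuous_apply 0))).inter
      (isClosed_le (hcm continuous_id continuous_const).neg continuous_const)
  refine (isCompact_closedBall (0 : Minkowski) (B / a)).of_isClosed_subset hcl ?_
  rintro q ⟨hq, hqB⟩
  have h0 : q 0 ≤ B / a := by
    rw [le_div_iff₀ ha]
    linarith [hap q hq]
  have hq1 := hq.1
  simp only [mink] at hq1
  rw [mem_closedBall_zero_iff]
  refine (pi_norm_le_iff_of_nonneg (hq.2.le.trans h0)).2 fun i => le_trans ?_ h0
  rw [Real.norm_eq_abs]
  refine abs_le_of_sq_le_sq ?_ hq.2.le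
  fin_cases i <;> simp only [Fin.zero_eta, Fin.mk_one, Fin.reduceFinMk] <;>
    nlinarith [sq_nonneg (q 1), sq_nonneg (q 2), sq_nonneg (q 3)]

/-- `x` is a foot point of `p`: the geodesic through `p` normal to the surface meets it at `x`. -/
def IsFoot (p : Minkowski) (x : Plane) : Prop := ∀ v, mink (dd v M.f x) p = 0

variable {M}

/-- A point is the combination of position and normal vector at its foot point. -/
lemma IsFoot.eq {p : Minkowski} {x : Plane} (h : M.IsFoot p x) :
    p = (-mink p (M.f x)) • M.f x + mink p (M.n x) • M.n x := by
  obtain ⟨w, hw⟩ := M.isSurface.exists_frame x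
  conv_lhs => rw [(M.isSurface.lorentzFrame hw).expand p]
  rw [mink_comm p (dd (w 0) M.f x), mink_comm p (dd (w 1) M.f x), h, h]
  simp

lemma IsFoot.mink_self {p : Minkowski} {x : Plane} (h : M.IsFoot p x) :
    mink p p = -mink p (M.f x) ^ 2 + mink p (M.n x) ^ 2 := by
  obtain ⟨w, hw⟩ := M.isSurface.exists_frame x
  rw [(M.isSurface.lorentzFrame hw).parseval p p, mink_comm p (dd (w 0) M.f x),
    mink_comm p (dd (w 1) M.f x), h, h]
  ring

lemma neg_mink_f_pos {p : Minkowski} (hp : p ∈ futureCone) (x : Plane) : 0 < -mink p (M.f x) := by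
  obtain ⟨a, ha, hap⟩ := exists_time_le_mink hp
  have := hap _ (M.surface x).mem
  rw [mink_comm p]
  exact (mul_pos ha (M.surface x).mem.2).trans_le this

/-- The form `A g + B h` is positive definite when `|B| < A`: principal curvatures lie in
`(-1, 1)`. -/
lemma comb_pos {A B : ℝ} (hA : 0 < A) (hAB : B ^ 2 < A ^ 2) (x : Plane) {v : Plane} (hv : v ≠ 0) :
    0 < A * mink (dd v M.f x) (dd v M.f x) + B * sff M.f M.n x v v := by
  obtain ⟨w, hw⟩ := M.isSurface.exists_frame x
  have h1 := sff_self_sq_le hw v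
  have h2 := sff_sq_lt_one hw
  have hg := M.isSurface.mink_dd_pos x hv
  set g := mink (dd v M.f x) (dd v M.f x)
  set s := sff M.f M.n x v v
  have h3 : s ^ 2 ≤ g ^ 2 := h1.trans (by nlinarith [sq_nonneg g])
  have h4 : (B * s) ^ 2 < (A * g) ^ 2 := by
    rw [mul_pow, mul_pow]
    calc B ^ 2 * s ^ 2 ≤ B ^ 2 * g ^ 2 := by gcongr
      _ < A ^ 2 * g ^ 2 := by
        have : 0 < g ^ 2 := by positivity
        gcongr
  have := (abs_lt.1 (abs_lt_of_sq_lt_sq h4 (by positivity))).1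
  linarith

lemma sq_lt_sq_of_isFoot {p : Minkowski} (hp : p ∈ futureCone) {x : Plane} (h : M.IsFoot p x) :
    mink p (M.n x) ^ 2 < (-mink p (M.f x)) ^ 2 := by
  have := h.mink_self
  have := hp.1
  rw [neg_sq]
  linarith

lemma contDiff_height (p : Minkowski) : ContDiff ℝ ∞ fun x => -mink (M.f x) p :=
  (M.f_smooth.mink contDiff_const).neg

lemma dd_height (p : Minkowski) (x v : Plane) :
    dd v (fun x => -mink (M.f x) p) x = -mink (dd v M.f x) p := by
  have h : (fun x => -mink (M.f x) p) = fun x => mink (M.f x) (-p) := by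
    funext x; rw [mink_neg_right]
  rw [h, dd_mink (M.f_smooth.diffAt x) (differentiableAt_const _)]
  simp [mink_neg_right, mink_zero_right]

lemma isFoot_iff (p : Minkowski) (x : Plane) :
    M.IsFoot p x ↔ fderiv ℝ (fun x => -mink (M.f x) p) x = 0 := by
  refine ⟨fun h => ContinuousLinearMap.ext fun v => ?_, fun h v => ?_⟩
  · have := dd_height (M := M) p x v
    rw [h v, neg_zero] at this
    exact this
  · have := dd_height (M := M) p x v
    rw [dd, h] at this
    simpa using this.symm

lemma isCompact_height_le {p : Minkowski} (hp : p ∈ futureCone) (B : ℝ) :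
    IsCompact {x | -mink (M.f x) p ≤ B} := by
  have := M.isCompact_preimage_f (isCompact_hyp3_inter hp B) fun q hq => hq.1
  convert this using 1
  ext x
  exact ⟨fun h => ⟨(M.surface x).mem, h⟩, fun h => h.2⟩

lemma exists_isFoot {p : Minkowski} (hp : p ∈ futureCone) :
    ∃ x, M.IsFoot p x ∧ ∀ y, -mink (M.f x) p ≤ -mink (M.f y) p := by
  have hc := (contDiff_height (M := M) p).continuous
  obtain ⟨x, hx, hmin⟩ := (isCompact_height_le (M := M) hp (-mink (M.f 0) p)).exists_isMinOn
    ⟨0, le_refl (-mink (M.f 0) p)⟩ hc.continuousOn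
  have hall : ∀ y, -mink (M.f x) p ≤ -mink (M.f y) p := by
    intro y
    by_cases hy : -mink (M.f y) p ≤ -mink (M.f 0) p
    · exact hmin hy
    · exact le_trans hx (not_le.1 hy).le
  refine ⟨x, (isFoot_iff p x).2 ?_, hall⟩
  exact IsLocalMin.fderiv_eq_zero (Eventually.of_forall hall)

/-- The foot point is unique: by convexity all critical points of the (hyperbolic cosine of the)
distance to `p` are nondegenerate minima. -/
lemma isFoot_unique {p : Minkowski} (hp : p ∈ futureCone) {x y : Plane} (hx : M.IsFoot p x)
    (hy : M.IsFoot p y) : x = y := by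
  refine critical_point_unique (contDiff_height (M := M) p) (isCompact_height_le hp) ?_
    ((isFoot_iff p x).1 hx) ((isFoot_iff p y).1 hy)
  intro z hz
  refine strict_min_of_hessian_pos (contDiff_height p) hz fun v hv => ?_
  have hzf := (isFoot_iff p z).2 hz
  rw [← dd_dd_eq (contDiff_height p).contDiffAt]
  have e : dd v (fun x => -mink (M.f x) p) = fun x => -mink (dd v M.f x) p := by
    funext x; exact dd_height p x v
  have e2 : dd v (fun x => -mink (dd v M.f x) p) z = -mink (dd v (dd v M.f) z) p := by
    have h : (fun x => -mink (dd v M.f x) p) = fun x => mink (dd v M.f x) (-p) := by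
      funext x; rw [mink_neg_right]
    rw [h, dd_mink ((M.f_smooth.dd v).diffAt z) (differentiableAt_const _)]
    simp [mink_neg_right, mink_zero_right]
  rw [e, e2, hzf.eq, mink_add_right, mink_smul_right, mink_smul_right, M.isSurface.mink_dd_dd_self,
    mink_comm (dd v (dd v M.f) z) (M.n z)]
  have := comb_pos (M := M) (neg_mink_f_pos hp z) (sq_lt_sq_of_isFoot hp hzf) z hv
  simp only [sff] at this
  linarith

variable (M) in
/-- The nearest point projection of `ℍ³` (extended to the future cone as a function that is
constant along rays) onto the minimal surface. -/
noncomputable def foot (p : Minkowski) : Plane := Classical.epsilon fun x => M.IsFoot p x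

lemma foot_spec {p : Minkowski} (hp : p ∈ futureCone) : M.IsFoot p (M.foot p) :=
  Classical.epsilon_spec (p := fun x => M.IsFoot p x)
    (let ⟨x, hx, _⟩ := exists_isFoot hp; ⟨x, hx⟩)

lemma foot_eq {p : Minkowski} (hp : p ∈ futureCone) {x : Plane} (h : M.IsFoot p x) :
    M.foot p = x := isFoot_unique hp (foot_spec hp) h

lemma foot_min {p : Minkowski} (hp : p ∈ futureCone) (y : Plane) :
    -mink (M.f (M.foot p)) p ≤ -mink (M.f y) p := by
  obtain ⟨x, hx, hmin⟩ := exists_isFoot (M := M) hp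
  rw [foot_eq hp hx]
  exact hmin y

lemma foot_equivariant {p : Minkowski} (hp : p ∈ Hyp3) (γ : M.Γ) :
    M.foot ((γ : Minkowski ≃ₗ[ℝ] Minkowski) p) = M.deck γ (M.foot p) := by
  have hγ := M.isometry γ γ.2
  refine foot_eq (Hyp3_subset_futureCone (hγ.map_mem p hp)) ((isFoot_iff _ _).2 ?_)
  refine IsLocalMin.fderiv_eq_zero (Eventually.of_forall fun y => ?_)
  obtain ⟨z, rfl⟩ := (M.deck γ).surjective y
  simp only [M.f_equivariant, hγ.mink_map]
  exact foot_min (Hyp3_subset_futureCone hp) z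

/-- The projection is smooth, by the inverse function theorem for `(x, a, b) ↦ a f(x) + b n(x)`. -/
lemma contDiffAt_foot {p : Minkowski} (hp : p ∈ futureCone) : ContDiffAt ℝ ∞ M.foot p := by
  set x₀ := M.foot p
  set A := -mink p (M.f x₀)
  set B := mink p (M.n x₀)
  have hfoot : M.IsFoot p x₀ := foot_spec hp
  set Φ : Plane × ℝ × ℝ → Minkowski := fun q => q.2.1 • M.f q.1 + q.2.2 • M.n q.1 with hΦ
  have hΦs : ContDiff ℝ ∞ Φ :=
    ((contDiff_fst.comp contDiff_snd).smul (M.f_smooth.comp contDiff_fst)).add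
      ((contDiff_snd.comp contDiff_snd).smul (M.n_smooth.comp contDiff_fst))
  have hΦp : Φ (x₀, A, B) = p := hfoot.eq.symm
  have hder : ∀ (v : Plane) (α β : ℝ), fderiv ℝ Φ (x₀, A, B) (v, α, β)
      = α • M.f x₀ + A • dd v M.f x₀ + (β • M.n x₀ + B • dd v M.n x₀) := by
    intro v α β
    have h1 : HasFDerivAt (fun q : Plane × ℝ × ℝ => M.f q.1)
        ((fderiv ℝ M.f x₀).comp (ContinuousLinearMap.fst ℝ Plane (ℝ × ℝ))) (x₀, A, B) :=
      HasFDerivAt.comp (x₀, A, B) (f := Prod.fst) (g := M.f) (M.f_smooth.diffAt x₀).hasFDerivAt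
        hasFDerivAt_fst
    have h2 : HasFDerivAt (fun q : Plane × ℝ × ℝ => M.n q.1)
        ((fderiv ℝ M.n x₀).comp (ContinuousLinearMap.fst ℝ Plane (ℝ × ℝ))) (x₀, A, B) :=
      HasFDerivAt.comp (x₀, A, B) (f := Prod.fst) (g := M.n) (M.n_smooth.diffAt x₀).hasFDerivAt
        hasFDerivAt_fst
    have h3 : HasFDerivAt (fun q : Plane × ℝ × ℝ => q.2.1)
        ((ContinuousLinearMap.fst ℝ ℝ ℝ).comp (ContinuousLinearMap.snd ℝ Plane (ℝ × ℝ)))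
        (x₀, A, B) := hasFDerivAt_fst.comp _ hasFDerivAt_snd
    have h4 : HasFDerivAt (fun q : Plane × ℝ × ℝ => q.2.2)
        ((ContinuousLinearMap.snd ℝ ℝ ℝ).comp (ContinuousLinearMap.snd ℝ Plane (ℝ × ℝ)))
        (x₀, A, B) := hasFDerivAt_snd.comp _ hasFDerivAt_snd
    have h5 := ((h3.fun_smul h1).fun_add (h4.fun_smul h2)).fderiv
    rw [hΦ, h5]
    simp [dd]
    abel
  have hinj : Function.Injective (fderiv ℝ Φ (x₀, A, B)) := by
    rw [injective_iff_map_eq_zero]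
    rintro ⟨v, α, β⟩ h0
    rw [hder] at h0
    have hS := M.isSurface
    have hα := congrArg (fun V => mink V (M.f x₀)) h0
    have hβ := congrArg (fun V => mink V (M.n x₀)) h0
    have hv := congrArg (fun V => mink V (dd v M.f x₀)) h0
    simp only [mink_add_left, mink_smul_left, mink_zero_left, (M.surface x₀).mem.1,
      hS.mink_dd_self, (M.surface x₀).normal_tangent, hS.mink_dd_normal_pos M.n_smooth] at hα
    simp only [mink_add_left, mink_smul_left, mink_zero_left, (M.surface x₀).normal_unit,
      mink_comm (M.f x₀) (M.n x₀), mink_comm (dd v M.f x₀) (M.n x₀), hS.mink_normal_dd,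
      (M.surface x₀).normal_tangent, hS.mink_dd_normal_self M.n_smooth] at hβ
    simp only [mink_add_left, mink_smul_left, mink_zero_left, mink_comm (M.f x₀),
      hS.mink_dd_self, hS.mink_normal_dd, hS.mink_dd_normal_dd M.n_smooth] at hv
    have hv0 : v = 0 := by
      by_contra hne
      have := comb_pos (M := M) (neg_mink_f_pos hp x₀) (sq_lt_sq_of_isFoot hp hfoot) x₀ hne
      linarith
    have hα0 : α = 0 := by linarith
    have hβ0 : β = 0 := by linarith
    rw [hv0, hα0, hβ0]; rfl
  have hfr : Module.finrank ℝ (Plane × ℝ × ℝ) = Module.finrank ℝ Minkowski := by simp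
  set e : (Plane × ℝ × ℝ) ≃L[ℝ] Minkowski :=
    (LinearEquiv.ofInjectiveOfFinrankEq (fderiv ℝ Φ (x₀, A, B) : (Plane × ℝ × ℝ) →ₗ[ℝ] Minkowski)
      hinj hfr).toContinuousLinearEquiv with he
  have hΦe : HasFDerivAt Φ (e : (Plane × ℝ × ℝ) →L[ℝ] Minkowski) (x₀, A, B) := by
    have : (e : (Plane × ℝ × ℝ) →L[ℝ] Minkowski) = fderiv ℝ Φ (x₀, A, B) := by
      exact ContinuousLinearMap.ext fun q => rfl
    rw [this]
    exact (hΦs.diffAt _).hasFDerivAt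
  have hΦst : HasStrictFDerivAt Φ (e : (Plane × ℝ × ℝ) →L[ℝ] Minkowski) (x₀, A, B) :=
    hΦs.contDiffAt.hasStrictFDerivAt' hΦe (by simp)
  have hinv := hΦs.contDiffAt.to_localInverse hΦe (by simp)
  have hright := hΦst.eventually_right_inverse
  rw [hΦp] at hinv hright
  refine ContDiffAt.congr_of_eventuallyEq (f := fun q =>
    ((hΦs.contDiffAt.localInverse hΦe (by simp)) q).1) hinv.fst ?_
  filter_upwards [hright, isOpen_futureCone.mem_nhds hp] with q hq hqc
  refine foot_eq hqc fun v => ?_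
  change Φ (hΦst.localInverse Φ e (x₀, A, B) q) = q at hq
  change mink (dd v M.f (hΦst.localInverse Φ e (x₀, A, B) q).1) q = 0
  set y := hΦst.localInverse Φ e (x₀, A, B) q
  rw [← hq, hΦ, mink_add_right, mink_smul_right, mink_smul_right, M.isSurface.mink_dd_self,
    mink_comm _ (M.n y.1), M.isSurface.mink_normal_dd]
  ring

/-! ### The radial field and the angle function -/

lemma normalExp_mem (x : Plane) (r : ℝ) : M.normalExp x r ∈ Hyp3 := by
  have hm : mink (M.normalExp x r) (M.normalExp x r) = -1 := by
    simp only [normalExp, mink_add_left, mink_add_right, mink_smul_left, mink_smul_right,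
      (M.surface x).mem.1, (M.surface x).normal_tangent, (M.surface x).normal_unit,
      mink_comm (M.f x) (M.n x)]
    linear_combination (-1 : ℝ) * Real.cosh_sq_sub_sinh_sq r
  refine ⟨hm, ?_⟩
  have hn := (M.surface x).normal_unit
  have ht := (M.surface x).normal_tangent
  have hf := (M.surface x).mem
  -- the time component of a unit normal is smaller than that of the position vector
  have hlt : (Real.sinh r * M.n x 0) ^ 2 < (Real.cosh r * M.f x 0) ^ 2 := by
    have h1 : (M.n x 0) ^ 2 < (M.f x 0) ^ 2 := by
      have hff := hf.1
      simp only [mink] at hn ht hff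
      have hcs : (M.n x 0 * M.f x 0) ^ 2 ≤ (1 + M.n x 0 ^ 2) * (M.f x 0 ^ 2 - 1) := by
        have e1 : M.n x 0 * M.f x 0
            = M.n x 1 * M.f x 1 + M.n x 2 * M.f x 2 + M.n x 3 * M.f x 3 := by linarith
        have e2 : 1 + M.n x 0 ^ 2 = M.n x 1 ^ 2 + M.n x 2 ^ 2 + M.n x 3 ^ 2 := by linarith
        have e3 : M.f x 0 ^ 2 - 1 = M.f x 1 ^ 2 + M.f x 2 ^ 2 + M.f x 3 ^ 2 := by linarith
        rw [e1, e2, e3]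
        nlinarith [sq_nonneg (M.n x 1 * M.f x 2 - M.n x 2 * M.f x 1),
          sq_nonneg (M.n x 1 * M.f x 3 - M.n x 3 * M.f x 1),
          sq_nonneg (M.n x 2 * M.f x 3 - M.n x 3 * M.f x 2)]
      nlinarith
    have h2 := Real.cosh_sq r
    rw [mul_pow, mul_pow, h2]
    nlinarith [sq_nonneg (Real.sinh r), sq_nonneg (M.f x 0), sq_nonneg (M.n x 0)]
  have := (abs_lt.1 (abs_lt_of_sq_lt_sq hlt (mul_pos (Real.cosh_pos r) hf.2).le)).1
  simp only [normalExp, Pi.add_apply, Pi.smul_apply, smul_eq_mul]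
  linarith

lemma isFoot_normalExp (x : Plane) (r : ℝ) : M.IsFoot (M.normalExp x r) x := by
  intro v
  rw [normalExp, mink_add_right, mink_smul_right, mink_smul_right, M.isSurface.mink_dd_self,
    mink_comm _ (M.n x), M.isSurface.mink_normal_dd]
  ring

lemma foot_normalExp (x : Plane) (r : ℝ) : M.foot (M.normalExp x r) = x :=
  foot_eq (Hyp3_subset_futureCone (normalExp_mem x r)) (isFoot_normalExp x r)

variable (M) in
/-- The normal of the minimal surface at the foot point of `p`. It coincides with
`cosh r ∂/∂r - (sinh r) p` where `r` is the signed distance of `p` to the surface. -/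
noncomputable def footNormal (p : Minkowski) : Minkowski := M.n (M.foot p)

lemma mink_normalExp_n (x : Plane) (r : ℝ) : mink (M.normalExp x r) (M.n x) = Real.sinh r := by
  rw [normalExp, mink_add_left, mink_smul_left, mink_smul_left, (M.surface x).normal_unit,
    mink_comm, (M.surface x).normal_tangent]
  ring

lemma exists_normalExp_eq {p : Minkowski} (hp : p ∈ Hyp3) : ∃ r, M.normalExp (M.foot p) r = p := by
  have hc := Hyp3_subset_futureCone hp
  have hf := foot_spec (M := M) hc
  refine ⟨Real.arsinh (mink p (M.n (M.foot p))), ?_⟩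
  have h1 := hf.mink_self
  have h2 := neg_mink_f_pos (M := M) hc (M.foot p)
  rw [hp.1] at h1
  conv_rhs => rw [hf.eq]
  rw [normalExp, Real.sinh_arsinh, Real.cosh_arsinh]
  congr 2
  rw [Real.sqrt_eq_iff_mul_self_eq (by positivity) h2.le]
  linarith

/-- The angle function in terms of the normal at the foot point. -/
lemma angle_eq {F ν : Plane → Minkowski} {x : Plane} (hF : F x ∈ Hyp3) (hν : mink (ν x) (F x) = 0) :
    M.angle F ν x = mink (ν x) (M.footNormal (F x))
      / Real.sqrt (1 + mink (F x) (M.footNormal (F x)) ^ 2) := by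
  set q := Function.invFun (fun q : Plane × ℝ => M.normalExp q.1 q.2) (F x) with hq
  have hqe : M.normalExp q.1 q.2 = F x := by
    obtain ⟨r, hr⟩ := exists_normalExp_eq (M := M) hF
    exact Function.invFun_eq (f := fun q : Plane × ℝ => M.normalExp q.1 q.2)
      ⟨(M.foot (F x), r), hr⟩
  have hfoot : M.foot (F x) = q.1 := by rw [← hqe, foot_normalExp]
  have hs : mink (F x) (M.footNormal (F x)) = Real.sinh q.2 := by
    rw [footNormal, hfoot, ← hqe, mink_normalExp_n]
  have hcosh : Real.sqrt (1 + Real.sinh q.2 ^ 2) = Real.cosh q.2 := by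
    rw [add_comm, ← Real.cosh_sq, Real.sqrt_sq (Real.cosh_pos _).le]
  have hang : M.angle F ν x = mink (ν x) (M.normalExpVelocity q.1 q.2) := rfl
  rw [hs, hcosh, hang, eq_div_iff (Real.cosh_pos _).ne', footNormal, hfoot]
  rw [← hqe, normalExp, mink_add_right, mink_smul_right, mink_smul_right] at hν
  rw [normalExpVelocity, mink_add_right, mink_smul_right, mink_smul_right]
  linear_combination Real.sinh q.2 * hν + mink (ν x) (M.n q.1) * Real.cosh_sq_sub_sinh_sq q.2

end AlmostFuchsian

namespace AlmostFuchsian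

variable {M : AlmostFuchsian}

/-! ### Derivatives of the normal at the foot point -/

section FootNormal

lemma eventually_mem_futureCone {Q : Minkowski} (hQ : Q ∈ futureCone) :
    ∀ᶠ R in 𝓝 Q, R ∈ futureCone := isOpen_futureCone.mem_nhds hQ

lemma contDiffAt_footNormal {P : Minkowski} (hP : P ∈ futureCone) :
    ContDiffAt ℝ ∞ M.footNormal P :=
  M.n_smooth.contDiffAt.comp P (contDiffAt_foot hP)

/-- The derivative of the equation `⟨∂ᵥf, Q⟩ = 0` that defines the foot point of `Q`. -/
lemma dd_foot_eq {Q : Minkowski} (hQ : Q ∈ futureCone) (X : Minkowski) (v : Plane) :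
    mink (dd (dd X M.foot Q) (dd v M.f) (M.foot Q)) Q + mink (dd v M.f (M.foot Q)) X = 0 := by
  have hfoot := contDiffAt_foot (M := M) hQ
  have hc : ∀ᶠ R in 𝓝 Q, mink (dd v M.f (M.foot R)) R = 0 :=
    (eventually_mem_futureCone hQ).mono fun R hR => foot_spec hR v
  have h := dd_eq_zero_of_eventually_const hc X
  rw [dd_mink (A := fun R => dd v M.f (M.foot R)) (B := fun R => R)
    (((M.f_smooth.dd v).diffAt _).comp Q hfoot.diffAt) differentiableAt_id,
    dd_comp ((M.f_smooth.dd v).diffAt _) hfoot.diffAt] at h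
  simpa [dd] using h

/-- The second derivative of the equation `⟨∂ᵥf, Q⟩ = 0` that defines the foot point of `Q`. -/
lemma dd_dd_foot_eq {Q : Minkowski} (hQ : Q ∈ futureCone) (X : Minkowski) (v : Plane) :
    mink (dd (dd X M.foot Q) (dd (dd X M.foot Q) (dd v M.f)) (M.foot Q)) Q
      + mink (dd (dd X (dd X M.foot) Q) (dd v M.f) (M.foot Q)) Q
      + 2 * mink (dd (dd X M.foot Q) (dd v M.f) (M.foot Q)) X = 0 := by
  have hfoot := contDiffAt_foot (M := M) hQ
  have hfv := M.f_smooth.dd v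
  have hD : ContDiff ℝ ∞ (fderiv ℝ (dd v M.f)) := hfv.fderiv_right (by simp)
  have hc : ∀ᶠ R in 𝓝 Q, mink (dd (dd X M.foot R) (dd v M.f) (M.foot R)) R
      + mink (dd v M.f (M.foot R)) X = 0 :=
    (eventually_mem_futureCone hQ).mono fun R hR => dd_foot_eq hR X v
  have h := dd_eq_zero_of_eventually_const hc X
  have hA : ContDiffAt ℝ ∞ (fun R => dd (dd X M.foot R) (dd v M.f) (M.foot R)) Q :=
    (hD.contDiffAt.comp Q hfoot).clm_apply (hfoot.dd X)
  have hB : ContDiffAt ℝ ∞ (fun R => dd v M.f (M.foot R)) Q := hfv.contDiffAt.comp Q hfoot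
  have e1 : dd X (fun R => dd (dd X M.foot R) (dd v M.f) (M.foot R)) Q
      = dd (dd X M.foot Q) (dd (dd X M.foot Q) (dd v M.f)) (M.foot Q)
        + dd (dd X (dd X M.foot) Q) (dd v M.f) (M.foot Q) := by
    rw [dd_dd_eq hfv.contDiffAt]
    exact dd_clm_comp (hD.diffAt _) hfoot.diffAt (hfoot.dd X).diffAt X
  have e2 : dd X (fun R => dd v M.f (M.foot R)) Q = dd (dd X M.foot Q) (dd v M.f) (M.foot Q) :=
    dd_comp (hfv.diffAt _) hfoot.diffAt X
  have e3 : dd X (fun R : Minkowski => R) Q = X := by simp [dd]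
  rw [dd_add (A := fun R => mink (dd (dd X M.foot R) (dd v M.f) (M.foot R)) R)
    (B := fun R => mink (dd v M.f (M.foot R)) X)
    (hA.mink contDiffAt_id).diffAt (hB.mink contDiffAt_const).diffAt,
    dd_mink (B := fun R => R) hA.diffAt differentiableAt_id,
    dd_mink hB.diffAt (differentiableAt_const X), e1, e2, e3,
    mink_add_left, dd_const, mink_zero_right] at h
  linarith

lemma dd_footNormal {Q : Minkowski} (hQ : Q ∈ futureCone) (X : Minkowski) :
    dd X M.footNormal Q = dd (dd X M.foot Q) M.n (M.foot Q) :=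
  dd_comp (M.n_smooth.diffAt _) (contDiffAt_foot hQ).diffAt X

lemma dd_dd_footNormal {Q : Minkowski} (hQ : Q ∈ futureCone) (X : Minkowski) :
    dd X (dd X M.footNormal) Q
      = dd (dd X M.foot Q) (dd (dd X M.foot Q) M.n) (M.foot Q)
        + dd (dd X (dd X M.foot) Q) M.n (M.foot Q) := by
  have hfoot := contDiffAt_foot (M := M) hQ
  have hD : ContDiff ℝ ∞ (fderiv ℝ M.n) := M.n_smooth.fderiv_right (by simp)
  have hc : dd X M.footNormal =ᶠ[𝓝 Q] fun R => dd (dd X M.foot R) M.n (M.foot R) :=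
    (eventually_mem_futureCone hQ).mono fun R hR => dd_footNormal hR X
  rw [hc.dd_eq, dd_dd_eq M.n_smooth.contDiffAt]
  exact dd_clm_comp (hD.diffAt _) hfoot.diffAt (hfoot.dd X).diffAt X

variable {P : Minkowski} (hP : P ∈ Hyp3) {w : Fin 2 → Plane}
  (hw : IsTangentFrame M.f (M.foot P) w)

include hP in
lemma cosh_sq_eq : (-mink P (M.f (M.foot P))) ^ 2 = 1 + mink P (M.footNormal P) ^ 2 := by
  have := (foot_spec (M := M) (Hyp3_subset_futureCone hP)).mink_self
  rw [hP.1] at this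
  rw [footNormal]
  linarith

include hP in
lemma cosh_pos : 0 < -mink P (M.f (M.foot P)) :=
  neg_mink_f_pos (Hyp3_subset_futureCone hP) _

include hP in
lemma mink_right_eq (V : Minkowski) : mink V P = -mink P (M.f (M.foot P)) * mink V (M.f (M.foot P))
    + mink P (M.footNormal P) * mink V (M.n (M.foot P)) := by
  have hf := congrArg (mink V) (foot_spec (M := M) (Hyp3_subset_futureCone hP)).eq
  rwa [mink_add_right, mink_smul_right, mink_smul_right] at hf

include hP in
lemma mink_dd_dd_foot (u v : Plane) : mink (dd u (dd v M.f) (M.foot P)) P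
    = -(-mink P (M.f (M.foot P)) * mink (dd u M.f (M.foot P)) (dd v M.f (M.foot P))
      + mink P (M.footNormal P) * sff M.f M.n (M.foot P) u v) := by
  rw [mink_right_eq hP, M.isSurface.mink_dd_dd_self, sff,
    mink_comm (dd u (dd v M.f) (M.foot P)) (M.n _)]
  ring

include hP in
/-- The foot point moves with velocity `u` where `(cosh r g + sinh r h) u` is the tangential part of
the velocity `X`. -/
lemma foot_velocity (X : Minkowski) (v : Plane) :
    -mink P (M.f (M.foot P)) * mink (dd (dd X M.foot P) M.f (M.foot P)) (dd v M.f (M.foot P))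
      + mink P (M.footNormal P) * sff M.f M.n (M.foot P) (dd X M.foot P) v
      = mink (dd v M.f (M.foot P)) X := by
  have h := dd_foot_eq (M := M) (Hyp3_subset_futureCone hP) X v
  rw [mink_dd_dd_foot hP] at h
  linarith

include hw in
lemma mink_tangent_expand (V : Minkowski) (a : Plane) : mink V (dd a M.f (M.foot P))
    = ∑ q, mink V (dd (w q) M.f (M.foot P)) * mink (dd a M.f (M.foot P)) (dd (w q) M.f (M.foot P)) := by
  conv_lhs => rw [hw.expand a]
  rw [Fin.sum_univ_two, Fin.sum_univ_two, dd_add_dir, dd_smul_dir, dd_smul_dir, mink_add_right,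
    mink_smul_right, mink_smul_right]
  ring

/-- The covariant acceleration of the foot point of `P + τ X` at `τ = 0`. -/
noncomputable def footAccel (M : AlmostFuchsian) (w : Fin 2 → Plane) (P X : Minkowski) : Plane :=
  dd X (dd X M.foot) P + ∑ q, mink (dd (dd X M.foot P) (dd (dd X M.foot P) M.f) (M.foot P))
    (dd (w q) M.f (M.foot P)) • w q

include hw in
lemma mink_footAccel (X : Minkowski) (v : Plane) :
    mink (dd (footAccel M w P X) M.f (M.foot P)) (dd v M.f (M.foot P))
      = mink (dd (dd X (dd X M.foot) P) M.f (M.foot P)) (dd v M.f (M.foot P))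
        + mink (dd (dd X M.foot P) (dd (dd X M.foot P) M.f) (M.foot P))
          (dd v M.f (M.foot P)) := by
  rw [mink_tangent_expand hw (dd (dd X M.foot P) (dd (dd X M.foot P) M.f) (M.foot P)) v,
    footAccel, dd_add_dir, mink_add_left, Fin.sum_univ_two, Fin.sum_univ_two, dd_add_dir,
    dd_smul_dir, dd_smul_dir, mink_add_left, mink_smul_left, mink_smul_left,
    mink_comm (dd (w 0) M.f _) (dd v M.f _), mink_comm (dd (w 1) M.f _) (dd v M.f _)]

lemma sff_footAccel (X : Minkowski) (v : Plane) :
    sff M.f M.n (M.foot P) (footAccel M w P X) v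
      = sff M.f M.n (M.foot P) (dd X (dd X M.foot) P) v
        + ∑ q, mink (dd (dd X M.foot P) (dd (dd X M.foot P) M.f) (M.foot P))
          (dd (w q) M.f (M.foot P)) * sff M.f M.n (M.foot P) (w q) v := by
  simp only [footAccel, sff_expand M.f_smooth, Fin.sum_univ_two, Pi.add_apply, Pi.smul_apply,
    smul_eq_mul]
  ring

include hP hw in
/-- The equation for the acceleration of the foot point. -/
lemma foot_acceleration (X : Minkowski) (v : Plane) :
    -mink P (M.f (M.foot P)) * mink (dd (footAccel M w P X) M.f (M.foot P)) (dd v M.f (M.foot P))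
      + mink P (M.footNormal P) * sff M.f M.n (M.foot P) (footAccel M w P X) v
      = 2 * mink (dd (dd X M.foot P) M.f (M.foot P)) (dd v M.f (M.foot P)) * mink X (M.f (M.foot P))
        - 2 * sff M.f M.n (M.foot P) (dd X M.foot P) v * mink X (M.n (M.foot P))
        - mink P (M.footNormal P)
          * covSff M.f M.n w (M.foot P) (dd X M.foot P) (dd X M.foot P) v := by
  have h := dd_dd_foot_eq (M := M) (Hyp3_subset_futureCone hP) X v
  have hv0 := foot_velocity (M := M) hP X (w 0)
  have hv1 := foot_velocity (M := M) hP X (w 1)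
  have hX := (M.isSurface.lorentzFrame hw).parseval
    (dd (dd X M.foot P) (dd v M.f) (M.foot P)) X
  rw [mink_dd_dd_foot hP] at h
  have h3 : mink (dd (dd X M.foot P) (dd (dd X M.foot P) (dd v M.f)) (M.foot P)) P
      = -mink P (M.f (M.foot P)) * mink (dd (dd X M.foot P) (dd (dd X M.foot P) (dd v M.f))
        (M.foot P)) (M.f (M.foot P)) + mink P (M.footNormal P) * mink (M.n (M.foot P))
        (dd (dd X M.foot P) (dd (dd X M.foot P) (dd v M.f)) (M.foot P)) := by
    rw [mink_right_eq hP, mink_comm _ (M.n _)]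
  rw [h3, M.isSurface.mink_dd_dd_dd_self] at h
  have ht := mink_tangent_expand hw (dd (dd X M.foot P) (dd v M.f) (M.foot P)) (dd X M.foot P)
  rw [mink_footAccel hw, sff_footAccel, covSff]
  rw [hX, M.isSurface.mink_dd_dd_self] at h
  simp only [Fin.sum_univ_two] at *
  have hn : mink (dd (dd X M.foot P) (dd v M.f) (M.foot P)) (M.n (M.foot P))
      = -sff M.f M.n (M.foot P) (dd X M.foot P) v := by rw [sff, mink_comm, neg_neg]
  rw [hn, mink_comm X (dd (w 0) M.f (M.foot P)), mink_comm X (dd (w 1) M.f (M.foot P))] at h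
  rw [ht] at h
  linear_combination (-1 : ℝ) * h
    - 2 * mink (dd (dd X M.foot P) (dd v M.f) (M.foot P)) (dd (w 0) M.f (M.foot P)) * hv0
    - 2 * mink (dd (dd X M.foot P) (dd v M.f) (M.foot P)) (dd (w 1) M.f (M.foot P)) * hv1

include hP hw in
/-- The second derivative of the normal at the foot point. -/
lemma mink_dd_dd_footNormal (X V : Minkowski) :
    mink (dd X (dd X M.footNormal) P) V
      = sff M.f M.n (M.foot P) (dd X M.foot P) (dd X M.foot P) * mink V (M.f (M.foot P))
        + ∑ q, (covSff M.f M.n w (M.foot P) (dd X M.foot P) (dd X M.foot P) (w q)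
          + sff M.f M.n (M.foot P) (footAccel M w P X) (w q)) * mink V (dd (w q) M.f (M.foot P))
        - (∑ q, sff M.f M.n (M.foot P) (dd X M.foot P) (w q) ^ 2) * mink V (M.n (M.foot P)) := by
  set x := M.foot P
  set u := dd X M.foot P
  have hS := M.isSurface
  have hN := M.n_smooth
  -- components of `D²n(u, u)`
  have c1 : ∀ v, mink (dd u (dd u M.n) x) (dd v M.f x) = covSff M.f M.n w x u u v
      + ∑ q, mink (dd u (dd u M.f) x) (dd (w q) M.f x) * sff M.f M.n x (w q) v := by
    intro v
    have h1 := dd_mink ((hN.dd u).diffAt x) ((M.f_smooth.dd v).diffAt x) u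
    have h2 : (fun y => mink (dd u M.n y) (dd v M.f y)) = fun y => sff M.f M.n y u v := by
      funext y; exact hS.mink_dd_normal_dd hN y u v
    rw [h2, hS.dd_sff hN hw, hS.mink_dd_normal_eq hN hw] at h1
    rw [covSff]
    simp only [Fin.sum_univ_two] at h1 ⊢
    linear_combination (-1 : ℝ) * h1
  have c2 : mink (dd u (dd u M.n) x) (M.f x) = -sff M.f M.n x u u := by
    have h1 := dd_mink ((hN.dd u).diffAt x) (M.f_smooth.diffAt x) u
    rw [dd_eq_zero_of_eventually_const (c := 0)
      (Eventually.of_forall fun y => hS.mink_dd_normal_pos hN y u), hS.mink_dd_normal_dd hN] at h1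
    linarith
  have c3 : mink (dd u (dd u M.n) x) (M.n x) = -∑ q, sff M.f M.n x u (w q) ^ 2 := by
    have h1 := dd_mink ((hN.dd u).diffAt x) (hN.diffAt x) u
    rw [dd_eq_zero_of_eventually_const (c := 0)
      (Eventually.of_forall fun y => hS.mink_dd_normal_self hN y u),
      hS.mink_dd_normal_eq hN hw] at h1
    simp only [hS.mink_dd_normal_dd hN, Fin.sum_univ_two] at h1 ⊢
    linarith
  rw [dd_dd_footNormal (Hyp3_subset_futureCone hP),
    (hS.lorentzFrame hw).parseval _ V]
  have hs : ∀ q, sff M.f M.n x (footAccel M w P X) (w q) = _ := fun q => sff_footAccel X (w q)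
  simp only [mink_add_left]
  rw [hS.mink_dd_normal_pos hN, hS.mink_dd_normal_self hN, hS.mink_dd_normal_dd hN,
    hS.mink_dd_normal_dd hN, c1, c1, c2, c3]
  simp only [Fin.sum_univ_two, hs]
  ring

include hP hw in
lemma mink_dd_footNormal (X V : Minkowski) : mink (dd X M.footNormal P) V
    = ∑ q, mink V (dd (w q) M.f (M.foot P)) * sff M.f M.n (M.foot P) (dd X M.foot P) (w q) := by
  rw [dd_footNormal (Hyp3_subset_futureCone hP), M.isSurface.mink_dd_normal_eq M.n_smooth hw]

include hP in
/-- The foot point is constant along rays of the future cone. -/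
lemma dd_foot_self : dd P M.foot P = 0 := by
  by_contra hne
  have h := foot_velocity (M := M) hP P (dd P M.foot P)
  rw [foot_spec (Hyp3_subset_futureCone hP)] at h
  have := comb_pos (M := M) (cosh_pos (M := M) hP) (sq_lt_sq_of_isFoot (Hyp3_subset_futureCone hP)
    (foot_spec (M := M) (Hyp3_subset_futureCone hP)))
    (M.foot P) hne
  rw [footNormal] at h
  linarith

include hP in
lemma dd_footNormal_self : dd P M.footNormal P = 0 := by
  rw [dd_footNormal (Hyp3_subset_futureCone hP), dd_foot_self hP]
  simp [dd]

include hP in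
/-- The derivative of the normal at the foot point is tangential to the minimal surface. -/
lemma mink_dd_footNormal_left (X : Minkowski) : mink (dd X M.footNormal P) P = 0 := by
  obtain ⟨w, hw⟩ := M.isSurface.exists_frame (M.foot P)
  rw [mink_dd_footNormal hP hw]
  refine Finset.sum_eq_zero fun q _ => ?_
  rw [mink_comm, foot_spec (Hyp3_subset_futureCone hP), zero_mul]

end FootNormal

end AlmostFuchsian

namespace AlmostFuchsian

variable {M : AlmostFuchsian}

/-! ### Estimates for the normal at the foot point -/

section Estimates

variable {P : Minkowski} (hP : P ∈ Hyp3) {w : Fin 2 → Plane}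
  (hw : IsTangentFrame M.f (M.foot P) w)

include hP hw in
/-- The components of a unit tangent vector of `ℍ³` with respect to the Lorentz frame at the
foot point. -/
lemma tangent_components {X : Minkowski} (hXP : mink X P = 0) (hX : mink X X = 1) :
    |mink X (dd (w 0) M.f (M.foot P))| ≤ 1 ∧ |mink X (dd (w 1) M.f (M.foot P))| ≤ 1
      ∧ |mink X (M.f (M.foot P))| ≤ -mink P (M.f (M.foot P))
      ∧ |mink X (M.n (M.foot P))| ≤ -mink P (M.f (M.foot P)) := by
  have h1 := (M.isSurface.lorentzFrame hw).parseval X X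
  have h2 := mink_right_eq (M := M) hP X
  have hC := cosh_sq_eq (M := M) hP
  have hC0 := cosh_pos (M := M) hP
  rw [hX] at h1
  rw [hXP] at h2
  set C := -mink P (M.f (M.foot P))
  set S := mink P (M.footNormal P)
  set a := mink X (M.f (M.foot P))
  set b := mink X (M.n (M.foot P))
  set p := mink X (dd (w 0) M.f (M.foot P))
  set q := mink X (dd (w 1) M.f (M.foot P))
  have h3 : (C * a) ^ 2 = (S * b) ^ 2 := by
    have : C * a = -(S * b) := by linarith
    rw [this, neg_sq]
  -- `b² - a² = b² / C²`
  have h4 : C ^ 2 * (b ^ 2 - a ^ 2) = b ^ 2 := by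
    rw [mul_pow, mul_pow] at h3
    linear_combination (-1 : ℝ) * h3 + b ^ 2 * hC
  have h5 : b ^ 2 = C ^ 2 * (1 - p ^ 2 - q ^ 2) := by rw [← h4]; linear_combination C ^ 2 * (-1 * h1)
  have hC2 : 0 < C ^ 2 := by positivity
  have h6 : 0 ≤ 1 - p ^ 2 - q ^ 2 := by
    by_contra! h
    nlinarith [sq_nonneg b]
  have hb : b ^ 2 ≤ C ^ 2 := by rw [h5]; nlinarith [sq_nonneg p, sq_nonneg q]
  have ha : a ^ 2 ≤ C ^ 2 := by nlinarith [sq_nonneg p, sq_nonneg q]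
  exact ⟨abs_le_of_sq_le_sq (by nlinarith [sq_nonneg q]) one_pos.le,
    abs_le_of_sq_le_sq (by nlinarith [sq_nonneg p]) one_pos.le, abs_le_of_sq_le_sq ha hC0.le,
    abs_le_of_sq_le_sq hb hC0.le⟩

include hw in
lemma sff_foot_comb (u v : Plane) : sff M.f M.n (M.foot P) u v
    = mink (dd u M.f (M.foot P)) (dd (w 0) M.f (M.foot P)) * sff M.f M.n (M.foot P) (w 0) v
      + mink (dd u M.f (M.foot P)) (dd (w 1) M.f (M.foot P)) * sff M.f M.n (M.foot P) (w 1) v := by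
  conv_lhs => rw [hw.expand u]
  rw [sff_comm M.f_smooth, Fin.sum_univ_two, sff_frame_comb hw, sff_comm M.f_smooth _ v,
    sff_comm M.f_smooth _ v]

include hw in
lemma covSff_foot_comb (u z : Plane) : covSff M.f M.n w (M.foot P) u u z
    = ∑ p, ∑ q, mink (dd u M.f (M.foot P)) (dd (w p) M.f (M.foot P))
      * mink (dd u M.f (M.foot P)) (dd (w q) M.f (M.foot P))
      * covSff M.f M.n w (M.foot P) (w p) (w q) z := by
  have hu := hw.expand u
  rw [Fin.sum_univ_two] at hu
  set s := mink (dd u M.f (M.foot P)) (dd (w 0) M.f (M.foot P))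
  set t := mink (dd u M.f (M.foot P)) (dd (w 1) M.f (M.foot P))
  have h0 := congrFun hu 0
  have h1 := congrFun hu 1
  simp only [Pi.add_apply, Pi.smul_apply, smul_eq_mul] at h0 h1
  have e := M.isSurface.covSff_expand (N := M.n) w (M.foot P)
  rw [e u u z]
  simp only [Fin.sum_univ_two]
  rw [e (w 0) (w 0) z, e (w 0) (w 1) z, e (w 1) (w 0) z, e (w 1) (w 1) z]
  simp only [Fin.sum_univ_two]
  rw [h0, h1]
  ring

/-- A linear system `(C + S h) u = r` with `|S| ≤ C` and small `h` gives a bound for `u`. -/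
lemma system_bound {C S ε u₀ u₁ h₀₀ h₀₁ h₁₀ h₁₁ r₀ r₁ R : ℝ} (hC : 0 < C) (hS : |S| ≤ C)
    (hε : ε ≤ 1 / 1000) (h00 : |h₀₀| ≤ ε) (h01 : |h₀₁| ≤ ε)
    (h10 : |h₁₀| ≤ ε) (h11 : |h₁₁| ≤ ε) (e₀ : C * u₀ + S * (u₀ * h₀₀ + u₁ * h₁₀) = r₀)
    (e₁ : C * u₁ + S * (u₀ * h₀₁ + u₁ * h₁₁) = r₁) (hr : |r₀| + |r₁| ≤ R) :
    C * (|u₀| + |u₁|) * (1 - 2 / 1000) ≤ R := by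
  have key : ∀ a b : ℝ, |a| ≤ ε → |b| ≤ ε → |S * (u₀ * a + u₁ * b)| ≤ C * (ε * (|u₀| + |u₁|)) := by
    intro a b ha hb
    rw [abs_mul]
    refine mul_le_mul hS ?_ (abs_nonneg _) hC.le
    calc _ ≤ |u₀ * a| + |u₁ * b| := abs_add_le _ _
      _ = |u₀| * |a| + |u₁| * |b| := by rw [abs_mul, abs_mul]
      _ ≤ |u₀| * ε + |u₁| * ε := by gcongr
      _ = _ := by ring
  have k0 := key _ _ h00 h10
  have k1 := key _ _ h01 h11
  have a0 : C * |u₀| ≤ |r₀| + C * (ε * (|u₀| + |u₁|)) := by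
    rw [← abs_of_pos hC, ← abs_mul, abs_of_pos hC]
    calc |C * u₀| = |r₀ - S * (u₀ * h₀₀ + u₁ * h₁₀)| := by rw [← e₀]; ring_nf
      _ ≤ |r₀| + |S * (u₀ * h₀₀ + u₁ * h₁₀)| := abs_sub _ _
      _ ≤ _ := by linarith
  have a1 : C * |u₁| ≤ |r₁| + C * (ε * (|u₀| + |u₁|)) := by
    rw [← abs_of_pos hC, ← abs_mul, abs_of_pos hC]
    calc |C * u₁| = |r₁ - S * (u₀ * h₀₁ + u₁ * h₁₁)| := by rw [← e₁]; ring_nf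
      _ ≤ |r₁| + |S * (u₀ * h₀₁ + u₁ * h₁₁)| := abs_sub _ _
      _ ≤ _ := by linarith
  have hU : 0 ≤ C * (|u₀| + |u₁|) := by positivity
  have : ε * (C * (|u₀| + |u₁|)) ≤ 1 / 1000 * (C * (|u₀| + |u₁|)) := by gcongr
  nlinarith

variable {ε : ℝ} (hA : M.c1NormA ≤ ε) (hε : ε ≤ 1 / 1000)

include hP in
lemma abs_sinh_le : |mink P (M.footNormal P)| ≤ -mink P (M.f (M.foot P)) :=
  abs_le_of_sq_le_sq (by linarith [cosh_sq_eq (M := M) hP]) (cosh_pos hP).le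

include hP in
lemma one_le_cosh : 1 ≤ -mink P (M.f (M.foot P)) := by
  have h := cosh_sq_eq (M := M) hP
  have := cosh_pos (M := M) hP
  nlinarith [sq_nonneg (mink P (M.footNormal P))]

include hP hw hA hε in
lemma foot_velocity_bound {X : Minkowski} (hXP : mink X P = 0) (hX : mink X X = 1) :
    -mink P (M.f (M.foot P)) *
      (|mink (dd (dd X M.foot P) M.f (M.foot P)) (dd (w 0) M.f (M.foot P))|
        + |mink (dd (dd X M.foot P) M.f (M.foot P)) (dd (w 1) M.f (M.foot P))|) ≤ 2.01 := by
  obtain ⟨h0, h1, -, -⟩ := tangent_components hP hw hXP hX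
  have e0 := foot_velocity (M := M) hP X (w 0)
  have e1 := foot_velocity (M := M) hP X (w 1)
  rw [sff_foot_comb hw] at e0 e1
  have := system_bound (cosh_pos hP) (abs_sinh_le hP) hε (abs_sff_le hA hw 0 0)
    (abs_sff_le hA hw 0 1) (abs_sff_le hA hw 1 0) (abs_sff_le hA hw 1 1) e0 e1 (R := 2) (by
      rw [mink_comm _ X, mink_comm _ X]; linarith)
  linarith

include hw hA in
lemma abs_sff_foot_le (u : Plane) (q : Fin 2) : |sff M.f M.n (M.foot P) u (w q)| ≤
    ε * (|mink (dd u M.f (M.foot P)) (dd (w 0) M.f (M.foot P))|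
      + |mink (dd u M.f (M.foot P)) (dd (w 1) M.f (M.foot P))|) := by
  rw [sff_foot_comb hw]
  refine (abs_add_le _ _).trans ?_
  rw [abs_mul, abs_mul]
  have h0 := abs_sff_le hA hw 0 q
  have h1 := abs_sff_le hA hw 1 q
  nlinarith [abs_nonneg (mink (dd u M.f (M.foot P)) (dd (w 0) M.f (M.foot P))),
    abs_nonneg (mink (dd u M.f (M.foot P)) (dd (w 1) M.f (M.foot P)))]

include hw hA in
lemma abs_covSff_foot_le (u : Plane) (q : Fin 2) : |covSff M.f M.n w (M.foot P) u u (w q)| ≤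
    ε * (|mink (dd u M.f (M.foot P)) (dd (w 0) M.f (M.foot P))|
      + |mink (dd u M.f (M.foot P)) (dd (w 1) M.f (M.foot P))|) ^ 2 := by
  rw [covSff_foot_comb hw]
  set s := mink (dd u M.f (M.foot P)) (dd (w 0) M.f (M.foot P))
  set t := mink (dd u M.f (M.foot P)) (dd (w 1) M.f (M.foot P))
  have h := fun p r => abs_covSff_le hA hw p r q
  simp only [Fin.sum_univ_two]
  calc _ ≤ |s * s * covSff M.f M.n w (M.foot P) (w 0) (w 0) (w q)|
        + |s * t * covSff M.f M.n w (M.foot P) (w 0) (w 1) (w q)|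
        + (|t * s * covSff M.f M.n w (M.foot P) (w 1) (w 0) (w q)|
        + |t * t * covSff M.f M.n w (M.foot P) (w 1) (w 1) (w q)|) :=
        (abs_add_le _ _).trans (add_le_add (abs_add_le _ _) (abs_add_le _ _))
    _ = |s| * |s| * |covSff M.f M.n w (M.foot P) (w 0) (w 0) (w q)|
        + |s| * |t| * |covSff M.f M.n w (M.foot P) (w 0) (w 1) (w q)|
        + (|t| * |s| * |covSff M.f M.n w (M.foot P) (w 1) (w 0) (w q)|
        + |t| * |t| * |covSff M.f M.n w (M.foot P) (w 1) (w 1) (w q)|) := by simp only [abs_mul]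
    _ ≤ |s| * |s| * ε + |s| * |t| * ε + (|t| * |s| * ε + |t| * |t| * ε) := by
        gcongr <;> apply h
    _ = _ := by ring

include hP hA hε in
/-- The first derivative of the normal at the foot point is of order `ε / cosh r`. -/
lemma abs_dd_footNormal_le {X V : Minkowski} (hXP : mink X P = 0) (hX : mink X X = 1)
    (hVP : mink V P = 0) (hV : mink V V = 1) :
    -mink P (M.f (M.foot P)) * |mink (dd X M.footNormal P) V| ≤ 4.02 * ε := by
  obtain ⟨w, hw⟩ := M.isSurface.exists_frame (M.foot P)
  obtain ⟨h0, h1, -, -⟩ := tangent_components hP hw hVP hV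
  have hu := foot_velocity_bound hP hw hA hε hXP hX
  have hC := cosh_pos (M := M) hP
  have s0 := abs_sff_foot_le hw hA (dd X M.foot P) 0
  have s1 := abs_sff_foot_le hw hA (dd X M.foot P) 1
  have hε0 := eps_nonneg_of_c1NormA_le hA
  rw [mink_dd_footNormal hP hw, Fin.sum_univ_two]
  set C := -mink P (M.f (M.foot P))
  set U := |mink (dd (dd X M.foot P) M.f (M.foot P)) (dd (w 0) M.f (M.foot P))|
        + |mink (dd (dd X M.foot P) M.f (M.foot P)) (dd (w 1) M.f (M.foot P))|
  have : |mink V (dd (w 0) M.f (M.foot P)) * sff M.f M.n (M.foot P) (dd X M.foot P) (w 0)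
      + mink V (dd (w 1) M.f (M.foot P)) * sff M.f M.n (M.foot P) (dd X M.foot P) (w 1)|
      ≤ 1 * (ε * U) + 1 * (ε * U) := by
    refine (abs_add_le _ _).trans ?_
    rw [abs_mul, abs_mul]
    gcongr
  calc _ ≤ C * (1 * (ε * U) + 1 * (ε * U)) := by gcongr
    _ = 2 * ε * (C * U) := by ring
    _ ≤ 2 * ε * 2.01 := by gcongr
    _ = _ := by ring

include hP hw hA hε in
lemma foot_acceleration_bound {X : Minkowski} (hXP : mink X P = 0) (hX : mink X X = 1) :
    -mink P (M.f (M.foot P)) *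
      (|mink (dd (footAccel M w P X) M.f (M.foot P)) (dd (w 0) M.f (M.foot P))|
        + |mink (dd (footAccel M w P X) M.f (M.foot P)) (dd (w 1) M.f (M.foot P))|) ≤ 4.06 := by
  obtain ⟨-, -, hXf, hXn⟩ := tangent_components hP hw hXP hX
  have hu := foot_velocity_bound hP hw hA hε hXP hX
  have hC := cosh_pos (M := M) hP
  have hC1 := one_le_cosh (M := M) hP
  have hS := abs_sinh_le (M := M) hP
  have hε0 := eps_nonneg_of_c1NormA_le hA
  have e0 := foot_acceleration hP hw X (w 0)
  have e1 := foot_acceleration hP hw X (w 1)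
  rw [sff_foot_comb hw (footAccel M w P X)] at e0 e1
  have s := abs_sff_foot_le hw hA (dd X M.foot P)
  have k := abs_covSff_foot_le hw hA (dd X M.foot P)
  set C := -mink P (M.f (M.foot P))
  set S := mink P (M.footNormal P)
  set u₀ := mink (dd (dd X M.foot P) M.f (M.foot P)) (dd (w 0) M.f (M.foot P))
  set u₁ := mink (dd (dd X M.foot P) M.f (M.foot P)) (dd (w 1) M.f (M.foot P))
  set U := |u₀| + |u₁| with hU
  have hU0 : 0 ≤ U := by positivity
  have bound : ∀ u h T : ℝ, |h| ≤ ε * U → |T| ≤ ε * U ^ 2 →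
      |2 * u * mink X (M.f (M.foot P)) - 2 * h * mink X (M.n (M.foot P)) - S * T|
        ≤ 2 * |u| * C + 2 * (ε * U) * C + C * (ε * U ^ 2) := by
    intro u h T hh hT
    refine (abs_sub _ _).trans (add_le_add ((abs_sub _ _).trans (add_le_add ?_ ?_)) ?_)
    · rw [abs_mul, abs_mul, abs_two]; gcongr
    · rw [abs_mul, abs_mul, abs_two]; gcongr
    · rw [abs_mul]; gcongr
  have b0 := bound u₀ _ _ (s 0) (k 0)
  have b1 := bound u₁ _ _ (s 1) (k 1)
  have hUC : U ≤ C * U := by nlinarith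
  have hεU : ε * (C * U) ≤ 1 / 1000 * 2.01 := by gcongr
  have hεU2 : C * (ε * U ^ 2) ≤ 1 / 1000 * 2.01 * 2.01 := by
    calc C * (ε * U ^ 2) = ε * (C * U) * U := by ring
      _ ≤ 1 / 1000 * 2.01 * 2.01 := by gcongr; linarith
  have := system_bound hC hS hε (abs_sff_le hA hw 0 0)
    (abs_sff_le hA hw 0 1) (abs_sff_le hA hw 1 0) (abs_sff_le hA hw 1 1) e0 e1 (R := 4.04)
    (by nlinarith)
  linarith

include hP hA hε in
/-- The second derivative of the normal at the foot point is of order `ε / cosh r`. -/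
lemma abs_dd_dd_footNormal_le {X V : Minkowski} (hXP : mink X P = 0) (hX : mink X X = 1)
    (hVP : mink V P = 0) (hV : mink V V = 1) :
    -mink P (M.f (M.foot P)) * |mink (dd X (dd X M.footNormal) P) V| ≤ 21 * ε := by
  obtain ⟨w, hw⟩ := M.isSurface.exists_frame (M.foot P)
  obtain ⟨hV0, hV1, hVf, hVn⟩ := tangent_components hP hw hVP hV
  have hu := foot_velocity_bound hP hw hA hε hXP hX
  have hW := foot_acceleration_bound hP hw hA hε hXP hX
  have hC := cosh_pos (M := M) hP
  have hC1 := one_le_cosh (M := M) hP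
  have hε0 := eps_nonneg_of_c1NormA_le hA
  have s := abs_sff_foot_le hw hA (dd X M.foot P)
  have sW := abs_sff_foot_le hw hA (footAccel M w P X)
  have k := abs_covSff_foot_le hw hA (dd X M.foot P)
  have hss : |sff M.f M.n (M.foot P) (dd X M.foot P) (dd X M.foot P)|
      ≤ ε * (|mink (dd (dd X M.foot P) M.f (M.foot P)) (dd (w 0) M.f (M.foot P))|
        + |mink (dd (dd X M.foot P) M.f (M.foot P)) (dd (w 1) M.f (M.foot P))|) ^ 2 := by
    rw [sff_foot_comb hw, sff_comm M.f_smooth _ (w 0), sff_comm M.f_smooth _ (w 1)]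
    refine (abs_add_le _ _).trans ?_
    rw [abs_mul, abs_mul]
    have s0 := s 0
    have s1 := s 1
    nlinarith [abs_nonneg (mink (dd (dd X M.foot P) M.f (M.foot P)) (dd (w 0) M.f (M.foot P))),
      abs_nonneg (mink (dd (dd X M.foot P) M.f (M.foot P)) (dd (w 1) M.f (M.foot P)))]
  rw [mink_dd_dd_footNormal hP hw, Fin.sum_univ_two, Fin.sum_univ_two]
  set C := -mink P (M.f (M.foot P))
  set U := |mink (dd (dd X M.foot P) M.f (M.foot P)) (dd (w 0) M.f (M.foot P))|
        + |mink (dd (dd X M.foot P) M.f (M.foot P)) (dd (w 1) M.f (M.foot P))|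
  set W := |mink (dd (footAccel M w P X) M.f (M.foot P)) (dd (w 0) M.f (M.foot P))|
        + |mink (dd (footAccel M w P X) M.f (M.foot P)) (dd (w 1) M.f (M.foot P))|
  have hU0 : 0 ≤ U := by positivity
  have hW0 : 0 ≤ W := by positivity
  have hmid : ∀ T h v : ℝ, |T| ≤ ε * U ^ 2 → |h| ≤ ε * W → |v| ≤ 1 →
      |(T + h) * v| ≤ ε * U ^ 2 + ε * W := by
    intro T h v hT hh hv
    rw [abs_mul]
    calc |T + h| * |v| ≤ (ε * U ^ 2 + ε * W) * 1 := by
          gcongr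
          exact (abs_add_le _ _).trans (add_le_add hT hh)
      _ = _ := mul_one _
  have hsq : ∀ q, sff M.f M.n (M.foot P) (dd X M.foot P) (w q) ^ 2 ≤ (ε * U) ^ 2 := fun q =>
    sq_le_sq' (abs_le.1 (s q)).1 (abs_le.1 (s q)).2
  have hfin : |(sff M.f M.n (M.foot P) (dd X M.foot P) (w 0) ^ 2
      + sff M.f M.n (M.foot P) (dd X M.foot P) (w 1) ^ 2) * mink V (M.n (M.foot P))|
      ≤ ((ε * U) ^ 2 + (ε * U) ^ 2) * C := by
    rw [abs_mul, abs_of_nonneg (by positivity)]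
    exact mul_le_mul (add_le_add (hsq 0) (hsq 1)) hVn (abs_nonneg _) (by positivity)
  have hfst : |sff M.f M.n (M.foot P) (dd X M.foot P) (dd X M.foot P) * mink V (M.f (M.foot P))|
      ≤ ε * U ^ 2 * C := by
    rw [abs_mul]; gcongr
  have htot := (abs_sub (sff M.f M.n (M.foot P) (dd X M.foot P) (dd X M.foot P)
      * mink V (M.f (M.foot P))
      + ((covSff M.f M.n w (M.foot P) (dd X M.foot P) (dd X M.foot P) (w 0)
          + sff M.f M.n (M.foot P) (footAccel M w P X) (w 0)) * mink V (dd (w 0) M.f (M.foot P))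
        + (covSff M.f M.n w (M.foot P) (dd X M.foot P) (dd X M.foot P) (w 1)
          + sff M.f M.n (M.foot P) (footAccel M w P X) (w 1)) * mink V (dd (w 1) M.f (M.foot P))))
    ((sff M.f M.n (M.foot P) (dd X M.foot P) (w 0) ^ 2
      + sff M.f M.n (M.foot P) (dd X M.foot P) (w 1) ^ 2) * mink V (M.n (M.foot P)))).trans
    (add_le_add ((abs_add_le _ _).trans (add_le_add hfst ((abs_add_le _ _).trans
      (add_le_add (hmid _ _ _ (k 0) (sW 0) hV0) (hmid _ _ _ (k 1) (sW 1) hV1))))) hfin)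
  have hUC : U ≤ 2.01 := by nlinarith
  have hCU2 : (C * U) ^ 2 ≤ 2.01 ^ 2 := pow_le_pow_left₀ (by positivity) hu 2
  have hCU : C * U * U ≤ 2.01 * 2.01 := by gcongr
  calc _ ≤ C * (ε * U ^ 2 * C + (ε * U ^ 2 + ε * W + (ε * U ^ 2 + ε * W))
        + ((ε * U) ^ 2 + (ε * U) ^ 2) * C) := by gcongr
    _ = ε * ((C * U) ^ 2 + 2 * (C * U * U) + 2 * (C * W) + 2 * ε * (C * U) ^ 2) := by ring
    _ ≤ ε * (2.01 ^ 2 + 2 * (2.01 * 2.01) + 2 * 4.06 + 2 * (1 / 1000) * 2.01 ^ 2) := by gcongr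
    _ ≤ 21 * ε := by norm_num; linarith

include hP hw in
/-- The quadratic form `X ↦ ⟨X, D_X n⟩` explicitly. -/
lemma mink_dd_footNormal_quadratic (X : Minkowski) :
    ((-mink P (M.f (M.foot P))) ^ 2 - (sff M.f M.n (M.foot P) (w 0) (w 0) ^ 2
        + sff M.f M.n (M.foot P) (w 0) (w 1) ^ 2) * mink P (M.footNormal P) ^ 2)
      * mink (dd X M.footNormal P) X
      = -mink P (M.f (M.foot P)) * (sff M.f M.n (M.foot P) (w 0) (w 0)
          * (mink X (dd (w 0) M.f (M.foot P)) ^ 2 - mink X (dd (w 1) M.f (M.foot P)) ^ 2)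
          + 2 * sff M.f M.n (M.foot P) (w 0) (w 1) * (mink X (dd (w 0) M.f (M.foot P))
            * mink X (dd (w 1) M.f (M.foot P))))
        - mink P (M.footNormal P) * (sff M.f M.n (M.foot P) (w 0) (w 0) ^ 2
          + sff M.f M.n (M.foot P) (w 0) (w 1) ^ 2)
          * (mink X (dd (w 0) M.f (M.foot P)) ^ 2 + mink X (dd (w 1) M.f (M.foot P)) ^ 2) := by
  have e0 := foot_velocity (M := M) hP X (w 0)
  have e1 := foot_velocity (M := M) hP X (w 1)
  rw [mink_dd_footNormal hP hw, Fin.sum_univ_two]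
  rw [mink_comm _ X] at e0 e1
  have c0 := sff_foot_comb hw (dd X M.foot P) (w 0)
  have c1 := sff_foot_comb hw (dd X M.foot P) (w 1)
  rw [sff_comm M.f_smooth _ (w 1) (w 0)] at c0
  rw [sff_trace hw] at c1
  rw [c0] at e0 ⊢
  rw [c1] at e1 ⊢
  set C := -mink P (M.f (M.foot P))
  set S := mink P (M.footNormal P)
  set a := sff M.f M.n (M.foot P) (w 0) (w 0)
  set b := sff M.f M.n (M.foot P) (w 0) (w 1)
  set u := mink (dd (dd X M.foot P) M.f (M.foot P)) (dd (w 0) M.f (M.foot P))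
  set v := mink (dd (dd X M.foot P) M.f (M.foot P)) (dd (w 1) M.f (M.foot P))
  set p := mink X (dd (w 0) M.f (M.foot P))
  set q := mink X (dd (w 1) M.f (M.foot P))
  -- Cramer's rule
  have hu : (C ^ 2 - (a ^ 2 + b ^ 2) * S ^ 2) * u = (C - S * a) * p - S * b * q := by
    linear_combination (C - S * a) * e0 - S * b * e1
  have hv : (C ^ 2 - (a ^ 2 + b ^ 2) * S ^ 2) * v = (C + S * a) * q - S * b * p := by
    linear_combination (C + S * a) * e1 - S * b * e0
  linear_combination (p * a + q * b) * hu + (p * b - q * a) * hv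

include hP hw in
/-- At a point where a surface is tangent to the equidistant foliation, the trace of `D n` is that
over the whole tangent space of the leaf. -/
lemma trace_dd_footNormal {e₁ e₂ ν : Minkowski} (he : IsLorentzFrame P e₁ e₂ ν)
    (h1 : mink e₁ (M.footNormal P) = 0) (h2 : mink e₂ (M.footNormal P) = 0) :
    ((-mink P (M.f (M.foot P))) ^ 2 - (sff M.f M.n (M.foot P) (w 0) (w 0) ^ 2
        + sff M.f M.n (M.foot P) (w 0) (w 1) ^ 2) * mink P (M.footNormal P) ^ 2)
      * (mink (dd e₁ M.footNormal P) e₁ + mink (dd e₂ M.footNormal P) e₂)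
      = -2 * mink P (M.footNormal P) * (sff M.f M.n (M.foot P) (w 0) (w 0) ^ 2
          + sff M.f M.n (M.foot P) (w 0) (w 1) ^ 2) := by
  have q1 := mink_dd_footNormal_quadratic hP hw e₁
  have q2 := mink_dd_footNormal_quadratic hP hw e₂
  have hfoot := foot_spec (M := M) (Hyp3_subset_futureCone hP)
  have hL := M.isSurface.lorentzFrame hw
  have hnn := he.parseval (M.footNormal P) (M.footNormal P)
  have hn1 : mink (M.footNormal P) (M.footNormal P) = 1 := (M.surface (M.foot P)).normal_unit
  have hνn : mink (M.footNormal P) ν ≠ 0 := by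
    intro h0
    rw [hn1, mink_comm _ e₁, mink_comm _ e₂, h1, h2, h0] at hnn
    nlinarith [sq_nonneg (mink (M.footNormal P) P)]
  have hν : ∀ q, mink (dd (w q) M.f (M.foot P)) ν = 0 := by
    intro q
    have h := he.parseval (M.footNormal P) (dd (w q) M.f (M.foot P))
    have h0 : mink (M.footNormal P) (dd (w q) M.f (M.foot P)) = 0 := M.isSurface.mink_normal_dd _ _
    rw [h0, mink_comm _ e₁, mink_comm _ e₂, h1, h2, hfoot] at h
    have : mink (M.footNormal P) ν * mink (dd (w q) M.f (M.foot P)) ν = 0 := by linarith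
    exact (mul_eq_zero.1 this).resolve_left hνn
  have g : ∀ p q, mink (dd (w p) M.f (M.foot P)) e₁ * mink (dd (w q) M.f (M.foot P)) e₁
      + mink (dd (w p) M.f (M.foot P)) e₂ * mink (dd (w q) M.f (M.foot P)) e₂
      = if p = q then 1 else 0 := by
    intro p q
    have h := he.parseval (dd (w p) M.f (M.foot P)) (dd (w q) M.f (M.foot P))
    rw [hw p q, hfoot, hν] at h
    linarith
  have g00 := g 0 0
  have g01 := g 0 1
  have g11 := g 1 1
  simp only [if_true, zero_ne_one, if_false] at g00 g01 g11
  rw [mink_comm _ e₁, mink_comm _ e₂] at g00 g01 g11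
  rw [mink_comm (dd (w 1) M.f (M.foot P)) e₁, mink_comm (dd (w 1) M.f (M.foot P)) e₂] at g01
  set C := -mink P (M.f (M.foot P))
  set S := mink P (M.footNormal P)
  set a := sff M.f M.n (M.foot P) (w 0) (w 0)
  set b := sff M.f M.n (M.foot P) (w 0) (w 1)
  linear_combination q1 + q2 + (C * a - S * (a ^ 2 + b ^ 2)) * g00
    - (C * a + S * (a ^ 2 + b ^ 2)) * g11 + 2 * C * b * g01

end Estimates

end AlmostFuchsian

/-! ### The evolution of position and normal under the flow -/

section DirectionalChainRule

variable {E F G' : Type*} [NormedAddCommGroup E] [NormedSpace ℝ E] [NormedAddCommGroup F]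
  [NormedSpace ℝ F] [NormedAddCommGroup G'] [NormedSpace ℝ G']

lemma dd_dd_comp {A : F → G'} {u : E → F} {x : E} (hA : ∀ᶠ y in 𝓝 x, ContDiffAt ℝ ∞ A (u y))
    (hu : ∀ᶠ y in 𝓝 x, ContDiffAt ℝ ∞ u y) (v : E) :
    dd v (dd v (fun y => A (u y))) x
      = dd (dd v u x) (dd (dd v u x) A) (u x) + dd (dd v (dd v u) x) A (u x) := by
  have hAx := hA.self_of_nhds
  have hux := hu.self_of_nhds
  have hc : dd v (fun y => A (u y)) =ᶠ[𝓝 x] fun y => fderiv ℝ A (u y) (dd v u y) := by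
    filter_upwards [hA, hu] with y hy hy'
    exact dd_comp hy.diffAt hy'.diffAt v
  have hD : DifferentiableAt ℝ (fderiv ℝ A) (u x) := (hAx.fderiv_right (m := ∞) (by simp)).diffAt
  have hB : DifferentiableAt ℝ (fun y => fderiv ℝ A (u y)) x := hD.comp x hux.diffAt
  rw [hc.dd_eq, dd_dd_eq hAx]
  have h1 := (hB.hasFDerivAt.clm_apply (hux.dd v).diffAt.hasFDerivAt).fderiv
  have h2 := dd_comp (A := fderiv ℝ A) (u := u) hD hux.diffAt v
  simp only [dd] at h1 h2 ⊢
  rw [h1]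
  simp [h2, add_comm]

/-- The product rule for the expression defining the trace of a bilinear form `h` with respect to a
metric `g`. -/
lemma dd_gram_trace {t g₀₀ g₀₁ g₁₁ h₀₀ h₀₁ h₁₁ : E → ℝ} {x : E} (ht : DifferentiableAt ℝ t x)
    (h1 : DifferentiableAt ℝ g₀₀ x) (h2 : DifferentiableAt ℝ g₀₁ x) (h3 : DifferentiableAt ℝ g₁₁ x)
    (h4 : DifferentiableAt ℝ h₀₀ x) (h5 : DifferentiableAt ℝ h₀₁ x) (h6 : DifferentiableAt ℝ h₁₁ x)
    (v : E) : dd v (fun y => t y * (g₀₀ y * g₁₁ y - g₀₁ y * g₀₁ y)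
      + (g₁₁ y * h₀₀ y + g₀₀ y * h₁₁ y - 2 * (g₀₁ y * h₀₁ y))) x
      = dd v t x * (g₀₀ x * g₁₁ x - g₀₁ x * g₀₁ x)
        + t x * (dd v g₀₀ x * g₁₁ x + g₀₀ x * dd v g₁₁ x - 2 * (g₀₁ x * dd v g₀₁ x))
        + (dd v g₁₁ x * h₀₀ x + g₁₁ x * dd v h₀₀ x + dd v g₀₀ x * h₁₁ x + g₀₀ x * dd v h₁₁ x
          - 2 * (dd v g₀₁ x * h₀₁ x + g₀₁ x * dd v h₀₁ x)) := by
  have m1 := h1.fun_mul h3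
  have m2 := h2.fun_mul h2
  have m3 := h3.fun_mul h4
  have m4 := h1.fun_mul h6
  have m5 := h2.fun_mul h5
  have hc := differentiableAt_const (𝕜 := ℝ) (x := x) (2 : ℝ)
  rw [dd_add (ht.fun_mul (m1.fun_sub m2)) ((m3.fun_add m4).fun_sub (hc.fun_mul m5)),
    dd_mul ht (m1.fun_sub m2), dd_sub m1 m2, dd_mul h1 h3, dd_mul h2 h2,
    dd_sub (m3.fun_add m4) (hc.fun_mul m5), dd_add m3 m4, dd_mul hc m5, dd_mul h3 h4, dd_mul h1 h6,
    dd_mul h2 h5, dd_const]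
  ring

end DirectionalChainRule

/-- A map `G` into hyperbolic space, depending on parameters in `U ⊆ E`, with unit normal `N` to
the surfaces swept out in the directions `e`, moving with velocity `-(H - c) N` in the direction
`τ`, where `H` is the mean curvature of these surfaces. The formula for `H` is that for the trace
of a bilinear form in a not necessarily orthonormal basis. -/
structure IsNormalFlow {E : Type*} [NormedAddCommGroup E] [NormedSpace ℝ E] (c : ℝ) (τ : E)
    (e : Fin 2 → E) (U : Set E) (G N : E → Minkowski) (H : E → ℝ) : Prop where
  isOpen : IsOpen U
  smooth : ∀ x ∈ U, ContDiffAt ℝ ∞ G x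
  smooth_normal : ∀ x ∈ U, ContDiffAt ℝ ∞ N x
  mem : ∀ x ∈ U, G x ∈ Hyp3
  normal_pos : ∀ x ∈ U, mink (N x) (G x) = 0
  normal_unit : ∀ x ∈ U, mink (N x) (N x) = 1
  normal_tangent : ∀ x ∈ U, ∀ a, mink (N x) (dd (e a) G x) = 0
  velocity : ∀ x ∈ U, dd τ G x = -(H x - c) • N x
  mean : ∀ x ∈ U, H x * (mink (dd (e 0) G x) (dd (e 0) G x) * mink (dd (e 1) G x) (dd (e 1) G x)
      - mink (dd (e 0) G x) (dd (e 1) G x) ^ 2)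
    = -(mink (dd (e 1) G x) (dd (e 1) G x) * mink (N x) (dd (e 0) (dd (e 0) G) x)
      - 2 * mink (dd (e 0) G x) (dd (e 1) G x) * mink (N x) (dd (e 0) (dd (e 1) G) x)
      + mink (dd (e 0) G x) (dd (e 0) G x) * mink (N x) (dd (e 1) (dd (e 1) G) x))

namespace IsNormalFlow

variable {E : Type*} [NormedAddCommGroup E] [NormedSpace ℝ E] {c : ℝ} {τ : E}
    {e : Fin 2 → E} {U : Set E} {G N : E → Minkowski} {H : E → ℝ}
    (h : IsNormalFlow c τ e U G N H) {x : E} (hx : x ∈ U)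
include h hx

lemma eventually : ∀ᶠ y in 𝓝 x, y ∈ U := h.isOpen.mem_nhds hx

lemma mink_dd_pos (v : E) : mink (dd v G x) (G x) = 0 := by
  have h1 := dd_mink (h.smooth x hx).diffAt (h.smooth x hx).diffAt v
  rw [dd_eq_zero_of_eventually_const (c := -1)
    ((h.eventually hx).mono fun y hy => (h.mem y hy).1), mink_comm (G x)] at h1
  linarith

lemma mink_dd_normal_unit (v : E) : mink (dd v N x) (N x) = 0 := by
  have h1 := dd_mink (h.smooth_normal x hx).diffAt (h.smooth_normal x hx).diffAt v
  rw [dd_eq_zero_of_eventually_const (c := 1)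
    ((h.eventually hx).mono fun y hy => h.normal_unit y hy), mink_comm (N x)] at h1
  linarith

lemma mink_dd_normal_pos (v : E) : mink (dd v N x) (G x) = -mink (N x) (dd v G x) := by
  have h1 := dd_mink (h.smooth_normal x hx).diffAt (h.smooth x hx).diffAt v
  rw [dd_eq_zero_of_eventually_const (c := 0)
    ((h.eventually hx).mono fun y hy => h.normal_pos y hy)] at h1
  linarith

lemma mink_dd_normal_dd (v : E) (a : Fin 2) :
    mink (dd v N x) (dd (e a) G x) = -mink (N x) (dd v (dd (e a) G) x) := by
  have h1 := dd_mink (h.smooth_normal x hx).diffAt ((h.smooth x hx).dd (e a)).diffAt v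
  rw [dd_eq_zero_of_eventually_const (c := 0)
    ((h.eventually hx).mono fun y hy => h.normal_tangent y hy a)] at h1
  linarith

lemma mink_dd_dd_pos (u v : E) :
    mink (dd u (dd v G) x) (G x) = -mink (dd u G x) (dd v G x) := by
  have h1 := dd_mink ((h.smooth x hx).dd v).diffAt (h.smooth x hx).diffAt u
  rw [dd_eq_zero_of_eventually_const (c := 0)
    ((h.eventually hx).mono fun y hy => h.mink_dd_pos hy v), mink_comm (dd v G x)] at h1
  linarith

lemma mink_dd_dd_normal_self (a : Fin 2) :
    mink (dd (e a) (dd (e a) N) x) (N x) = -mink (dd (e a) N x) (dd (e a) N x) := by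
  have h1 := dd_mink ((h.smooth_normal x hx).dd (e a)).diffAt (h.smooth_normal x hx).diffAt (e a)
  rw [dd_eq_zero_of_eventually_const (c := 0)
    ((h.eventually hx).mono fun y hy => h.mink_dd_normal_unit hy (e a))] at h1
  linarith

lemma mink_dd_dd_normal_pos (a : Fin 2) :
    mink (dd (e a) (dd (e a) N) x) (G x) = mink (N x) (dd (e a) (dd (e a) G) x) := by
  have h1 := dd_mink ((h.smooth_normal x hx).dd (e a)).diffAt (h.smooth x hx).diffAt (e a)
  rw [dd_eq_zero_of_eventually_const (c := 0)
    ((h.eventually hx).mono fun y hy => by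
      rw [h.mink_dd_normal_pos hy, h.normal_tangent y hy, neg_zero]),
    h.mink_dd_normal_dd hx] at h1
  linarith

lemma mink_dd_dd_normal_dd (a b : Fin 2) :
    mink (dd (e a) (dd (e a) N) x) (dd (e b) G x)
      = -2 * mink (dd (e a) N x) (dd (e a) (dd (e b) G) x)
        - mink (N x) (dd (e a) (dd (e a) (dd (e b) G)) x) := by
  have hN := h.smooth_normal x hx
  have hG := (h.smooth x hx).dd (e b)
  have h1 := dd_mink (hN.dd (e a)).diffAt hG.diffAt (e a)
  have h2 := dd_mink hN.diffAt (hG.dd (e a)).diffAt (e a)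
  have h3 : dd (e a) (fun y => mink (dd (e a) N y) (dd (e b) G y)) x
      + dd (e a) (fun y => mink (N y) (dd (e a) (dd (e b) G) y)) x = 0 := by
    rw [← dd_add ((hN.dd (e a)).mink hG).diffAt (hN.mink (hG.dd (e a))).diffAt]
    refine dd_eq_zero_of_eventually_const (c := 0) ((h.eventually hx).mono fun y hy => ?_) _
    rw [h.mink_dd_normal_dd hy]
    ring
  linarith

lemma smooth_mean : ContDiffAt ℝ ∞ H x := by
  have : H =ᶠ[𝓝 x] fun y => c - mink (dd τ G y) (N y) := by
    filter_upwards [h.eventually hx] with y hy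
    rw [h.velocity y hy, mink_smul_left, h.normal_unit y hy]
    ring
  exact (contDiffAt_const.sub (((h.smooth x hx).dd τ).mink (h.smooth_normal x hx))).congr_of_eventuallyEq
    this

section Frame

variable (hw : ∀ a b, mink (dd (e a) G x) (dd (e b) G x) = if a = b then 1 else 0)
include hw

lemma lorentzFrame : IsLorentzFrame (G x) (dd (e 0) G x) (dd (e 1) G x) (N x) where
  h00 := (h.mem x hx).1
  h01 := by rw [mink_comm, h.mink_dd_pos hx]
  h02 := by rw [mink_comm, h.mink_dd_pos hx]
  h03 := by rw [mink_comm, h.normal_pos x hx]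
  h11 := by simpa using hw 0 0
  h12 := by simpa using hw 0 1
  h13 := by rw [mink_comm, h.normal_tangent x hx]
  h22 := by simpa using hw 1 1
  h23 := by rw [mink_comm, h.normal_tangent x hx]
  h33 := h.normal_unit x hx

lemma mean_eq : H x = -(mink (N x) (dd (e 0) (dd (e 0) G) x)
    + mink (N x) (dd (e 1) (dd (e 1) G) x)) := by
  have := h.mean x hx
  rw [hw 0 0, hw 0 1, hw 1 1] at this
  simp only [if_true, zero_ne_one, if_false] at this
  linarith

lemma dd_normal (a : Fin 2) : dd (e a) N x = -(mink (N x) (dd (e a) (dd (e 0) G) x) • dd (e 0) G x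
    + mink (N x) (dd (e a) (dd (e 1) G) x) • dd (e 1) G x) := by
  conv_lhs => rw [(h.lorentzFrame hx hw).expand (dd (e a) N x)]
  rw [h.mink_dd_normal_pos hx, h.normal_tangent x hx, h.mink_dd_normal_unit hx,
    h.mink_dd_normal_dd hx, h.mink_dd_normal_dd hx]
  module

lemma dd_normal_time : dd τ N x = -(H x - c) • G x + dd (e 0) H x • dd (e 0) G x
    + dd (e 1) H x • dd (e 1) G x := by
  have hv : ∀ a, mink (N x) (dd τ (dd (e a) G) x) = -dd (e a) H x := by
    intro a
    have hH := (h.smooth_mean hx).diffAt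
    have hN := (h.smooth_normal x hx).diffAt
    have hv : dd τ G =ᶠ[𝓝 x] fun y => (c - H y) • N y := by
      filter_upwards [h.eventually hx] with y hy
      rw [h.velocity y hy, neg_sub]
    rw [dd_comm (h.smooth x hx), hv.dd_eq,
      dd_smul (a := fun y => c - H y) ((differentiableAt_const c).sub hH) hN,
      mink_add_right, mink_smul_right, mink_smul_right, h.normal_unit x hx, mink_comm (N x),
      h.mink_dd_normal_unit hx, dd_sub (A := fun _ => c) (differentiableAt_const c) hH, dd_const]
    ring
  conv_lhs => rw [(h.lorentzFrame hx hw).expand (dd τ N x)]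
  rw [h.mink_dd_normal_pos hx, h.mink_dd_normal_unit hx,
    h.mink_dd_normal_dd hx, h.mink_dd_normal_dd hx, hv, hv, h.velocity x hx, mink_smul_right,
    h.normal_unit x hx]
  module

lemma mink_dd_normal_eq (a : Fin 2) (V : Minkowski) : mink (dd (e a) N x) V
    = -(mink (N x) (dd (e a) (dd (e 0) G) x) * mink V (dd (e 0) G x)
      + mink (N x) (dd (e a) (dd (e 1) G) x) * mink V (dd (e 1) G x)) := by
  rw [h.dd_normal hx hw, mink_neg_left, mink_add_left, mink_smul_left, mink_smul_left,
    mink_comm V, mink_comm V]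

/-- The derivative of the mean curvature, in terms of the second derivatives of the normal:
the contracted Codazzi equation. -/
lemma sum_mink_dd_dd_normal_dd (b : Fin 2) :
    ∑ a, mink (dd (e a) (dd (e a) N) x) (dd (e b) G x)
      = dd (e b) H x - ∑ d, mink (N x) (dd (e b) (dd (e d) G) x)
        * ∑ a, mink (dd (e a) (dd (e a) G) x) (dd (e d) G x) := by
  have hN := h.smooth_normal x hx
  have hG := h.smooth x hx
  have hH := h.smooth_mean hx
  have dg : ∀ i j, dd (e b) (fun y => mink (dd (e i) G y) (dd (e j) G y)) x
      = mink (dd (e b) (dd (e i) G) x) (dd (e j) G x)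
        + mink (dd (e b) (dd (e j) G) x) (dd (e i) G x) := fun i j => by
    rw [dd_mink (hG.dd _).diffAt (hG.dd _).diffAt, mink_comm (dd (e i) G x)]
  have dh : ∀ i j, dd (e b) (fun y => mink (N y) (dd (e i) (dd (e j) G) y)) x
      = mink (dd (e b) N x) (dd (e i) (dd (e j) G) x)
        + mink (N x) (dd (e b) (dd (e i) (dd (e j) G)) x) := fun i j => 
    dd_mink hN.diffAt ((hG.dd _).dd _).diffAt _
  have sg : ∀ i j, DifferentiableAt ℝ (fun y => mink (dd (e i) G y) (dd (e j) G y)) x := fun i j =>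
    ((hG.dd _).mink (hG.dd _)).diffAt
  have sh : ∀ i j, DifferentiableAt ℝ (fun y => mink (N y) (dd (e i) (dd (e j) G) y)) x :=
    fun i j => (hN.mink ((hG.dd _).dd _)).diffAt
  have hzero : dd (e b) (fun y => H y * (mink (dd (e 0) G y) (dd (e 0) G y)
        * mink (dd (e 1) G y) (dd (e 1) G y)
        - mink (dd (e 0) G y) (dd (e 1) G y) * mink (dd (e 0) G y) (dd (e 1) G y))
      + (mink (dd (e 1) G y) (dd (e 1) G y) * mink (N y) (dd (e 0) (dd (e 0) G) y)
        + mink (dd (e 0) G y) (dd (e 0) G y) * mink (N y) (dd (e 1) (dd (e 1) G) y)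
        - 2 * (mink (dd (e 0) G y) (dd (e 1) G y) * mink (N y) (dd (e 0) (dd (e 1) G) y)))) x
      = 0 := by
    refine dd_eq_zero_of_eventually_const (c := 0) ((h.eventually hx).mono fun y hy => ?_) _
    have := h.mean y hy
    linear_combination this
  rw [dd_gram_trace hH.diffAt (sg 0 0) (sg 0 1) (sg 1 1) (sh 0 0) (sh 0 1) (sh 1 1)] at hzero
  simp only [dg, dh, hw] at hzero
  rw [h.mean_eq hx hw] at hzero
  have third : ∀ a, dd (e b) (dd (e a) (dd (e a) G)) x = dd (e a) (dd (e a) (dd (e b) G)) x := by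
    intro a
    rw [dd_comm (hG.dd (e a))]
    refine Filter.EventuallyEq.dd_eq ?_ _
    filter_upwards [h.eventually hx] with y hy
    exact dd_comm (h.smooth y hy) _ _
  have s01 := dd_comm hG (e 0) (e 1)
  simp only [h.mink_dd_normal_eq hx hw, third] at hzero
  simp only [h.mink_dd_dd_normal_dd hx, h.mink_dd_normal_eq hx hw, Fin.sum_univ_two]
  simp only [if_true, zero_ne_one, one_ne_zero, if_false] at hzero
  fin_cases b
  · simp only [Fin.zero_eta, s01] at hzero ⊢
    linear_combination (-1 : ℝ) * hzero
  · simp only [Fin.mk_one, s01] at hzero ⊢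
    linear_combination (-1 : ℝ) * hzero

end Frame

end IsNormalFlow

/-! ### Evolution equations for the distance and the angle -/

namespace IsNormalFlow

variable {M : AlmostFuchsian} {E : Type*} [NormedAddCommGroup E] [NormedSpace ℝ E] {c : ℝ} {τ : E}
    {e : Fin 2 → E} {U : Set E} {G N : E → Minkowski} {H : E → ℝ}
    (h : IsNormalFlow c τ e U G N H) {x : E} (hx : x ∈ U)
include h hx

lemma smooth_footNormal : ContDiffAt ℝ ∞ (fun y => M.footNormal (G y)) x :=
  (AlmostFuchsian.contDiffAt_footNormal (Hyp3_subset_futureCone (h.mem x hx))).comp x (h.smooth x hx)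

lemma dd_footNormal_comp (v : E) : dd v (fun y => M.footNormal (G y)) x
    = dd (dd v G x) M.footNormal (G x) :=
  dd_comp (AlmostFuchsian.contDiffAt_footNormal
    (Hyp3_subset_futureCone (h.mem x hx))).diffAt (h.smooth x hx).diffAt v

lemma dd_dd_footNormal_comp (v : E) : dd v (dd v (fun y => M.footNormal (G y))) x
    = dd (dd v G x) (dd (dd v G x) M.footNormal) (G x)
      + dd (dd v (dd v G) x) M.footNormal (G x) :=
  dd_dd_comp ((h.eventually hx).mono fun y hy => AlmostFuchsian.contDiffAt_footNormal
    (Hyp3_subset_futureCone (h.mem y hy))) ((h.eventually hx).mono fun y hy => h.smooth y hy) v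

/-- The function `sinh` of the signed distance to the minimal surface, along the flow. -/
lemma dd_height (v : E) : dd v (fun y => mink (G y) (M.footNormal (G y))) x
    = mink (dd v G x) (M.footNormal (G x)) := by
  rw [dd_mink (h.smooth x hx).diffAt (h.smooth_footNormal hx).diffAt, h.dd_footNormal_comp hx,
    mink_comm (G x), AlmostFuchsian.mink_dd_footNormal_left (h.mem x hx), add_zero]

lemma dd_height_time : dd τ (fun y => mink (G y) (M.footNormal (G y))) x
    = -(H x - c) * mink (N x) (M.footNormal (G x)) := by
  rw [h.dd_height hx, h.velocity x hx, mink_smul_left]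

lemma dd_dd_height (v : E) : dd v (dd v (fun y => mink (G y) (M.footNormal (G y)))) x
    = mink (dd v (dd v G) x) (M.footNormal (G x))
      + mink (dd (dd v G x) M.footNormal (G x)) (dd v G x) := by
  have : dd v (fun y => mink (G y) (M.footNormal (G y)))
      =ᶠ[𝓝 x] fun y => mink (dd v G y) (M.footNormal (G y)) :=
    (h.eventually hx).mono fun y hy => h.dd_height hy v
  rw [this.dd_eq, dd_mink ((h.smooth x hx).dd v).diffAt (h.smooth_footNormal hx).diffAt,
    h.dd_footNormal_comp hx, mink_comm (dd v G x)]

lemma dd_angle (v : E) : dd v (fun y => mink (N y) (M.footNormal (G y))) x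
    = mink (dd v N x) (M.footNormal (G x)) + mink (dd (dd v G x) M.footNormal (G x)) (N x) := by
  rw [dd_mink (h.smooth_normal x hx).diffAt (h.smooth_footNormal hx).diffAt,
    h.dd_footNormal_comp hx, mink_comm (N x) (dd _ _ _)]

lemma dd_dd_angle (v : E) : dd v (dd v (fun y => mink (N y) (M.footNormal (G y)))) x
    = mink (dd v (dd v N) x) (M.footNormal (G x))
      + 2 * mink (dd (dd v G x) M.footNormal (G x)) (dd v N x)
      + mink (dd (dd v G x) (dd (dd v G x) M.footNormal) (G x)) (N x)
      + mink (dd (dd v (dd v G) x) M.footNormal (G x)) (N x) := by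
  have hN := h.smooth_normal x hx
  have hm := h.smooth_footNormal (M := M) hx
  have : dd v (fun y => mink (N y) (M.footNormal (G y)))
      =ᶠ[𝓝 x] fun y => mink (dd v N y) (M.footNormal (G y))
        + mink (N y) (dd v (fun z => M.footNormal (G z)) y) :=
    (h.eventually hx).mono fun y hy =>
      dd_mink (h.smooth_normal y hy).diffAt (h.smooth_footNormal hy).diffAt v
  rw [this.dd_eq, dd_add ((hN.dd v).mink hm).diffAt (hN.mink (hm.dd v)).diffAt,
    dd_mink (hN.dd v).diffAt hm.diffAt, dd_mink hN.diffAt (hm.dd v).diffAt,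
    h.dd_dd_footNormal_comp hx, h.dd_footNormal_comp hx, mink_comm (N x), mink_add_left,
    mink_comm (dd v N x) (dd _ _ _)]
  ring

section Frame

variable (hw : ∀ a b, mink (dd (e a) G x) (dd (e b) G x) = if a = b then 1 else 0)
include hw

lemma second_derivative_eq (a : Fin 2) : dd (e a) (dd (e a) G) x
    = G x + mink (dd (e a) (dd (e a) G) x) (dd (e 0) G x) • dd (e 0) G x
      + mink (dd (e a) (dd (e a) G) x) (dd (e 1) G x) • dd (e 1) G x
      + mink (N x) (dd (e a) (dd (e a) G) x) • N x := by
  conv_lhs => rw [(h.lorentzFrame hx hw).expand (dd (e a) (dd (e a) G) x)]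
  rw [h.mink_dd_dd_pos hx, hw, mink_comm _ (N x)]
  simp

/-- The gradient of the height, by Parseval's identity for `∂/∂r`. -/
lemma grad_height_sq : ∑ a, dd (e a) (fun y => mink (G y) (M.footNormal (G y))) x ^ 2
    = 1 + mink (G x) (M.footNormal (G x)) ^ 2 - mink (N x) (M.footNormal (G x)) ^ 2 := by
  have hp := (h.lorentzFrame hx hw).parseval (M.footNormal (G x)) (M.footNormal (G x))
  rw [show mink (M.footNormal (G x)) (M.footNormal (G x)) = 1 from
    (M.surface (M.foot (G x))).normal_unit] at hp
  simp only [h.dd_height hx, Fin.sum_univ_two]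
  rw [mink_comm (G x), mink_comm (N x), mink_comm (dd _ _ _), mink_comm (dd _ _ _)]
  linarith

/-- The second derivatives of the height; the right-hand side includes the Christoffel terms. -/
lemma laplacian_height :
    ∑ a, dd (e a) (dd (e a) (fun y => mink (G y) (M.footNormal (G y)))) x
    = ∑ d, (∑ a, mink (dd (e a) (dd (e a) G) x) (dd (e d) G x))
        * dd (e d) (fun y => mink (G y) (M.footNormal (G y))) x
      + 2 * mink (G x) (M.footNormal (G x)) - H x * mink (N x) (M.footNormal (G x))
      + ∑ a, mink (dd (dd (e a) G x) M.footNormal (G x)) (dd (e a) G x) := by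
  have key : ∀ a, mink (dd (e a) (dd (e a) G) x) (M.footNormal (G x))
      = mink (G x) (M.footNormal (G x)) + mink (dd (e a) (dd (e a) G) x) (dd (e 0) G x)
        * mink (dd (e 0) G x) (M.footNormal (G x))
        + mink (dd (e a) (dd (e a) G) x) (dd (e 1) G x) * mink (dd (e 1) G x) (M.footNormal (G x))
        + mink (N x) (dd (e a) (dd (e a) G) x) * mink (N x) (M.footNormal (G x)) := by
    intro a
    conv_lhs => rw [h.second_derivative_eq hx hw a]
    simp only [mink_add_left, mink_smul_left]
  simp only [h.dd_dd_height hx, h.dd_height hx, Fin.sum_univ_two, key]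
  rw [h.mean_eq hx hw]
  ring

/-- The evolution equation of `⟨N, m⟩`, where `m` is the normal at the foot point. The sum over `d` on
the left-hand side turns the sum of second derivatives into the Laplacian. -/
lemma angle_evolution :
    dd τ (fun y => mink (N y) (M.footNormal (G y))) x
      - ∑ a, dd (e a) (dd (e a) (fun y => mink (N y) (M.footNormal (G y)))) x
      + ∑ d, (∑ a, mink (dd (e a) (dd (e a) G) x) (dd (e d) G x))
        * dd (e d) (fun y => mink (N y) (M.footNormal (G y))) x
    = (∑ a, ∑ b, mink (N x) (dd (e a) (dd (e b) G) x) ^ 2) * mink (N x) (M.footNormal (G x))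
      - 2 * H x * mink (G x) (M.footNormal (G x))
      + 2 * ∑ a, ∑ b, mink (N x) (dd (e a) (dd (e b) G) x)
        * mink (dd (dd (e a) G x) M.footNormal (G x)) (dd (e b) G x)
      + c * mink (G x) (M.footNormal (G x)) + c * mink (dd (N x) M.footNormal (G x)) (N x)
      - ∑ a, mink (dd (dd (e a) G x) (dd (dd (e a) G x) M.footNormal) (G x)) (N x) := by
  have hDm : ∀ a, mink (dd (dd (e a) (dd (e a) G) x) M.footNormal (G x)) (N x)
      = mink (dd (e a) (dd (e a) G) x) (dd (e 0) G x)
          * mink (dd (dd (e 0) G x) M.footNormal (G x)) (N x)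
        + mink (dd (e a) (dd (e a) G) x) (dd (e 1) G x)
          * mink (dd (dd (e 1) G x) M.footNormal (G x)) (N x)
        + mink (N x) (dd (e a) (dd (e a) G) x) * mink (dd (N x) M.footNormal (G x)) (N x) := by
    intro a
    conv_lhs => rw [h.second_derivative_eq hx hw a]
    simp only [dd_add_dir, dd_smul_dir, AlmostFuchsian.dd_footNormal_self (h.mem x hx),
      mink_add_left, mink_smul_left, mink_zero_left]
    ring
  have hτ : mink (dd τ N x) (M.footNormal (G x)) = -(H x - c) * mink (G x) (M.footNormal (G x))
      + dd (e 0) H x * mink (dd (e 0) G x) (M.footNormal (G x))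
      + dd (e 1) H x * mink (dd (e 1) G x) (M.footNormal (G x)) := by
    rw [h.dd_normal_time hx hw]
    simp only [mink_add_left, mink_smul_left]
  have hτ2 : mink (dd (dd τ G x) M.footNormal (G x)) (N x)
      = -(H x - c) * mink (dd (N x) M.footNormal (G x)) (N x) := by
    rw [h.velocity x hx, dd_smul_dir, mink_smul_left]
  have hNa : ∀ (a : Fin 2) (V : Minkowski), mink V (dd (e a) N x)
      = -(mink (N x) (dd (e a) (dd (e 0) G) x) * mink V (dd (e 0) G x)
        + mink (N x) (dd (e a) (dd (e 1) G) x) * mink V (dd (e 1) G x)) := fun a V => by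
    rw [mink_comm, h.mink_dd_normal_eq hx hw]
  have hNaa : ∀ a, mink (dd (e a) (dd (e a) N) x) (M.footNormal (G x))
      = -(mink (N x) (dd (e a) (dd (e a) G) x) * mink (G x) (M.footNormal (G x)))
        + mink (dd (e a) (dd (e a) N) x) (dd (e 0) G x)
          * mink (dd (e 0) G x) (M.footNormal (G x))
        + mink (dd (e a) (dd (e a) N) x) (dd (e 1) G x)
          * mink (dd (e 1) G x) (M.footNormal (G x))
        - (mink (N x) (dd (e a) (dd (e 0) G) x) ^ 2 + mink (N x) (dd (e a) (dd (e 1) G) x) ^ 2)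
          * mink (N x) (M.footNormal (G x)) := by
    intro a
    rw [(h.lorentzFrame hx hw).parseval (dd (e a) (dd (e a) N) x) (M.footNormal (G x)),
      h.mink_dd_dd_normal_pos hx, h.mink_dd_dd_normal_self hx, hNa a (dd (e a) N x),
      h.mink_dd_normal_dd hx, h.mink_dd_normal_dd hx, mink_comm _ (G x),
      mink_comm (M.footNormal (G x)) (N x), mink_comm (M.footNormal (G x)) (dd _ _ _),
      mink_comm (M.footNormal (G x)) (dd _ _ _)]
    ring
  have c0 := h.sum_mink_dd_dd_normal_dd hx hw 0
  have c1 := h.sum_mink_dd_dd_normal_dd hx hw 1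
  have s01 := dd_comm (h.smooth x hx) (e 1) (e 0)
  have hH := h.mean_eq hx hw
  simp only [Fin.sum_univ_two] at c0 c1 ⊢
  simp only [h.dd_angle hx, h.dd_dd_angle hx, hDm, hτ, hτ2, hNaa, hNa,
    h.mink_dd_normal_eq hx hw, mink_comm (M.footNormal (G x)) (dd _ _ _)]
  rw [s01] at *
  set s0 := mink (dd (e 0) G x) (M.footNormal (G x))
  set s1 := mink (dd (e 1) G x) (M.footNormal (G x))
  set n00 := mink (N x) (dd (e 0) (dd (e 0) G) x)
  set n01 := mink (N x) (dd (e 0) (dd (e 1) G) x)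
  set n11 := mink (N x) (dd (e 1) (dd (e 1) G) x)
  set D := mink (dd (N x) M.footNormal (G x)) (N x)
  set s := mink (G x) (M.footNormal (G x))
  linear_combination (-s0) * c0 - s1 * c1 - (D - s) * hH

end Frame

end IsNormalFlow

/-! ### The mean curvature flow in space-time -/

namespace IsSurface

variable {F N : Plane → Minkowski} (h : IsSurface F N)
include h

lemma gram_det_pos (x : Plane) : 0 < mink (pd 0 F x) (pd 0 F x) * mink (pd 1 F x) (pd 1 F x)
    - mink (pd 0 F x) (pd 1 F x) ^ 2 := by
  obtain ⟨w, hw⟩ := h.exists_frame x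
  have h1 := congrArg Matrix.det hw.matrix
  rw [Matrix.det_mul, Matrix.det_mul, Matrix.det_transpose, Matrix.det_one,
    Matrix.det_fin_two (metric F x)] at h1
  simp only [metric, Matrix.of_apply] at h1
  rw [mink_comm (pd 1 F x) (pd 0 F x), ← sq] at h1
  by_contra! hneg
  nlinarith [sq_nonneg (Matrix.of w).det]

/-- The mean curvature in terms of an arbitrary pair of tangent directions. -/
lemma meanCurvature_mul_gram (x u v : Plane) :
    meanCurvature F N x * (mink (dd u F x) (dd u F x) * mink (dd v F x) (dd v F x)
      - mink (dd u F x) (dd v F x) ^ 2)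
    = mink (dd v F x) (dd v F x) * sff F N x u u - 2 * mink (dd u F x) (dd v F x) * sff F N x u v
      + mink (dd u F x) (dd u F x) * sff F N x v v := by
  obtain ⟨w, hw⟩ := h.exists_frame x
  have hL := h.lorentzFrame hw
  rw [meanCurvature_eq h.smooth hw, Fin.sum_univ_two]
  have hp : ∀ a b : Plane, mink (dd a F x) (dd b F x)
      = mink (dd a F x) (dd (w 0) F x) * mink (dd b F x) (dd (w 0) F x)
        + mink (dd a F x) (dd (w 1) F x) * mink (dd b F x) (dd (w 1) F x) := by
    intro a b
    rw [hL.parseval, h.mink_dd_self, mink_comm (dd a F x) (N x), h.mink_normal_dd]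
    ring
  have hs : ∀ a b : Plane, sff F N x a b
      = mink (dd a F x) (dd (w 0) F x) * (mink (dd b F x) (dd (w 0) F x) * sff F N x (w 0) (w 0)
          + mink (dd b F x) (dd (w 1) F x) * sff F N x (w 0) (w 1))
        + mink (dd a F x) (dd (w 1) F x) * (mink (dd b F x) (dd (w 0) F x) * sff F N x (w 0) (w 1)
          + mink (dd b F x) (dd (w 1) F x) * sff F N x (w 1) (w 1)) := by
    intro a b
    rw [← sff_sum_frame h hw, Fin.sum_univ_two, sff_comm h.smooth _ a, sff_comm h.smooth _ a,
      ← sff_sum_frame h hw (w 0) a, ← sff_sum_frame h hw (w 1) a, Fin.sum_univ_two,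
      Fin.sum_univ_two, sff_comm h.smooth _ (w 1) (w 0)]
    ring
  rw [hp u u, hp u v, hp v v, hs u u, hs u v, hs v v]
  ring

/-- The orthogonal projection of a fixed vector to the normal line, multiplied by the Gram
determinant, is polynomial in the first derivatives of the surface. -/
lemma normal_projection (x : Plane) (Y : Minkowski) :
    (mink (pd 0 F x) (pd 0 F x) * mink (pd 1 F x) (pd 1 F x) - mink (pd 0 F x) (pd 1 F x) ^ 2)
        • (Y + mink Y (F x) • F x)
      - (mink (pd 1 F x) (pd 1 F x) * mink Y (pd 0 F x)
          - mink (pd 0 F x) (pd 1 F x) * mink Y (pd 1 F x)) • pd 0 F x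
      - (mink (pd 0 F x) (pd 0 F x) * mink Y (pd 1 F x)
          - mink (pd 0 F x) (pd 1 F x) * mink Y (pd 0 F x)) • pd 1 F x
    = ((mink (pd 0 F x) (pd 0 F x) * mink (pd 1 F x) (pd 1 F x) - mink (pd 0 F x) (pd 1 F x) ^ 2)
        * mink Y (N x)) • N x := by
  obtain ⟨w, hw⟩ := h.exists_frame x
  have hL := h.lorentzFrame hw
  have hs := h.surface x
  have d0 : mink (pd 0 F x) (F x) = 0 := h.mink_dd_self x _
  have d1 : mink (pd 1 F x) (F x) = 0 := h.mink_dd_self x _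
  set W : Minkowski := (_ : Minkowski) - (_ : Minkowski) - (_ : Minkowski) with hW
  have w0 : mink W (pd 0 F x) = 0 := by
    simp only [hW, mink_sub_left, mink_smul_left, mink_add_left, mink_comm (F x), d0,
      mink_comm (pd 1 F x) (pd 0 F x)]
    ring
  have w1 : mink W (pd 1 F x) = 0 := by
    simp only [hW, mink_sub_left, mink_smul_left, mink_add_left, mink_comm (F x), d1,
      mink_comm (pd 1 F x) (pd 0 F x)]
    ring
  have wF : mink W (F x) = 0 := by
    simp only [hW, mink_sub_left, mink_smul_left, mink_add_left, d0, d1, hs.mem.1]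
    ring
  have wN : mink W (N x) = (mink (pd 0 F x) (pd 0 F x) * mink (pd 1 F x) (pd 1 F x)
      - mink (pd 0 F x) (pd 1 F x) ^ 2) * mink Y (N x) := by
    rw [mink_comm W, mink_comm Y (N x)]
    simp only [hW, mink_sub_right, mink_smul_right, mink_add_right, hs.normal_orthogonal,
      hs.normal_tangent]
    ring
  have wd : ∀ v, mink W (dd v F x) = 0 := by
    intro v
    rw [dd_eq_pd, mink_add_right, mink_smul_right, mink_smul_right, w0, w1]
    ring
  rw [hL.expand W, wd, wd, wF, wN]
  simp

end IsSurface

namespace AlmostFuchsian.IsMMCF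

variable {M : AlmostFuchsian} {c T : ℝ} {F ν : ℝ → Plane → Minkowski} (h : M.IsMMCF c T F ν)
include h

lemma contDiff_slice {t : ℝ} (ht : t ∈ Ico 0 T) : ContDiff ℝ ∞ (F t) := by
  rw [← contDiffOn_univ]
  exact h.smooth.comp (contDiff_prodMk_right t).contDiffOn fun x _ => ⟨ht, mem_univ x⟩

lemma isSurface {t : ℝ} (ht : t ∈ Ico 0 T) : IsSurface (F t) (ν t) :=
  ⟨h.contDiff_slice ht, h.surface t ht⟩

omit h in
lemma isOpen_interior : IsOpen (Ioo 0 T ×ˢ (univ : Set Plane)) := isOpen_Ioo.prod isOpen_univ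

lemma contDiffAt {q : ℝ × Plane} (hq : q ∈ Ioo 0 T ×ˢ (univ : Set Plane)) :
    ContDiffAt ℝ ∞ (fun q : ℝ × Plane => F q.1 q.2) q :=
  (h.smooth.mono (prod_mono_left Ioo_subset_Ico_self)).contDiffAt (isOpen_interior.mem_nhds hq)

lemma continuousAt_normal {q : ℝ × Plane} (hq : q ∈ Ioo 0 T ×ˢ (univ : Set Plane)) :
    ContinuousAt (fun q : ℝ × Plane => ν q.1 q.2) q :=
  (h.normal_continuous.mono (prod_mono_left Ioo_subset_Ico_self)).continuousAt
    (isOpen_interior.mem_nhds hq)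

omit h in
lemma dd_slice_of_differentiableAt {V : Type*} [NormedAddCommGroup V] [NormedSpace ℝ V]
    {A : ℝ × Plane → V} {t : ℝ} {x : Plane}
    (hA : DifferentiableAt ℝ A (t, x)) (v : Plane) :
    dd v (fun y => A (t, y)) x = dd ((0 : ℝ), v) A (t, x) := by
  have hp : HasFDerivAt (fun y : Plane => (t, y)) (ContinuousLinearMap.inr ℝ ℝ Plane) x :=
    hasFDerivAt_prodMk_right t x
  rw [dd_comp (u := fun y => (t, y)) hA hp.differentiableAt]
  congr 1
  rw [dd, hp.fderiv]
  rfl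

lemma dd_slice {t : ℝ} (ht : t ∈ Ioo 0 T) (x v : Plane) :
    dd v (F t) x = dd ((0 : ℝ), v) (fun q : ℝ × Plane => F q.1 q.2) (t, x) :=
  dd_slice_of_differentiableAt (A := fun q : ℝ × Plane => F q.1 q.2)
    (h.contDiffAt ⟨ht, mem_univ x⟩).diffAt v

lemma dd_dd_slice {t : ℝ} (ht : t ∈ Ioo 0 T) (x u v : Plane) : dd u (dd v (F t)) x
    = dd ((0 : ℝ), u) (dd ((0 : ℝ), v) (fun q : ℝ × Plane => F q.1 q.2)) (t, x) := by
  rw [← dd_slice_of_differentiableAt ((h.contDiffAt ⟨ht, mem_univ x⟩).dd _).diffAt]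
  congr 1
  funext y
  exact h.dd_slice ht y v

/-- The unit normal, which is only assumed to be continuous, is smooth: near a point `q` it is the
normalized projection of the constant vector `ν(q)` to the normal line of `F`. -/
lemma contDiffAt_normal {q : ℝ × Plane} (hq : q ∈ Ioo 0 T ×ˢ (univ : Set Plane)) :
    ContDiffAt ℝ ∞ (fun q : ℝ × Plane => ν q.1 q.2) q := by
  set G : ℝ × Plane → Minkowski := fun q => F q.1 q.2 with hGdef
  set N : ℝ × Plane → Minkowski := fun q => ν q.1 q.2 with hNdef
  set G₀ := dd ((0 : ℝ), (Pi.single 0 1 : Plane)) G with hG₀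
  set G₁ := dd ((0 : ℝ), (Pi.single 1 1 : Plane)) G with hG₁
  have sG := h.contDiffAt hq
  have s0 : ContDiffAt ℝ ∞ G₀ q := sG.dd _
  have s1 : ContDiffAt ℝ ∞ G₁ q := sG.dd _
  set Y := N q with hY
  set d : ℝ × Plane → ℝ := fun z => mink (G₀ z) (G₀ z) * mink (G₁ z) (G₁ z)
    - mink (G₀ z) (G₁ z) ^ 2 with hd
  set W : ℝ × Plane → Minkowski := fun z => d z • (Y + mink Y (G z) • G z)
    - (mink (G₁ z) (G₁ z) * mink Y (G₀ z) - mink (G₀ z) (G₁ z) * mink Y (G₁ z)) • G₀ z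
    - (mink (G₀ z) (G₀ z) * mink Y (G₁ z) - mink (G₀ z) (G₁ z) * mink Y (G₀ z)) • G₁ z with hW
  have sY : ContDiffAt ℝ ∞ (fun _ : ℝ × Plane => Y) q := contDiffAt_const
  have sd : ContDiffAt ℝ ∞ d q :=
    ((s0.mink s0).mul (s1.mink s1)).sub ((s0.mink s1).pow 2)
  have sW : ContDiffAt ℝ ∞ W q :=
    ((sd.smul (sY.add ((sY.mink sG).smul sG))).sub
      ((((s1.mink s1).mul (sY.mink s0)).sub ((s0.mink s1).mul (sY.mink s1))).smul s0)).sub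
      ((((s0.mink s0).mul (sY.mink s1)).sub ((s0.mink s1).mul (sY.mink s0))).smul s1)
  have hpd : ∀ z ∈ Ioo 0 T ×ˢ (univ : Set Plane), 0 < d z ∧ mink (N z) (N z) = 1
      ∧ W z = (d z * mink Y (N z)) • N z := by
    rintro ⟨t, x⟩ ⟨ht, -⟩
    have hs := h.isSurface (Ioo_subset_Ico_self ht)
    have e0 : pd 0 (F t) x = G₀ (t, x) := h.dd_slice ht x _
    have e1 : pd 1 (F t) x = G₁ (t, x) := h.dd_slice ht x _
    have a := hs.gram_det_pos x
    have b := hs.normal_projection x Y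
    rw [e0, e1] at a b
    exact ⟨a, (hs.surface x).normal_unit, b⟩
  have hpos : ∀ᶠ z in 𝓝 q, 0 < mink Y (N z) := by
    have hc : ContinuousAt (fun z => mink Y (N z)) q :=
      ((minkCLM Y).continuous.continuousAt).comp (h.continuousAt_normal hq)
    refine hc.eventually (lt_mem_nhds ?_)
    exact one_pos.trans_eq (hpd q hq).2.1.symm
  have heq : N =ᶠ[𝓝 q] fun z => (Real.sqrt (mink (W z) (W z)))⁻¹ • W z := by
    filter_upwards [hpos, isOpen_interior.mem_nhds hq] with z hz hzU
    obtain ⟨h1, h2, h3⟩ := hpd z hzU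
    have hk : 0 < d z * mink Y (N z) := mul_pos h1 hz
    have hWW : mink (W z) (W z) = (d z * mink Y (N z)) ^ 2 := by
      rw [h3, mink_smul_left, mink_smul_right, h2]; ring
    rw [hWW, Real.sqrt_sq hk.le, h3, smul_smul, inv_mul_cancel₀ hk.ne', one_smul]
  have hWW : mink (W q) (W q) ≠ 0 := by
    obtain ⟨h1, h2, h3⟩ := hpd q hq
    rw [h3, mink_smul_left, mink_smul_right, h2]
    positivity
  refine ContDiffAt.congr_of_eventuallyEq ?_ heq
  refine (((sW.mink sW).sqrt hWW).inv
    (Real.sqrt_ne_zero'.2 (lt_of_le_of_ne ?_ hWW.symm))).smul sW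
  obtain ⟨h1, h2, h3⟩ := hpd q hq
  rw [h3, mink_smul_left, mink_smul_right, h2]
  nlinarith [sq_nonneg (d q * mink Y (N q))]

/-- The modified mean curvature flow, as seen in space-time. -/
lemma isNormalFlow (w : Fin 2 → Plane) : IsNormalFlow c ((1 : ℝ), (0 : Plane))
    (fun a => ((0 : ℝ), w a)) (Ioo 0 T ×ˢ (univ : Set Plane)) (fun q => F q.1 q.2)
    (fun q => ν q.1 q.2) (fun q => meanCurvature (F q.1) (ν q.1) q.2) where
  isOpen := isOpen_interior
  smooth _ hq := h.contDiffAt hq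
  smooth_normal _ hq := h.contDiffAt_normal hq
  mem q hq := (h.surface q.1 (Ioo_subset_Ico_self hq.1) q.2).mem
  normal_pos q hq := (h.surface q.1 (Ioo_subset_Ico_self hq.1) q.2).normal_tangent
  normal_unit q hq := (h.surface q.1 (Ioo_subset_Ico_self hq.1) q.2).normal_unit
  normal_tangent := by
    rintro ⟨t, x⟩ hq a
    rw [← h.dd_slice hq.1]
    exact (h.isSurface (Ioo_subset_Ico_self hq.1)).mink_normal_dd x (w a)
  velocity := by
    rintro ⟨t, x⟩ hq
    have h1 : HasDerivAt (fun s => F s x) (-(meanCurvature (F t) (ν t) x - c) • ν t x) t :=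
      (h.evolution t (Ioo_subset_Ico_self hq.1) x).hasDerivAt (Ico_mem_nhds hq.1.1 hq.1.2)
    have h2 : HasFDerivAt (fun q : ℝ × Plane => F q.1 q.2) _ (t, x) :=
      (h.contDiffAt hq).diffAt.hasFDerivAt
    have h3 := h2.comp_hasDerivAt t ((hasDerivAt_id t).prodMk (hasDerivAt_const t x))
    exact h3.unique h1
  mean := by
    rintro ⟨t, x⟩ hq
    simp only [← h.dd_slice hq.1, ← h.dd_dd_slice hq.1]
    rw [(h.isSurface (Ioo_subset_Ico_self hq.1)).meanCurvature_mul_gram]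
    simp only [sff]
    ring

end AlmostFuchsian.IsMMCF

/-! ### Invariance under deck transformations and first contact -/

namespace AlmostFuchsian

variable {M : AlmostFuchsian}

lemma footNormal_equivariant {P : Minkowski} (hP : P ∈ Hyp3) (γ : M.Γ) :
    M.footNormal ((γ : Minkowski ≃ₗ[ℝ] Minkowski) P)
      = (γ : Minkowski ≃ₗ[ℝ] Minkowski) (M.footNormal P) := by
  rw [footNormal, foot_equivariant hP, M.n_equivariant, footNormal]

/-- The first time at which a continuous function on `[0, t₁] × Σ`, positive at the time zero, has
a zero. -/
lemma exists_first_contact {Z : ℝ × Plane → ℝ} {t₁ : ℝ}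
    (hc : ContinuousOn Z (Icc 0 t₁ ×ˢ univ))
    (hinv : ∀ t ∈ Icc 0 t₁, ∀ (γ : M.Γ) x, Z (t, M.deck γ x) = Z (t, x))
    (h0 : ∀ x, 0 < Z (0, x)) (hn : ∃ t ∈ Icc 0 t₁, ∃ x, Z (t, x) ≤ 0) :
    ∃ t ∈ Ioc 0 t₁, ∃ x, Z (t, x) = 0 ∧ (∀ s ∈ Ico 0 t, ∀ y, 0 < Z (s, y)) ∧
      ∀ y, 0 ≤ Z (t, y) := by
  obtain ⟨K, hK, hKM⟩ := M.cocompact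
  have hcK : ContinuousOn Z (Icc 0 t₁ ×ˢ K) := hc.mono (prod_mono_right (subset_univ K))
  set B := (Icc 0 t₁ ×ˢ K) ∩ Z ⁻¹' Iic 0 with hB
  have hBc : IsCompact B := (isCompact_Icc.prod hK).of_isClosed_subset
    (hcK.preimage_isClosed_of_isClosed (isCompact_Icc.prod hK).isClosed isClosed_Iic)
    inter_subset_left
  have hBn : ∀ t ∈ Icc 0 t₁, ∀ x, Z (t, x) ≤ 0 → ∃ y, (t, y) ∈ B := by
    intro t ht x hx
    obtain ⟨γ, hγ⟩ := hKM x
    exact ⟨M.deck γ x, ⟨ht, hγ⟩, by rw [mem_preimage, hinv t ht]; exact hx⟩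
  obtain ⟨t₂, ht₂, x₂, hx₂⟩ := hn
  obtain ⟨y₂, hy₂⟩ := hBn t₂ ht₂ x₂ hx₂
  obtain ⟨⟨t, x⟩, htx, hmin⟩ := hBc.exists_isMinOn ⟨_, hy₂⟩ continuous_fst.continuousOn
  have ht : t ∈ Icc 0 t₁ := htx.1.1
  have hZ : Z (t, x) ≤ 0 := htx.2
  have hbefore : ∀ s ∈ Ico 0 t, ∀ y, 0 < Z (s, y) := by
    intro s hs y
    by_contra! hle
    obtain ⟨z, hz⟩ := hBn s ⟨hs.1, hs.2.le.trans ht.2⟩ y hle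
    exact absurd (hmin hz) (not_le.2 hs.2)
  have ht0 : 0 < t := by
    rcases ht.1.eq_or_lt with h | h
    · rw [← h] at hZ
      exact absurd (h0 x) (not_lt.2 hZ)
    · exact h
  have hafter : ∀ y, 0 ≤ Z (t, y) := by
    intro y
    have hcy : ContinuousWithinAt (fun s => Z (s, y)) (Icc 0 t₁) t :=
      (hc (t, y) ⟨ht, mem_univ y⟩).comp (f := fun s => (s, y))
        (continuous_id.prodMk continuous_const).continuousWithinAt fun s hs => ⟨hs, mem_univ y⟩
    have hcy' : Tendsto (fun s => Z (s, y)) (𝓝[Ico 0 t] t) (𝓝 (Z (t, y))) :=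
      hcy.mono fun s hs => ⟨hs.1, hs.2.le.trans ht.2⟩
    have : (𝓝[Ico 0 t] t).NeBot := by
      rw [← mem_closure_iff_nhdsWithin_neBot, closure_Ico ht0.ne]
      exact right_mem_Icc.2 ht0.le
    exact ge_of_tendsto hcy' (eventually_nhdsWithin_of_forall fun s hs => (hbefore s hs y).le)
  exact ⟨t, ⟨ht0, ht.2⟩, x, le_antisymm hZ (hafter x), hbefore, hafter⟩

/-- First and second order conditions at a first contact point. -/
lemma contact_derivatives {Z : ℝ × Plane → ℝ} {t : ℝ} {x : Plane} (ht : 0 < t)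
    (hZ : ∀ᶠ q in 𝓝 (t, x), ContDiffAt ℝ ∞ Z q) (h0 : Z (t, x) = 0)
    (hbefore : ∀ s ∈ Ico 0 t, 0 < Z (s, x)) (hafter : ∀ y, 0 ≤ Z (t, y)) :
    dd ((1 : ℝ), (0 : Plane)) Z (t, x) ≤ 0 ∧ ∀ v : Plane, dd ((0 : ℝ), v) Z (t, x) = 0
      ∧ 0 ≤ dd ((0 : ℝ), v) (dd ((0 : ℝ), v) Z) (t, x) := by
  have hZx := hZ.self_of_nhds
  constructor
  · have hd : HasDerivAt (fun s => Z (s, x)) (dd ((1 : ℝ), (0 : Plane)) Z (t, x)) t :=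
      hZx.diffAt.hasFDerivAt.comp_hasDerivAt t ((hasDerivAt_id t).prodMk (hasDerivAt_const t x))
    have hs := hd.tendsto_slope.mono_left (nhdsWithin_mono t
      (fun s (hs : s ∈ Ioo 0 t) => (ne_of_lt hs.2 : s ≠ t)))
    have : (𝓝[Ioo 0 t] t).NeBot := by
      rw [← mem_closure_iff_nhdsWithin_neBot, closure_Ioo ht.ne]
      exact right_mem_Icc.2 ht.le
    refine le_of_tendsto hs (eventually_nhdsWithin_of_forall fun s hs => ?_)
    rw [slope_def_field, h0, sub_zero]
    exact div_nonpos_of_nonneg_of_nonpos (hbefore s ⟨hs.1.le, hs.2⟩).le (by linarith [hs.2])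
  · have hp : ContDiff ℝ ∞ (fun y : Plane => (t, y)) := contDiff_prodMk_right t
    have hpt : Tendsto (fun y : Plane => (t, y)) (𝓝 x) (𝓝 (t, x)) := hp.continuous.tendsto x
    have hmin : IsLocalMin (fun y => Z (t, y)) x :=
      Eventually.of_forall fun y => h0.trans_le (hafter y)
    have hs : ContDiffAt ℝ ∞ (fun y => Z (t, y)) x := hZx.comp x hp.contDiffAt
    have e1 : ∀ v : Plane, dd v (fun y => Z (t, y)) =ᶠ[𝓝 x] fun y => dd ((0 : ℝ), v) Z (t, y) :=
      fun v => (hpt.eventually hZ).mono fun y hy => IsMMCF.dd_slice_of_differentiableAt hy.diffAt v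
    intro v
    constructor
    · refine (e1 v).self_of_nhds.symm.trans ?_
      rw [dd, hmin.fderiv_eq_zero]
      rfl
    · have := hmin.dd_dd_nonneg hs v
      rwa [(e1 v).dd_eq, IsMMCF.dd_slice_of_differentiableAt (hZx.dd _).diffAt] at this

end AlmostFuchsian

namespace AlmostFuchsian.IsMMCF

variable {M : AlmostFuchsian} {c T : ℝ} {F ν : ℝ → Plane → Minkowski} (h : M.IsMMCF c T F ν)
include h

lemma mem {t : ℝ} (ht : t ∈ Ico 0 T) (x : Plane) : F t x ∈ Hyp3 := (h.surface t ht x).mem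

lemma height_deck {t : ℝ} (ht : t ∈ Ico 0 T) (γ : M.Γ) (x : Plane) :
    mink (F t (M.deck γ x)) (M.footNormal (F t (M.deck γ x)))
      = mink (F t x) (M.footNormal (F t x)) := by
  rw [h.equivariant t ht, footNormal_equivariant (h.mem ht x), (M.isometry γ γ.2).mink_map]

/-- The normal is equivariant up to sign. -/
lemma normal_deck_sign {t : ℝ} (ht : t ∈ Ico 0 T) (γ : M.Γ) (x : Plane) :
    (γ : Minkowski ≃ₗ[ℝ] Minkowski) (ν t x)
      = mink ((γ : Minkowski ≃ₗ[ℝ] Minkowski) (ν t x)) (ν t (M.deck γ x)) • ν t (M.deck γ x) := by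
  have hs := h.isSurface ht
  obtain ⟨w, hw⟩ := hs.exists_frame x
  have hγ := M.isometry γ γ.2
  have e : ∀ p, dd (dd (w p) (M.deck γ) x) (F t) (M.deck γ x)
      = (γ : Minkowski ≃ₗ[ℝ] Minkowski) (dd (w p) (F t) x) := by
    intro p
    have h1 := dd_comp (A := F t) (u := M.deck γ) (hs.smooth.diffAt _)
      ((M.deck_smooth γ).diffAt x) (w p)
    rw [← h1, show (fun y => F t (M.deck γ y))
      = fun y => (γ : Minkowski ≃ₗ[ℝ] Minkowski) (F t y) from funext (h.equivariant t ht γ)]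
    exact dd_clm ((γ : Minkowski ≃ₗ[ℝ] Minkowski).toContinuousLinearEquiv : Minkowski →L[ℝ] Minkowski)
      (hs.smooth.diffAt x) (w p)
  have hw' : IsTangentFrame (F t) (M.deck γ x) (fun p => dd (w p) (M.deck γ) x) := by
    intro p q
    rw [e, e, hγ.mink_map]
    exact hw p q
  have hL := (hs.lorentzFrame hw').expand ((γ : Minkowski ≃ₗ[ℝ] Minkowski) (ν t x))
  rw [e, e, h.equivariant t ht, hγ.mink_map, hγ.mink_map, hγ.mink_map,
    (hs.surface x).normal_tangent, hs.mink_normal_dd, hs.mink_normal_dd] at hL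
  simpa using hL

lemma normal_equivariant {r : ℝ} (hν₀ : ∀ x, ν 0 x = M.normalExpVelocity x r) {t : ℝ}
    (ht : t ∈ Ico 0 T) (γ : M.Γ) (x : Plane) :
    ν t (M.deck γ x) = (γ : Minkowski ≃ₗ[ℝ] Minkowski) (ν t x) := by
  have hγ := M.isometry γ γ.2
  have hsec : ∀ y, ContinuousOn (fun s => ν s y) (Ico 0 T) := fun y =>
    h.normal_continuous.comp (f := fun s : ℝ => (s, y))
      (continuous_id.prodMk continuous_const).continuousOn fun s hs => ⟨hs, mem_univ y⟩
  have hcont : ContinuousOn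
      (fun s => mink ((γ : Minkowski ≃ₗ[ℝ] Minkowski) (ν s x)) (ν s (M.deck γ x))) (Ico 0 T) :=
    continuous_mink.comp_continuousOn
      ((((γ : Minkowski ≃ₗ[ℝ] Minkowski).toContinuousLinearEquiv.continuous).comp_continuousOn
        (hsec x)).prodMk (hsec _))
  have hsq : ∀ s ∈ Ico 0 T,
      mink ((γ : Minkowski ≃ₗ[ℝ] Minkowski) (ν s x)) (ν s (M.deck γ x)) ^ 2 = 1 := by
    intro s hs
    have h1 := congrArg (fun V => mink V V) (h.normal_deck_sign hs γ x)
    simp only [mink_smul_left, mink_smul_right, hγ.mink_map, (h.surface s hs _).normal_unit] at h1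
    linarith
  have h0T : (0 : ℝ) ∈ Ico 0 T := ⟨le_rfl, ht.1.trans_lt ht.2⟩
  have h0 : mink ((γ : Minkowski ≃ₗ[ℝ] Minkowski) (ν 0 x)) (ν 0 (M.deck γ x)) = 1 := by
    have : ν 0 (M.deck γ x) = (γ : Minkowski ≃ₗ[ℝ] Minkowski) (ν 0 x) := by
      rw [hν₀, hν₀, normalExpVelocity, normalExpVelocity, M.f_equivariant, M.n_equivariant,
        map_add, map_smul, map_smul]
    rw [this, hγ.mink_map, (h.surface 0 h0T x).normal_unit]
  have := isPreconnected_Ico.eq_of_sq_eq hcont (continuousOn_const (c := (1 : ℝ)))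
    (fun s hs => by simpa using hsq s hs) (fun _ => one_ne_zero) h0T h0 ht
  have hx := h.normal_deck_sign ht γ x
  simp only at this
  rw [this, one_smul] at hx
  exact hx.symm

lemma angle_deck {r : ℝ} (hν₀ : ∀ x, ν 0 x = M.normalExpVelocity x r) {t : ℝ}
    (ht : t ∈ Ico 0 T) (γ : M.Γ) (x : Plane) :
    mink (ν t (M.deck γ x)) (M.footNormal (F t (M.deck γ x)))
      = mink (ν t x) (M.footNormal (F t x)) := by
  rw [h.equivariant t ht, h.normal_equivariant hν₀ ht, footNormal_equivariant (h.mem ht x),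
    (M.isometry γ γ.2).mink_map]

lemma continuousOn_footNormal : ContinuousOn (fun q : ℝ × Plane => M.footNormal (F q.1 q.2))
    (Ico 0 T ×ˢ univ) := fun q hq =>
  (contDiffAt_footNormal (Hyp3_subset_futureCone (h.mem hq.1 q.2))).continuousAt.comp_continuousWithinAt
    (f := fun q : ℝ × Plane => F q.1 q.2) (h.smooth.continuousOn q hq)

lemma continuousOn_height : ContinuousOn
    (fun q : ℝ × Plane => mink (F q.1 q.2) (M.footNormal (F q.1 q.2))) (Ico 0 T ×ˢ univ) :=
  continuous_mink.comp_continuousOn (h.smooth.continuousOn.prodMk h.continuousOn_footNormal)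

lemma continuousOn_angle : ContinuousOn
    (fun q : ℝ × Plane => mink (ν q.1 q.2) (M.footNormal (F q.1 q.2))) (Ico 0 T ×ˢ univ) :=
  continuous_mink.comp_continuousOn (h.normal_continuous.prodMk h.continuousOn_footNormal)

/-- Evolution of the height at a spatial critical point where the angle is positive. There the surface
is tangent to a leaf of the foliation, and `2 s + E` is the mean curvature of the leaf times `cosh r`;
here `l` is the square of the principal curvatures of the minimal surface at the foot point. -/
lemma height_at_critical {t : ℝ} (ht : t ∈ Ioo 0 T) (x : Plane)
    (hcrit : ∀ v : Plane, dd ((0 : ℝ), v)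
      (fun q : ℝ × Plane => mink (F q.1 q.2) (M.footNormal (F q.1 q.2))) (t, x) = 0)
    (hp : 0 < mink (ν t x) (M.footNormal (F t x))) :
    ∃ (w : Fin 2 → Plane) (l E : ℝ), 0 ≤ l ∧ l < 1 ∧ l ≤ M.lambdaMax ^ 2 ∧
      (1 + (1 - l) * mink (F t x) (M.footNormal (F t x)) ^ 2) * E
        = -2 * mink (F t x) (M.footNormal (F t x)) * l ∧
      dd ((1 : ℝ), (0 : Plane))
        (fun q : ℝ × Plane => mink (F q.1 q.2) (M.footNormal (F q.1 q.2))) (t, x)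
        = (∑ a, dd ((0 : ℝ), w a) (dd ((0 : ℝ), w a)
            (fun q : ℝ × Plane => mink (F q.1 q.2) (M.footNormal (F q.1 q.2)))) (t, x))
          + c * Real.sqrt (1 + mink (F t x) (M.footNormal (F t x)) ^ 2)
          - 2 * mink (F t x) (M.footNormal (F t x)) - E := by
  have hs := h.isSurface (Ioo_subset_Ico_self ht)
  obtain ⟨w, hw⟩ := hs.exists_frame x
  have hx : (t, x) ∈ Ioo 0 T ×ˢ (univ : Set Plane) := ⟨ht, mem_univ x⟩
  have hflow := h.isNormalFlow w
  have hw' : ∀ a b, mink (dd ((0 : ℝ), w a) (fun q : ℝ × Plane => F q.1 q.2) (t, x))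
      (dd ((0 : ℝ), w b) (fun q : ℝ × Plane => F q.1 q.2) (t, x)) = if a = b then 1 else 0 := by
    intro a b
    rw [← h.dd_slice ht, ← h.dd_slice ht]
    exact hw a b
  have hP : F t x ∈ Hyp3 := (hs.surface x).mem
  obtain ⟨z, hz⟩ := M.isSurface.exists_frame (M.foot (F t x))
  have hgrad := hflow.grad_height_sq (M := M) hx hw'
  have hlap := hflow.laplacian_height (M := M) hx hw'
  have htime := hflow.dd_height_time (M := M) hx
  have hd := fun a => (hflow.dd_height (M := M) hx ((0 : ℝ), w a)).symm.trans (hcrit (w a))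
  have htr := trace_dd_footNormal hP hz (hflow.lorentzFrame hx hw') (hd 0) (hd 1)
  rw [cosh_sq_eq hP] at htr
  simp only [hcrit, Fin.sum_univ_two] at hgrad hlap
  have hpC : mink (ν t x) (M.footNormal (F t x))
      = Real.sqrt (1 + mink (F t x) (M.footNormal (F t x)) ^ 2) := by
    rw [eq_comm, Real.sqrt_eq_iff_mul_self_eq_of_pos hp]
    linarith
  set a₀ := dd ((0 : ℝ), w 0) (fun q : ℝ × Plane => F q.1 q.2) (t, x)
  set a₁ := dd ((0 : ℝ), w 1) (fun q : ℝ × Plane => F q.1 q.2) (t, x)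
  refine ⟨w, sff M.f M.n (M.foot (F t x)) (z 0) (z 0) ^ 2
    + sff M.f M.n (M.foot (F t x)) (z 0) (z 1) ^ 2, mink (dd a₀ M.footNormal (F t x)) a₀
      + mink (dd a₁ M.footNormal (F t x)) a₁, by positivity, sff_sq_lt_one hz,
    sff_sq_le_lambdaMax_sq hz, ?_, ?_⟩
  · linear_combination htr
  · rw [htime, ← hpC, Fin.sum_univ_two, hlap]
    ring

end AlmostFuchsian.IsMMCF

/-! ### The barrier function -/

/-- Completing the square in the second fundamental form. -/
lemma neg_sq_div_le {p n b : ℝ} (hp : 0 < p) : -(b ^ 2 / p) ≤ n ^ 2 * p + 2 * n * b := by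
  have : n ^ 2 * p + 2 * n * b + b ^ 2 / p = (n * p + b) ^ 2 / p := by
    field_simp; ring
  have h2 : 0 ≤ (n * p + b) ^ 2 / p := by positivity
  linarith

/-- The gain in the evolution inequality, in the variables `t = tanh r` and `d = δ / cosh³ r`. -/
lemma barrier_gain_normalized {c t d : ℝ} (ht : 0 ≤ t) (hct : c ≤ 2 * t)
    (hd : 0 ≤ d) (hdt : d ≤ (1 - t ^ 2) / 15) :
    11 / 10 * d * (1 - t ^ 2) ≤ -2 * t ^ 2 / (1 - d) + c * t
      - t * (1 + 2 * d) * (c * (1 - d) - 2 * t)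
      + (1 - t ^ 2 + 2 * d - 8 * d * t ^ 2) * (2 * d - d ^ 2) := by
  have hd15 : d ≤ 1 / 15 := by nlinarith [sq_nonneg t]
  have h1d : 0 < 1 - d := by linarith
  have e : -2 * t ^ 2 / (1 - d) + 2 * t ^ 2 * (1 + 2 * d)
      = 2 * t ^ 2 * (d * (1 - 2 * d)) / (1 - d) := by
    field_simp; ring
  have h2d : 0 ≤ d * (1 - 2 * d) := mul_nonneg hd (by linarith)
  have e2 : 2 * t ^ 2 * (d * (1 - 2 * d)) ≤ 2 * t ^ 2 * (d * (1 - 2 * d)) / (1 - d) := by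
    rw [le_div_iff₀ h1d]
    exact mul_le_of_le_one_right (by positivity) (by linarith)
  have e3 : c * t * (d * (1 - 2 * d)) ≤ 2 * t ^ 2 * (d * (1 - 2 * d)) := by
    refine mul_le_mul_of_nonneg_right ?_ h2d
    nlinarith
  have e4 : 11 / 10 * d * (1 - t ^ 2)
      ≤ (1 - t ^ 2 + 2 * d - 8 * d * t ^ 2) * (2 * d - d ^ 2) := by
    have t2 : t ^ 2 ≤ 1 := by nlinarith
    have h1 : 9 / 15 * (1 - t ^ 2) ≤ 1 - t ^ 2 + 2 * d - 8 * d * t ^ 2 := by nlinarith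
    have h2 : 29 / 15 * d ≤ 2 * d - d ^ 2 := by nlinarith
    have h3 : 0 ≤ 9 / 15 * (1 - t ^ 2) := by linarith
    calc 11 / 10 * d * (1 - t ^ 2) ≤ 9 / 15 * (1 - t ^ 2) * (29 / 15 * d) := by nlinarith
      _ ≤ _ := mul_le_mul h1 h2 (by positivity) (h3.trans h1)
  linarith

/-- The terms of the evolution inequality at a contact which do not involve the curvature of the
minimal surface. -/
lemma barrier_gain {C s c δ p g₁ g₂ : ℝ} (hC : 1 ≤ C) (hCs : C ^ 2 = 1 + s ^ 2) (hs : 0 ≤ s)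
    (hc : 0 ≤ c) (hcs : c * C ≤ 2 * s) (hδ : 0 ≤ δ) (hδ1 : δ ≤ 1 / 15) (hp : p = C - δ / C ^ 2)
    (hg₁ : g₁ = s / C + 2 * δ * s / C ^ 4)
    (hg₂ : g₂ = 1 / C ^ 3 + 2 * δ / C ^ 4 - 8 * δ * s ^ 2 / C ^ 6) :
    11 / 10 * δ / C ^ 4 ≤ -2 * s ^ 2 / p + c * s - g₁ * (c * p - 2 * s)
      + g₂ * (C ^ 2 - p ^ 2) := by
  have hC0 : 0 < C := by linarith
  obtain ⟨t, rfl⟩ : ∃ t, s = C * t := ⟨s / C, by field_simp⟩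
  obtain ⟨d, rfl⟩ : ∃ d, δ = C ^ 3 * d := ⟨δ / C ^ 3, by field_simp⟩
  have hC2 : C ^ 2 * (1 - t ^ 2) = 1 := by linear_combination hCs
  have ht : 0 ≤ t := nonneg_of_mul_nonneg_right hs hC0
  have hd : 0 ≤ d := nonneg_of_mul_nonneg_right hδ (by positivity)
  have ht1 : t < 1 := by
    by_contra! h
    have : C ^ 2 * (1 - t ^ 2) ≤ 0 :=
      mul_nonpos_of_nonneg_of_nonpos (sq_nonneg C) (by nlinarith)
    linarith
  have hct : c ≤ 2 * t := by
    have : C * c ≤ C * (2 * t) := by linarith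
    exact le_of_mul_le_mul_left this hC0
  have hdt : d ≤ (1 - t ^ 2) / 15 := by
    have h1 : C ^ 2 * d ≤ C ^ 3 * d := by
      refine mul_le_mul_of_nonneg_right ?_ hd
      nlinarith [sq_nonneg C]
    have h2 : C ^ 2 * d ≤ C ^ 2 * ((1 - t ^ 2) / 15) := by linarith
    exact le_of_mul_le_mul_left h2 (by positivity)
  have h1d : 0 < 1 - d := by nlinarith [sq_nonneg t]
  have key := barrier_gain_normalized ht hct hd hdt
  have hp' : p = C * (1 - d) := by rw [hp]; field_simp
  have hg₁' : g₁ = t * (1 + 2 * d) := by rw [hg₁]; field_simp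
  have hg₂' : C * g₂ = 1 - t ^ 2 + 2 * d - 8 * d * t ^ 2 := by
    have h3 : 1 / C ^ 3 = (1 - t ^ 2) / C := by
      rw [div_eq_div_iff (by positivity) hC0.ne']
      linear_combination (-C) * hC2
    rw [hg₂, h3]; field_simp
  have hlhs : 11 / 10 * (C ^ 3 * d) / C ^ 4 = C * (11 / 10 * d * (1 - t ^ 2)) := by
    have : 1 / C = C * (1 - t ^ 2) := by
      rw [div_eq_iff hC0.ne']; linear_combination (-1 : ℝ) * hC2
    calc 11 / 10 * (C ^ 3 * d) / C ^ 4 = 11 / 10 * d * (1 / C) := by field_simp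
      _ = _ := by rw [this]; ring
  have hdiv : -2 * (C * t) ^ 2 / p = C * (-2 * t ^ 2 / (1 - d)) := by
    rw [hp']; field_simp
  rw [hlhs, hdiv, hg₁', hp']
  have := mul_le_mul_of_nonneg_left key hC0.le
  refine this.trans_eq ?_
  linear_combination (-C * (2 * d - d ^ 2)) * hg₂'

/-- At a first contact of the angle with the barrier, the evolution inequality is violated. The
numbers `nᵢⱼ`, `Eᵢⱼ` stand for the components of the second fundamental form and of the derivative
of the normal of the minimal surface, and `g₁`, `g₂` are the derivatives of the barrier with respect
to `s`. The terms without `E`, `D`, `B` are at least `1.1 δ / C⁴` after completing squares, and the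
others at most `80 ε / C`. -/
lemma barrier_strict {C s c δ p g₁ g₂ ε n₀₀ n₀₁ n₁₁ E₀₀ E₀₁ E₁₀ E₁₁ D₀ D₁ B : ℝ}
    (hC : 1 ≤ C) (hCs : C ^ 2 = 1 + s ^ 2) (hs : 0 ≤ s)
    (hc : 0 ≤ c) (hc2 : c ≤ 2) (hcs : c * C ≤ 2 * s) (hδ : 0 ≤ δ) (hδ1 : δ ≤ 1 / 15)
    (hp : p = C - δ / C ^ 2) (hg₁ : g₁ = s / C + 2 * δ * s / C ^ 4)
    (hg₂ : g₂ = 1 / C ^ 3 + 2 * δ / C ^ 4 - 8 * δ * s ^ 2 / C ^ 6)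
    (hε0 : 0 ≤ ε) (hε : ε ≤ 1 / 1000) (hδε : 80 * ε * C ^ 3 < 11 / 10 * δ)
    (h00 : C * |E₀₀| ≤ 4.02 * ε) (h01 : C * |E₀₁| ≤ 4.02 * ε) (h10 : C * |E₁₀| ≤ 4.02 * ε)
    (h11 : C * |E₁₁| ≤ 4.02 * ε) (hB : C * |B| ≤ 4.02 * ε) (h0 : C * |D₀| ≤ 21 * ε)
    (h1 : C * |D₁| ≤ 21 * ε) :
    0 < (n₀₀ ^ 2 + n₀₁ ^ 2 + (n₀₁ ^ 2 + n₁₁ ^ 2)) * p + 2 * (n₀₀ + n₁₁) * s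
      + 2 * (n₀₀ * E₀₀ + n₀₁ * E₀₁ + (n₀₁ * E₁₀ + n₁₁ * E₁₁)) + c * s + c * B - (D₀ + D₁)
      - g₁ * (c * p - 2 * s - (E₀₀ + E₁₁)) + g₂ * (C ^ 2 - p ^ 2) := by
  have gain := barrier_gain hC hCs hs hc hcs hδ hδ1 hp hg₁ hg₂
  have hC0 : 0 < C := by linarith
  have hsC : s ≤ C := by nlinarith
  have hδC : δ / C ^ 2 ≤ C / 15 := by
    rw [div_le_iff₀ (by positivity)]
    nlinarith [one_le_pow₀ hC (n := 3)]
  have hpC : 14 / 15 * C ≤ p := by linarith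
  have hp0 : 0 < p := by linarith
  have hg₁0 : 0 ≤ g₁ := by rw [hg₁]; positivity
  have hg₁1 : g₁ ≤ 17 / 15 := by
    have a1 : s / C ≤ 1 := by rw [div_le_one hC0]; exact hsC
    have a2 : 2 * δ * s / C ^ 4 ≤ 2 / 15 := by
      rw [div_le_iff₀ (by positivity)]
      have b1 : s ≤ C ^ 4 := hsC.trans (by simpa using pow_le_pow_right₀ hC (show 1 ≤ 4 by norm_num))
      nlinarith
    linarith
  have abs_le' : ∀ {E k : ℝ}, C * |E| ≤ k * ε → |E| ≤ k * (ε / C) := by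
    intro E k hE
    rw [← mul_div_assoc, le_div_iff₀ hC0]
    linarith
  set η := ε / C with hη
  have hη0 : 0 ≤ η := by positivity
  have hη1 : η ≤ 1 / 1000 := by
    rw [hη, div_le_iff₀ hC0]; linarith
  have a00 := abs_le' h00
  have a01 := abs_le' h01
  have a10 := abs_le' h10
  have a11 := abs_le' h11
  have aB := abs_le' hB
  have a0 := abs_le' h0
  have a1 := abs_le' h1
  -- only the linear terms `2 s Eᵢᵢ / p` of the completed squares are of first order in `ε`
  have q00 := neg_sq_div_le (n := n₀₀) (b := s + E₀₀) hp0
  have q01 := neg_sq_div_le (n := n₀₁) (b := E₀₁) hp0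
  have q10 := neg_sq_div_le (n := n₀₁) (b := E₁₀) hp0
  have q11 := neg_sq_div_le (n := n₁₁) (b := s + E₁₁) hp0
  have sqb : ∀ {E : ℝ}, |E| ≤ 4.02 * η → E ^ 2 / p ≤ 18 / 1000 * η := by
    intro E hE
    rw [div_le_iff₀ hp0]
    have e1 : E ^ 2 ≤ (4.02 * η) ^ 2 := sq_le_sq' (abs_le.1 hE).1 (abs_le.1 hE).2
    have e2 : η * η ≤ η * (1 / 1000) := mul_le_mul_of_nonneg_left hη1 hη0
    have e3 : η * (14 / 15) ≤ η * p := mul_le_mul_of_nonneg_left (by linarith) hη0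
    linarith
  have lin : ∀ {E : ℝ}, |E| ≤ 4.02 * η → 2 * s * E / p ≤ 8.62 * η := by
    intro E hE
    rw [div_le_iff₀ hp0]
    have h2 : s * E ≤ C * (4.02 * η) :=
      (le_abs_self _).trans (by rw [abs_mul, abs_of_nonneg hs]; gcongr)
    have e3 : η * (14 / 15 * C) ≤ η * p := mul_le_mul_of_nonneg_left hpC hη0
    have e4 : 0 ≤ η * C := by positivity
    linarith
  have x00 : (s + E₀₀) ^ 2 / p = s ^ 2 / p + 2 * s * E₀₀ / p + E₀₀ ^ 2 / p := by ring
  have x11 : (s + E₁₁) ^ 2 / p = s ^ 2 / p + 2 * s * E₁₁ / p + E₁₁ ^ 2 / p := by ring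
  have xs : -2 * s ^ 2 / p = -(s ^ 2 / p) - s ^ 2 / p := by ring
  have cB : -(2 * (4.02 * η)) ≤ c * B := by
    have : |c * B| ≤ 2 * (4.02 * η) := by rw [abs_mul, abs_of_nonneg hc]; gcongr
    exact (abs_le.1 this).1
  have gE : -(17 / 15 * (2 * (4.02 * η))) ≤ g₁ * (E₀₀ + E₁₁) := by
    have : |g₁ * (E₀₀ + E₁₁)| ≤ 17 / 15 * (2 * (4.02 * η)) := by
      rw [abs_mul, abs_of_nonneg hg₁0]
      gcongr
      exact (abs_add_le _ _).trans (by linarith)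
    exact (abs_le.1 this).1
  have fin : 80 * η < 11 / 10 * δ / C ^ 4 := by
    rw [lt_div_iff₀ (by positivity), hη]
    calc 80 * (ε / C) * C ^ 4 = 80 * ε * C ^ 3 := by field_simp
      _ < _ := hδε
  have l00 := lin a00
  have l11 := lin a11
  have s00 := sqb a00
  have s01 := sqb a01
  have s10 := sqb a10
  have s11 := sqb a11
  have d0 := (abs_le.1 a0).2
  have d1 := (abs_le.1 a1).2
  rw [x00] at q00
  rw [x11] at q11
  rw [xs] at gain
  linarith

/-- Above the leaf with `tanh r = c / (2 - (2 - c² / 2) λ²)` for `λ = λ_max`,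
the mean curvature of a leaf is at least `c`, so that its height does not increase. -/
lemma upper_barrier {c s C l L : ℝ} (hC : 0 < C) (hCs : C ^ 2 = 1 + s ^ 2) (hc : 0 ≤ c) (hc2 : c < 2)
    (hl : 0 ≤ l) (hl1 : l < 1) (hlL : l ≤ L) (hL : 2 * L < 2 - c)
    (hs : c / (2 - (2 - c ^ 2 / 2) * L) * C ≤ s) {E : ℝ}
    (hE : (1 + (1 - l) * s ^ 2) * E = -2 * s * l) : c * C - 2 * s - E ≤ 0 := by
  have hden : 0 < 2 - (2 - c ^ 2 / 2) * L := by nlinarith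
  set T := c / (2 - (2 - c ^ 2 / 2) * L) with hT
  have hTe : T * (2 - (2 - c ^ 2 / 2) * L) = c := div_mul_cancel₀ _ hden.ne'
  have hT0 : 0 ≤ T := by positivity
  have hcT : c ≤ 2 * T := by
    have : 0 ≤ T * ((2 - c ^ 2 / 2) * L) := by
      have : 0 ≤ 2 - c ^ 2 / 2 := by nlinarith
      have hL0 : 0 ≤ L := hl.trans hlL
      positivity
    linarith
  obtain ⟨t, rfl⟩ : ∃ t, s = C * t := ⟨s / C, by field_simp⟩
  have hTt : T ≤ t := by
    rw [mul_comm] at hs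
    exact le_of_mul_le_mul_left hs hC
  have ht0 := hT0.trans hTt
  have hC2 : C ^ 2 * (1 - t ^ 2) = 1 := by linear_combination hCs
  have ht1 : t < 1 := by
    by_contra! h
    have : C ^ 2 * (1 - t ^ 2) ≤ 0 :=
      mul_nonpos_of_nonneg_of_nonpos (sq_nonneg C) (by nlinarith)
    linarith
  have hpos : 0 < 1 + (1 - l) * (C * t) ^ 2 := by
    have : 0 < 1 - l := by linarith
    positivity
  have key : c * (1 - l * t ^ 2) ≤ 2 * t * (1 - l) := by
    have k1 : c * (1 - L * T ^ 2) ≤ 2 * T * (1 - L) := by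
      have hL0 : 0 ≤ L := hl.trans hlL
      have : 0 ≤ c * L * T * (T - c / 2) := by
        have : 0 ≤ T - c / 2 := by linarith
        positivity
      nlinarith
    have k2 : 2 * T * (1 - l) - c * (1 - l * T ^ 2)
        = (2 * T * (1 - L) - c * (1 - L * T ^ 2)) + (L - l) * (T * (2 - c * T)) := by ring
    have hcT2 : 0 ≤ 2 - c * T := by nlinarith
    have k3 : 0 ≤ (L - l) * (T * (2 - c * T)) :=
      mul_nonneg (by linarith) (mul_nonneg hT0 hcT2)
    have k4 : 0 ≤ c * l * (t ^ 2 - T ^ 2) :=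
      mul_nonneg (mul_nonneg hc hl) (by nlinarith)
    nlinarith
  have hmul : (1 + (1 - l) * (C * t) ^ 2) * (c * C - 2 * (C * t) - E)
      = C ^ 3 * (c * (1 - l * t ^ 2) - 2 * t * (1 - l)) := by
    have e1 : 1 + (1 - l) * (C * t) ^ 2 = C ^ 2 * (1 - l * t ^ 2) := by linear_combination hCs * (-1 : ℝ)
    have e2 : C ^ 2 * t ^ 2 = C ^ 2 - 1 := by linear_combination (-1 : ℝ) * hC2
    rw [mul_sub, hE, e1]
    linear_combination (-2 * C * t * l) * hC2
  by_contra! hcon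
  have h1 := mul_pos hpos hcon
  rw [hmul] at h1
  have h2 : C ^ 3 * (c * (1 - l * t ^ 2) - 2 * t * (1 - l)) ≤ 0 :=
    mul_nonpos_of_nonneg_of_nonpos (by positivity) (by linarith)
  linarith

/-- Below the leaf with `2 tanh r = c`, the height of a leaf increases. -/
lemma lower_barrier {c s C l : ℝ} (hC : 0 < C) (hc : 0 ≤ c)
    (hl : 0 ≤ l) (hl1 : l < 1) (hs : 2 * s < c * C) {E : ℝ}
    (hE : (1 + (1 - l) * s ^ 2) * E = -2 * s * l) : 0 < c * C - 2 * s - E := by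
  have h1l : 0 < 1 - l := by linarith
  have hpos : 0 < 1 + (1 - l) * s ^ 2 := by positivity
  rcases lt_or_ge s 0 with h | h
  · have : (1 + (1 - l) * s ^ 2) * (-2 * s - E) = -2 * s * ((1 - l) * (1 + s ^ 2)) := by
      rw [mul_sub, hE]; ring
    have h2 : 0 < (1 + (1 - l) * s ^ 2) * (-2 * s - E) := by
      rw [this]
      have : 0 < -2 * s := by linarith
      positivity
    have h3 : 0 < -2 * s - E := (mul_pos_iff_of_pos_left hpos).1 h2
    have : 0 ≤ c * C := by positivity
    linarith
  · have : E ≤ 0 := by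
      by_contra! hE0
      have h1 := mul_pos hpos hE0
      have : 0 ≤ s * l := by positivity
      linarith
    linarith

/-! ### Height barriers -/

/-- For `s = sinh r`, the condition `c ≤ 2 tanh r` says that `s` is at least `c / √(4 - c²)`. -/
lemma mul_sqrt_le_iff {c s : ℝ} (hc : 0 ≤ c) (hc2 : c < 2) :
    c * Real.sqrt (1 + s ^ 2) ≤ 2 * s ↔ c / Real.sqrt (4 - c ^ 2) ≤ s := by
  have h4 : 0 < 4 - c ^ 2 := by nlinarith
  have hq := Real.sqrt_pos.2 h4
  have hq2 : Real.sqrt (4 - c ^ 2) ^ 2 = 4 - c ^ 2 := Real.sq_sqrt h4.le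
  have hC : 0 < Real.sqrt (1 + s ^ 2) := Real.sqrt_pos.2 (by positivity)
  have hC2 : Real.sqrt (1 + s ^ 2) ^ 2 = 1 + s ^ 2 := Real.sq_sqrt (by positivity)
  rw [div_le_iff₀ hq]
  constructor
  · intro h
    have hs : 0 ≤ s := by nlinarith [mul_nonneg hc hC.le]
    refine le_of_pow_le_pow_left₀ two_ne_zero (by positivity) ?_
    have := pow_le_pow_left₀ (by positivity) h 2
    rw [mul_pow, hC2] at this
    rw [mul_pow, hq2]
    linarith
  · intro h
    have hs : 0 ≤ s := nonneg_of_mul_nonneg_left (hc.trans h) hq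
    refine le_of_pow_le_pow_left₀ two_ne_zero (by positivity) ?_
    have := pow_le_pow_left₀ hc h 2
    rw [mul_pow, hq2] at this
    rw [mul_pow, hC2]
    linarith

namespace AlmostFuchsian.IsMMCF

variable {M : AlmostFuchsian} {c T : ℝ} {F ν : ℝ → Plane → Minkowski} (h : M.IsMMCF c T F ν)
include h

lemma contDiffAt_height {q : ℝ × Plane} (hq : q ∈ Ioo 0 T ×ˢ (univ : Set Plane)) :
    ContDiffAt ℝ ∞ (fun q : ℝ × Plane => mink (F q.1 q.2) (M.footNormal (F q.1 q.2))) q :=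
  (h.contDiffAt hq).mink ((h.isNormalFlow 0).smooth_footNormal hq)

lemma contDiffAt_angle {q : ℝ × Plane} (hq : q ∈ Ioo 0 T ×ˢ (univ : Set Plane)) :
    ContDiffAt ℝ ∞ (fun q : ℝ × Plane => mink (ν q.1 q.2) (M.footNormal (F q.1 q.2))) q :=
  (h.contDiffAt_normal hq).mink ((h.isNormalFlow 0).smooth_footNormal hq)

/-- As long as the surface is a graph, it stays above the leaf with `2 tanh r = c`. -/
lemma height_lower (hc : 0 ≤ c) (hc2 : c < 2) {t₁ : ℝ} (ht₁ : t₁ ∈ Ico 0 T)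
    (hp : ∀ t ∈ Icc 0 t₁, ∀ x, 0 < mink (ν t x) (M.footNormal (F t x)))
    (h0 : ∀ x, c * Real.sqrt (1 + mink (F 0 x) (M.footNormal (F 0 x)) ^ 2)
      ≤ 2 * mink (F 0 x) (M.footNormal (F 0 x))) {t : ℝ} (ht : t ∈ Icc 0 t₁) (x : Plane) :
    c * Real.sqrt (1 + mink (F t x) (M.footNormal (F t x)) ^ 2)
      ≤ 2 * mink (F t x) (M.footNormal (F t x)) := by
  set s : ℝ × Plane → ℝ := fun q => mink (F q.1 q.2) (M.footNormal (F q.1 q.2)) with hs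
  set b := c / Real.sqrt (4 - c ^ 2) with hb
  have hsub : Icc 0 t₁ ⊆ Ico 0 T := fun t ht => ⟨ht.1, ht.2.trans_lt ht₁.2⟩
  rw [mul_sqrt_le_iff hc hc2]
  refine le_of_forall_pos_le_add fun η hη => ?_
  by_contra! hlt
  obtain ⟨t', ht', x', hZ, hbefore, hafter⟩ := M.exists_first_contact (Z := fun q => s q + (η - b))
    (t₁ := t₁) ((h.continuousOn_height.mono (prod_mono_left hsub)).add continuousOn_const)
    (fun t ht γ x => by simp only [hs, h.height_deck (hsub ht) γ x])
    (fun x => by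
      have := (mul_sqrt_le_iff hc hc2).1 (h0 x)
      simp only [hs]
      linarith) ⟨t, ht, x, by simp only [hs]; linarith⟩
  have htI : t' ∈ Ioo 0 T := ⟨ht'.1, ht'.2.trans_lt ht₁.2⟩
  have hU : ∀ᶠ q in 𝓝 (t', x'), q ∈ Ioo 0 T ×ˢ (univ : Set Plane) :=
    isOpen_interior.mem_nhds ⟨htI, mem_univ x'⟩
  have hZs : ∀ᶠ q in 𝓝 (t', x'), ContDiffAt ℝ ∞ s q := hU.mono fun q hq => h.contDiffAt_height hq
  have hdd : ∀ v, dd v (fun q => s q + (η - b)) = dd v s := fun v => by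
    funext q
    simp only [dd, fderiv_add_const]
  obtain ⟨hτ, hsp⟩ := contact_derivatives (Z := fun q => s q + (η - b)) ht'.1
    (hZs.mono fun q hq => hq.add contDiffAt_const) hZ (fun s hs => hbefore s hs x') hafter
  simp only [hdd] at hτ hsp
  obtain ⟨w, l, E, hl0, hl1, -, hE, he⟩ := h.height_at_critical htI x' (fun v => (hsp v).1)
    (hp t' ⟨ht'.1.le, ht'.2⟩ x')
  have hlt' : 2 * s (t', x') < c * Real.sqrt (1 + s (t', x') ^ 2) := by
    rw [← not_le, mul_sqrt_le_iff hc hc2]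
    push Not
    linarith
  have := lower_barrier (Real.sqrt_pos.2 (by positivity)) hc hl0 hl1 hlt' hE
  have h2 := Finset.sum_nonneg fun a (_ : a ∈ Finset.univ) => (hsp (w a)).2
  simp only [hs] at hτ this h2
  linarith

/-- As long as the surface is a graph, it stays below its initial leaf. -/
lemma height_upper (hc : 0 ≤ c) (hc2 : c < 2) (hL : 2 * M.lambdaMax ^ 2 < 2 - c) {b : ℝ}
    (hb : c / (2 - (2 - c ^ 2 / 2) * M.lambdaMax ^ 2) * Real.sqrt (1 + b ^ 2) ≤ b) {t₁ : ℝ}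
    (ht₁ : t₁ ∈ Ico 0 T)
    (hp : ∀ t ∈ Icc 0 t₁, ∀ x, 0 < mink (ν t x) (M.footNormal (F t x)))
    (h0 : ∀ x, mink (F 0 x) (M.footNormal (F 0 x)) = b) {t : ℝ} (ht : t ∈ Icc 0 t₁) (x : Plane) :
    mink (F t x) (M.footNormal (F t x)) ≤ b := by
  set s : ℝ × Plane → ℝ := fun q => mink (F q.1 q.2) (M.footNormal (F q.1 q.2)) with hs
  have hsub : Icc 0 t₁ ⊆ Ico 0 T := fun t ht => ⟨ht.1, ht.2.trans_lt ht₁.2⟩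
  have hden : 0 < 2 - (2 - c ^ 2 / 2) * M.lambdaMax ^ 2 := by
    nlinarith [sq_nonneg M.lambdaMax]
  set κ := c / (2 - (2 - c ^ 2 / 2) * M.lambdaMax ^ 2) with hκ
  have hκ0 : 0 ≤ κ := by positivity
  have hb0 : 0 ≤ b := le_trans (by positivity) hb
  have hmono : ∀ a, b ≤ a → κ * Real.sqrt (1 + a ^ 2) ≤ a := by
    intro a ha
    have h1 : κ ^ 2 * (1 + b ^ 2) ≤ b ^ 2 := by
      have := pow_le_pow_left₀ (by positivity) hb 2
      rwa [mul_pow, Real.sq_sqrt (by positivity)] at this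
    refine le_of_pow_le_pow_left₀ two_ne_zero (hb0.trans ha) ?_
    rw [mul_pow, Real.sq_sqrt (by positivity)]
    have h2 : κ ^ 2 ≤ 1 := by
      by_contra! hlt
      nlinarith [sq_nonneg b]
    have h3 : b ^ 2 ≤ a ^ 2 := pow_le_pow_left₀ hb0 ha 2
    nlinarith
  -- the barrier is raised at a small constant speed, as the leaf itself may be stationary
  suffices hη : ∀ η > 0, s (t, x) ≤ b + η * (1 + t) by
    refine le_of_forall_pos_le_add fun η hη' => ?_
    have ht0 : 0 < 1 + t := by linarith [ht.1]
    have := hη (η / (1 + t)) (by positivity)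
    rwa [div_mul_cancel₀ _ ht0.ne'] at this
  intro η hη
  by_contra! hlt
  set B : ℝ × Plane → ℝ := fun q => b + η * (1 + q.1) with hB
  have sB : ContDiff ℝ ∞ B := by fun_prop
  obtain ⟨t', ht', x', hZ, hbefore, hafter⟩ := M.exists_first_contact (Z := fun q => B q - s q)
    (t₁ := t₁) (sB.continuous.continuousOn.sub
      (h.continuousOn_height.mono (prod_mono_left hsub)))
    (fun t ht γ x => by simp only [hs, hB, h.height_deck (hsub ht) γ x])
    (fun x => by
      simp only [hs, hB, h0 x]
      linarith) ⟨t, ht, x, by simp only [hB]; linarith⟩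
  have htI : t' ∈ Ioo 0 T := ⟨ht'.1, ht'.2.trans_lt ht₁.2⟩
  have hU : ∀ᶠ q in 𝓝 (t', x'), q ∈ Ioo 0 T ×ˢ (univ : Set Plane) :=
    isOpen_interior.mem_nhds ⟨htI, mem_univ x'⟩
  have hZs : ∀ᶠ q in 𝓝 (t', x'), ContDiffAt ℝ ∞ s q := hU.mono fun q hq => h.contDiffAt_height hq
  have hBτ : ∀ v q, dd v B q = η * v.1 := by
    intro v q
    have : HasFDerivAt B (η • ContinuousLinearMap.fst ℝ ℝ Plane) q :=
      (((ContinuousLinearMap.fst ℝ ℝ Plane).hasFDerivAt.const_add 1).const_mul η).const_add b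
    rw [dd, this.fderiv]
    rfl
  have hd1 : ∀ v, dd v (fun q => B q - s q) =ᶠ[𝓝 (t', x')] fun q => η * v.1 - dd v s q := by
    intro v
    filter_upwards [hZs] with q hq
    rw [dd_sub (sB.diffAt q) hq.diffAt, hBτ]
  have hd2 : ∀ v, dd v (dd v (fun q => B q - s q)) (t', x') = -dd v (dd v s) (t', x') := by
    intro v
    rw [(hd1 v).dd_eq, dd_sub (A := fun _ => η * v.1) (differentiableAt_const _)
      (hZs.self_of_nhds.dd v).diffAt, dd_const, zero_sub]
  obtain ⟨hτ, hsp⟩ := contact_derivatives (Z := fun q => B q - s q) ht'.1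
    (hZs.mono fun q hq => sB.contDiffAt.sub hq) hZ (fun s hs => hbefore s hs x') hafter
  rw [(hd1 _).self_of_nhds] at hτ
  have hcrit : ∀ v : Plane, dd ((0 : ℝ), v) s (t', x') = 0 := by
    intro v
    have := (hsp v).1
    rw [(hd1 _).self_of_nhds] at this
    simpa using this
  obtain ⟨w, l, E, hl0, hl1, hlL, hE, he⟩ := h.height_at_critical htI x' hcrit
    (hp t' ⟨ht'.1.le, ht'.2⟩ x')
  have hge : b ≤ s (t', x') := by
    have : 0 ≤ η * (1 + t') := by have := ht'.1; positivity
    simp only [hB] at hZ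
    linarith
  have := upper_barrier (Real.sqrt_pos.2 (by positivity)) (Real.sq_sqrt (by positivity)) hc hc2 hl0
    hl1 hlL hL (hmono _ hge) hE
  have h2 : 0 ≤ ∑ a, -dd ((0 : ℝ), w a) (dd ((0 : ℝ), w a) s) (t', x') :=
    Finset.sum_nonneg fun a _ => by rw [← hd2]; exact (hsp (w a)).2
  rw [Finset.sum_neg_distrib] at h2
  simp only [hs] at hτ this h2
  linarith

end AlmostFuchsian.IsMMCF

/-! ### Preservation of the angle bound -/

/-- The barrier for the angle, as a function of the height `s = sinh r`: it is
`cosh r - δ / cosh² r`. -/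
noncomputable def angleBarrier (δ s : ℝ) : ℝ := Real.sqrt (1 + s ^ 2) - δ / (1 + s ^ 2)

lemma contDiff_angleBarrier (δ : ℝ) : ContDiff ℝ ∞ (angleBarrier δ) := by
  have h1 : ContDiff ℝ ∞ fun s : ℝ => 1 + s ^ 2 := by fun_prop
  have h0 : ∀ s : ℝ, 1 + s ^ 2 ≠ 0 := fun s => by positivity
  exact (h1.sqrt h0).sub (contDiff_const.div h1 h0)

lemma hasDerivAt_sqrt_one_add_sq (s : ℝ) :
    HasDerivAt (fun s => Real.sqrt (1 + s ^ 2)) (s / Real.sqrt (1 + s ^ 2)) s := by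
  have h1 : HasDerivAt (fun s : ℝ => 1 + s ^ 2) (2 * s) s := by
    simpa using (hasDerivAt_pow 2 s).const_add 1
  have := h1.sqrt (by positivity)
  convert this using 1
  ring

lemma deriv_angleBarrier (δ s : ℝ) : deriv (angleBarrier δ) s
    = s / Real.sqrt (1 + s ^ 2) + 2 * δ * s / (1 + s ^ 2) ^ 2 := by
  have h1 : HasDerivAt (fun s : ℝ => 1 + s ^ 2) (2 * s) s := by
    simpa using (hasDerivAt_pow 2 s).const_add 1
  have h0 : 1 + s ^ 2 ≠ 0 := by positivity
  have := (hasDerivAt_sqrt_one_add_sq s).sub ((hasDerivAt_const s δ).div h1 h0)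
  refine (this.deriv).trans ?_
  ring

lemma deriv_deriv_angleBarrier (δ s : ℝ) : deriv (deriv (angleBarrier δ)) s
    = 1 / Real.sqrt (1 + s ^ 2) ^ 3 + 2 * δ / (1 + s ^ 2) ^ 2
      - 8 * δ * s ^ 2 / (1 + s ^ 2) ^ 3 := by
  have e : deriv (angleBarrier δ) = fun s => s / Real.sqrt (1 + s ^ 2)
      + 2 * δ * s / (1 + s ^ 2) ^ 2 := funext (deriv_angleBarrier δ)
  have h1 : HasDerivAt (fun s : ℝ => 1 + s ^ 2) (2 * s) s := by
    simpa using (hasDerivAt_pow 2 s).const_add 1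
  have h0 : 1 + s ^ 2 ≠ 0 := by positivity
  have hq : Real.sqrt (1 + s ^ 2) ≠ 0 := (Real.sqrt_pos.2 (by positivity)).ne'
  have hq2 : Real.sqrt (1 + s ^ 2) ^ 2 = 1 + s ^ 2 := Real.sq_sqrt (by positivity)
  have hd := ((hasDerivAt_id s).div (hasDerivAt_sqrt_one_add_sq s) hq).add
    (((hasDerivAt_id s).const_mul (2 * δ)).div (h1.pow 2) (pow_ne_zero 2 h0))
  rw [e]
  refine (hd.deriv).trans ?_
  simp only [id]
  set C := Real.sqrt (1 + s ^ 2)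
  have e1 : (1 * C - s * (s / C)) / C ^ 2 = 1 / C ^ 3 := by
    field_simp
    linear_combination hq2
  rw [e1]
  simp only [Pi.pow_apply]
  field_simp
  ring

section ScalarComposition

variable {E : Type*} [NormedAddCommGroup E] [NormedSpace ℝ E]

lemma dd_real_comp {A : ℝ → ℝ} {u : E → ℝ} {x : E} (hA : ContDiff ℝ ∞ A)
    (hu : ContDiffAt ℝ ∞ u x) (v : E) :
    dd v (fun y => A (u y)) x = deriv A (u x) * dd v u x := by
  rw [dd_comp (hA.diffAt _) hu.diffAt, dd, fderiv_eq_smul_deriv, smul_eq_mul, mul_comm]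

lemma dd_dd_real_comp {A : ℝ → ℝ} {u : E → ℝ} {x : E} (hA : ContDiff ℝ ∞ A)
    (hu : ∀ᶠ y in 𝓝 x, ContDiffAt ℝ ∞ u y) (v : E) :
    dd v (dd v (fun y => A (u y))) x
      = deriv (deriv A) (u x) * dd v u x ^ 2 + deriv A (u x) * dd v (dd v u) x := by
  have hux := hu.self_of_nhds
  have hA' : ContDiff ℝ ∞ (deriv A) := by
    have : deriv A = dd (1 : ℝ) A := funext fun y => by rw [dd, fderiv_eq_smul_deriv, one_smul]
    rw [this]
    exact hA.dd 1
  have h1 : dd v (fun y => A (u y)) =ᶠ[𝓝 x] fun y => deriv A (u y) * dd v u y :=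
    hu.mono fun y hy => dd_real_comp hA hy v
  rw [h1.dd_eq, dd_mul (A := fun y => deriv A (u y)) (hA'.contDiffAt.comp x hux).diffAt (hux.dd v).diffAt,
    dd_real_comp hA' hux]
  ring

end ScalarComposition

/-- The size of `δ` compared to the curvature of the minimal surface; this is where the upper bound
for `r` enters. -/
lemma curvature_small {ε₁ ε r C : ℝ} (hε₁ : 0 < ε₁) (hε : 0 ≤ ε) (hr0 : 0 ≤ r)
    (hr : ε = 0 ∨ (1 ≤ 1 / 8 * Real.log (ε₁ / (ε * (16 + ε₁))) ∧
        r ≤ 1 / 2 * Real.arcosh (1 / 8 * Real.log (ε₁ / (ε * (16 + ε₁))))))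
    (hC : 1 ≤ C) (hCr : C ≤ Real.cosh r) :
    80 * ε * C ^ 3 < 11 / 10 * (ε₁ / (3 * (16 + ε₁))) := by
  rcases hε.eq_or_lt with h0 | h0
  · rw [← h0]
    have : 0 < ε₁ / (3 * (16 + ε₁)) := by positivity
    linarith
  obtain ⟨hX, hrX⟩ := hr.resolve_left h0.ne'
  set X := 1 / 8 * Real.log (ε₁ / (ε * (16 + ε₁))) with hXdef
  have hcosh : Real.cosh (2 * r) ≤ X := by
    rw [← Real.cosh_arcosh hX, Real.cosh_le_cosh, abs_of_nonneg (by positivity),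
      abs_of_nonneg (Real.arcosh_nonneg hX)]
    linarith
  have hC2 : C ^ 2 ≤ X := by
    have h1 : C ^ 2 ≤ Real.cosh r ^ 2 := pow_le_pow_left₀ (by linarith) hCr 2
    have h2 := Real.cosh_two_mul r
    have h3 := Real.cosh_sq_sub_sinh_sq r
    linarith
  have hC3 : C ^ 3 ≤ X ^ 2 := by
    calc C ^ 3 ≤ C ^ 4 := pow_le_pow_right₀ hC (by norm_num)
      _ = (C ^ 2) ^ 2 := by ring
      _ ≤ X ^ 2 := pow_le_pow_left₀ (by positivity) hC2 2
  have hexp : Real.exp (8 * X) = ε₁ / (ε * (16 + ε₁)) := by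
    rw [hXdef, ← mul_assoc]
    norm_num
    exact Real.exp_log (by positivity)
  -- `exp (8 X) ≥ (1 + X)⁸ ≥ (4 X)⁴`
  have hlow : 256 * X ^ 2 ≤ Real.exp (8 * X) := by
    have h1 : (1 + X) ^ 8 ≤ Real.exp (8 * X) := by
      rw [show (8 : ℝ) * X = (8 : ℕ) * X by norm_num, Real.exp_nat_mul]
      exact pow_le_pow_left₀ (by linarith) (by linarith [Real.add_one_le_exp X]) 8
    have h2 : (4 * X) ^ 4 ≤ ((1 + X) ^ 2) ^ 4 :=
      pow_le_pow_left₀ (by linarith) (by nlinarith [sq_nonneg (1 - X)]) 4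
    have h3 : X ^ 2 ≤ X ^ 4 := pow_le_pow_right₀ hX (by norm_num)
    have h4 : ((1 + X) ^ 2) ^ 4 = (1 + X) ^ 8 := by ring
    have h5 : (4 * X) ^ 4 = 256 * X ^ 4 := by ring
    linarith
  have h6 : ε₁ / (3 * (16 + ε₁)) = ε * Real.exp (8 * X) / 3 := by
    rw [hexp]; field_simp
  rw [h6]
  have h7 : ε * C ^ 3 ≤ ε * X ^ 2 := mul_le_mul_of_nonneg_left hC3 hε
  have h8 : ε * (256 * X ^ 2) ≤ ε * Real.exp (8 * X) := mul_le_mul_of_nonneg_left hlow hε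
  have h9 : 0 < ε * X ^ 2 := by positivity
  linarith

namespace AlmostFuchsian.IsMMCF

variable {M : AlmostFuchsian} {c T : ℝ} {F ν : ℝ → Plane → Minkowski} (h : M.IsMMCF c T F ν)
include h

/-- The angle cannot touch the barrier from above. -/
lemma no_contact {ε δ : ℝ} (hA : M.c1NormA ≤ ε) (hε : ε ≤ 1 / 1000) (hc : 0 ≤ c) (hc2 : c ≤ 2)
    (hδ : 0 ≤ δ) (hδ1 : δ ≤ 1 / 15) {t : ℝ} (ht : t ∈ Ioo 0 T) (x : Plane)
    (hcs : c * Real.sqrt (1 + mink (F t x) (M.footNormal (F t x)) ^ 2)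
      ≤ 2 * mink (F t x) (M.footNormal (F t x)))
    (hδε : 80 * ε * Real.sqrt (1 + mink (F t x) (M.footNormal (F t x)) ^ 2) ^ 3 < 11 / 10 * δ)
    (h0 : mink (ν t x) (M.footNormal (F t x))
      - angleBarrier δ (mink (F t x) (M.footNormal (F t x))) = 0)
    (hbefore : ∀ s ∈ Ico 0 t, 0 < mink (ν s x) (M.footNormal (F s x))
      - angleBarrier δ (mink (F s x) (M.footNormal (F s x))))
    (hafter : ∀ y, 0 ≤ mink (ν t y) (M.footNormal (F t y))
      - angleBarrier δ (mink (F t y) (M.footNormal (F t y)))) : False := by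
  have hs := h.isSurface (Ioo_subset_Ico_self ht)
  obtain ⟨w, hw⟩ := hs.exists_frame x
  have hx : (t, x) ∈ Ioo 0 T ×ˢ (univ : Set Plane) := ⟨ht, mem_univ x⟩
  have hflow := h.isNormalFlow w
  have hw' : ∀ a b, mink (dd ((0 : ℝ), w a) (fun q : ℝ × Plane => F q.1 q.2) (t, x))
      (dd ((0 : ℝ), w b) (fun q : ℝ × Plane => F q.1 q.2) (t, x)) = if a = b then 1 else 0 := by
    intro a b
    rw [← h.dd_slice ht, ← h.dd_slice ht]
    exact hw a b
  have hP : F t x ∈ Hyp3 := (hs.surface x).mem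
  set s : ℝ × Plane → ℝ := fun q => mink (F q.1 q.2) (M.footNormal (F q.1 q.2)) with hsdef
  set p : ℝ × Plane → ℝ := fun q => mink (ν q.1 q.2) (M.footNormal (F q.1 q.2)) with hpdef
  have hU : ∀ᶠ q in 𝓝 (t, x), q ∈ Ioo 0 T ×ˢ (univ : Set Plane) := isOpen_interior.mem_nhds hx
  have hss : ∀ᶠ q in 𝓝 (t, x), ContDiffAt ℝ ∞ s q := hU.mono fun q hq => h.contDiffAt_height hq
  have hps : ∀ᶠ q in 𝓝 (t, x), ContDiffAt ℝ ∞ p q := hU.mono fun q hq => h.contDiffAt_angle hq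
  have hG := contDiff_angleBarrier δ
  have hGs : ∀ᶠ q in 𝓝 (t, x), ContDiffAt ℝ ∞ (fun q => angleBarrier δ (s q)) q :=
    hss.mono fun q hq => hG.contDiffAt.comp q hq
  obtain ⟨hτ, hsp⟩ := contact_derivatives (Z := fun q => p q - angleBarrier δ (s q)) ht.1
    (by filter_upwards [hps, hGs] with q h1 h2 using h1.sub h2) h0 hbefore hafter
  have hd1 : ∀ v, dd v (fun q => p q - angleBarrier δ (s q)) =ᶠ[𝓝 (t, x)]
      fun q => dd v p q - dd v (fun q => angleBarrier δ (s q)) q := by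
    intro v
    filter_upwards [hps, hGs] with q h1 h2
    exact dd_sub h1.diffAt h2.diffAt v
  have hd2 : ∀ v, dd v (dd v (fun q => p q - angleBarrier δ (s q))) (t, x)
      = dd v (dd v p) (t, x) - dd v (dd v (fun q => angleBarrier δ (s q))) (t, x) := by
    intro v
    rw [(hd1 v).dd_eq, dd_sub (hps.self_of_nhds.dd v).diffAt (hGs.self_of_nhds.dd v).diffAt]
  have hd : ∀ v, dd v (fun q => p q - angleBarrier δ (s q)) (t, x)
      = dd v p (t, x) - deriv (angleBarrier δ) (s (t, x)) * dd v s (t, x) := fun v =>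
    (hd1 v).self_of_nhds.trans (by rw [← dd_real_comp hG hss.self_of_nhds])
  rw [hd] at hτ
  have z1 : ∀ a, dd ((0 : ℝ), w a) p (t, x)
      - deriv (angleBarrier δ) (s (t, x)) * dd ((0 : ℝ), w a) s (t, x) = 0 := by
    intro a
    rw [← hd]
    exact (hsp (w a)).1
  have z2 : ∀ a, 0 ≤ dd ((0 : ℝ), w a) (dd ((0 : ℝ), w a) p) (t, x)
      - (deriv (deriv (angleBarrier δ)) (s (t, x)) * dd ((0 : ℝ), w a) s (t, x) ^ 2
        + deriv (angleBarrier δ) (s (t, x)) * dd ((0 : ℝ), w a) (dd ((0 : ℝ), w a) s) (t, x)) := by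
    intro a
    rw [← dd_dd_real_comp hG hss, ← hd2]
    exact (hsp (w a)).2
  have hgrad := hflow.grad_height_sq (M := M) hx hw'
  have hlap := hflow.laplacian_height (M := M) hx hw'
  have htime := hflow.dd_height_time (M := M) hx
  have hangle := hflow.angle_evolution (M := M) hx hw'
  have hmean := hflow.mean_eq hx hw'
  have hL := hflow.lorentzFrame hx hw'
  have s01 := dd_comm (hflow.smooth _ hx) ((0 : ℝ), w 1) ((0 : ℝ), w 0)
  simp only [← hsdef, ← hpdef, Fin.sum_univ_two] at hgrad hlap htime hangle
  rw [s01] at hangle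
  set a₀ := dd ((0 : ℝ), w 0) (fun q : ℝ × Plane => F q.1 q.2) (t, x) with ha₀
  set a₁ := dd ((0 : ℝ), w 1) (fun q : ℝ × Plane => F q.1 q.2) (t, x) with ha₁
  have o0 : mink a₀ (F t x) = 0 := (mink_comm _ _).trans hL.h01
  have o1 : mink a₁ (F t x) = 0 := (mink_comm _ _).trans hL.h02
  have oN : mink (ν t x) (F t x) = 0 := (mink_comm _ _).trans hL.h03
  have u0 : mink a₀ a₀ = 1 := hL.h11
  have u1 : mink a₁ a₁ = 1 := hL.h22
  have uN : mink (ν t x) (ν t x) = 1 := hL.h33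
  set C := Real.sqrt (1 + mink (F t x) (M.footNormal (F t x)) ^ 2) with hCdef
  have hC2 : C ^ 2 = 1 + mink (F t x) (M.footNormal (F t x)) ^ 2 :=
    Real.sq_sqrt (by positivity)
  have hCe : -mink (F t x) (M.f (M.foot (F t x))) = C := by
    rw [hCdef, ← cosh_sq_eq hP, Real.sqrt_sq (cosh_pos hP).le]
  have hC1 : 1 ≤ C := by rw [← hCe]; exact one_le_cosh hP
  have b1 := fun {X V} h1 h2 h3 h4 => abs_dd_footNormal_le (X := X) (V := V) hP hA hε h1 h2 h3 h4
  have b2 := fun {X V} h1 h2 h3 h4 =>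
    abs_dd_dd_footNormal_le (X := X) (V := V) hP hA hε h1 h2 h3 h4
  rw [hCe] at b1 b2
  have hst : 0 ≤ mink (F t x) (M.footNormal (F t x)) := by
    have : 0 ≤ c * C := by positivity
    linarith
  have hpe : mink (ν t x) (M.footNormal (F t x)) = C - δ / C ^ 2 := by
    rw [hC2]; exact sub_eq_zero.1 h0
  have strict := barrier_strict (n₀₀ := mink (ν t x) (dd ((0 : ℝ), w 0)
      (dd ((0 : ℝ), w 0) (fun q : ℝ × Plane => F q.1 q.2)) (t, x)))
    (n₀₁ := mink (ν t x) (dd ((0 : ℝ), w 0)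
      (dd ((0 : ℝ), w 1) (fun q : ℝ × Plane => F q.1 q.2)) (t, x)))
    (n₁₁ := mink (ν t x) (dd ((0 : ℝ), w 1)
      (dd ((0 : ℝ), w 1) (fun q : ℝ × Plane => F q.1 q.2)) (t, x)))
    hC1 hC2 hst hc hc2 hcs hδ hδ1 hpe
    (g₁ := deriv (angleBarrier δ) (s (t, x))) (g₂ := deriv (deriv (angleBarrier δ)) (s (t, x)))
    (by rw [deriv_angleBarrier, show C ^ 4 = (C ^ 2) ^ 2 by ring, hC2])
    (by rw [deriv_deriv_angleBarrier, show C ^ 4 = (C ^ 2) ^ 2 by ring,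
      show C ^ 6 = (C ^ 2) ^ 3 by ring, hC2])
    (eps_nonneg_of_c1NormA_le hA) hε hδε
    (b1 o0 u0 o0 u0) (b1 o0 u0 o1 u1) (b1 o1 u1 o0 u0) (b1 o1 u1 o1 u1) (b1 oN uN oN uN)
    (b2 o0 u0 oN uN) (b2 o1 u1 oN uN)
  have y0 := z1 0
  have y1 := z1 1
  have x0 := z2 0
  have x1 := z2 1
  rw [← hC2] at hgrad
  set g₁ := deriv (angleBarrier δ) (s (t, x))
  set g₂ := deriv (deriv (angleBarrier δ)) (s (t, x))
  set k₀ := mink (dd ((0 : ℝ), w 0) (dd ((0 : ℝ), w 0) (fun q : ℝ × Plane => F q.1 q.2)) (t, x)) a₀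
    + mink (dd ((0 : ℝ), w 1) (dd ((0 : ℝ), w 1) (fun q : ℝ × Plane => F q.1 q.2)) (t, x)) a₀
  set k₁ := mink (dd ((0 : ℝ), w 0) (dd ((0 : ℝ), w 0) (fun q : ℝ × Plane => F q.1 q.2)) (t, x)) a₁
    + mink (dd ((0 : ℝ), w 1) (dd ((0 : ℝ), w 1) (fun q : ℝ × Plane => F q.1 q.2)) (t, x)) a₁
  -- the Christoffel terms `k₀`, `k₁` of the two Laplacians cancel, as the gradient vanishes
  refine absurd strict (not_lt.2 ?_)
  linear_combination hτ + x0 + x1 - hangle + g₁ * htime - g₂ * hgrad - g₁ * hlap + k₀ * y0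
    + k₁ * y1 + 2 * mink (F t x) (M.footNormal (F t x)) * hmean

end AlmostFuchsian.IsMMCF

namespace AlmostFuchsian.IsMMCF

variable {M : AlmostFuchsian} {c T : ℝ} {F ν : ℝ → Plane → Minkowski} (h : M.IsMMCF c T F ν)
include h

/-- The angle stays above the barrier along the flow. -/
lemma barrier_lt {ε δ r : ℝ} (hA : M.c1NormA ≤ ε) (hε : ε ≤ 1 / 1000) (hc : 0 ≤ c) (hc2 : c < 2)
    (hL : 2 * M.lambdaMax ^ 2 < 2 - c) (hδ : 0 < δ) (hδ1 : δ ≤ 1 / 15)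
    (hr : c / (2 - (2 - c ^ 2 / 2) * M.lambdaMax ^ 2) * Real.cosh r ≤ Real.sinh r)
    (hδε : ∀ C, 1 ≤ C → C ≤ Real.cosh r → 80 * ε * C ^ 3 < 11 / 10 * δ)
    (hF₀ : ∀ x, F 0 x = M.normalExp x r) (hν₀ : ∀ x, ν 0 x = M.normalExpVelocity x r)
    {t : ℝ} (ht : t ∈ Ico 0 T) (x : Plane) :
    angleBarrier δ (mink (F t x) (M.footNormal (F t x)))
      < mink (ν t x) (M.footNormal (F t x)) := by
  have hs0 : ∀ x, mink (F 0 x) (M.footNormal (F 0 x)) = Real.sinh r := fun x => by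
    rw [hF₀, footNormal, foot_normalExp, mink_normalExp_n]
  have hp0 : ∀ x, mink (ν 0 x) (M.footNormal (F 0 x)) = Real.cosh r := fun x => by
    rw [hF₀, hν₀, footNormal, foot_normalExp, normalExpVelocity, mink_add_left, mink_smul_left,
      mink_smul_left, (M.surface x).normal_unit, mink_comm, (M.surface x).normal_tangent]
    ring
  have hC0 : Real.sqrt (1 + Real.sinh r ^ 2) = Real.cosh r := by
    rw [add_comm, ← Real.cosh_sq, Real.sqrt_sq (Real.cosh_pos r).le]
  have hcosh : 1 ≤ Real.cosh r := Real.one_le_cosh r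
  have hden : 0 < 2 - (2 - c ^ 2 / 2) * M.lambdaMax ^ 2 := by
    nlinarith [sq_nonneg M.lambdaMax]
  have hsinh : 0 ≤ Real.sinh r := le_trans (by positivity) hr
  have hcs0 : c * Real.cosh r ≤ 2 * Real.sinh r := by
    have h1 : c / 2 ≤ c / (2 - (2 - c ^ 2 / 2) * M.lambdaMax ^ 2) := by
      refine div_le_div_of_nonneg_left hc hden ?_
      have : 0 ≤ (2 - c ^ 2 / 2) * M.lambdaMax ^ 2 :=
        mul_nonneg (by nlinarith) (sq_nonneg _)
      linarith
    have := mul_le_mul_of_nonneg_right h1 (Real.cosh_pos r).le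
    linarith
  by_contra! hle
  have hsub : Icc 0 t ⊆ Ico 0 T := fun s hs => ⟨hs.1, hs.2.trans_lt ht.2⟩
  have hcont := h.continuousOn_angle.sub
    ((contDiff_angleBarrier δ).continuous.comp_continuousOn h.continuousOn_height)
  obtain ⟨t', ht', x', hZ, hbefore, hafter⟩ := M.exists_first_contact
    (Z := fun q => mink (ν q.1 q.2) (M.footNormal (F q.1 q.2))
      - angleBarrier δ (mink (F q.1 q.2) (M.footNormal (F q.1 q.2))))
    (hcont.mono (prod_mono_left hsub))
    (fun s hs γ y => by
      simp only [h.height_deck (hsub hs) γ y, h.angle_deck hν₀ (hsub hs) γ y])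
    (fun y => by
      simp only [hs0, hp0, angleBarrier, hC0]
      have : 0 < δ / (1 + Real.sinh r ^ 2) := by positivity
      linarith) ⟨t, ⟨ht.1, le_rfl⟩, x, sub_nonpos.2 hle⟩
  have htI : t' ∈ Ioo 0 T := ⟨ht'.1, ht'.2.trans_lt ht.2⟩
  have hbar : ∀ s : ℝ, 0 < angleBarrier δ s := by
    intro s
    have h1 : 1 ≤ Real.sqrt (1 + s ^ 2) := Real.one_le_sqrt.2 (by nlinarith [sq_nonneg s])
    have h2 : δ / (1 + s ^ 2) ≤ δ := div_le_self hδ.le (by nlinarith [sq_nonneg s])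
    rw [angleBarrier]
    linarith
  -- up to the time of contact the angle is positive, so that the height barriers apply
  have hp : ∀ s ∈ Icc 0 t', ∀ y, 0 < mink (ν s y) (M.footNormal (F s y)) := by
    intro s hs y
    rcases hs.2.eq_or_lt with e | e
    · rw [e]
      exact (hbar _).trans_le (sub_nonneg.1 (hafter y))
    · exact (hbar _).trans (sub_pos.1 (hbefore s ⟨hs.1, e⟩ y))
  have ht'I : t' ∈ Icc 0 t' := ⟨ht'.1.le, le_rfl⟩
  have hlow := h.height_lower hc hc2 (Ioo_subset_Ico_self htI) hp
    (fun y => by rw [hs0, hC0]; exact hcs0) ht'I x'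
  have hup := h.height_upper hc hc2 hL (by rw [hC0]; exact hr) (Ioo_subset_Ico_self htI) hp hs0 ht'I x'
  have hs' : 0 ≤ mink (F t' x') (M.footNormal (F t' x')) := by
    have : 0 ≤ c * Real.sqrt (1 + mink (F t' x') (M.footNormal (F t' x')) ^ 2) := by positivity
    linarith
  refine h.no_contact hA hε hc hc2.le hδ.le hδ1 htI x' hlow (hδε _ ?_ ?_) hZ
    (fun s hs => hbefore s hs x') hafter
  · exact Real.one_le_sqrt.2 (by nlinarith [sq_nonneg (mink (F t' x') (M.footNormal (F t' x')))])
  · rw [← hC0]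
    exact Real.sqrt_le_sqrt (by nlinarith)

end AlmostFuchsian.IsMMCF

end

theorem lemma5p1 (M : AlmostFuchsian) (ε₁ ε c r T : ℝ) (F ν : ℝ → Plane → Minkowski)
    (hε₁ : 0 < ε₁)
    -- the range of `ε`
    (hε_nonneg : 0 ≤ ε) (hε_lt : ε < 1 - 1 / (1 + ε₁ / 16) ^ 2)
    (hε_sqrt : ε ≤ Real.sqrt ε₁ / 12) (hε_univ : ε ≤ 7 / 10 ^ 6)
    -- the smallness of the second fundamental form of `Σ`
    (hA : M.c1NormA ≤ ε)
    -- the range of `c`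
    (hc : c ∈ Set.Icc 0 (2 - ε₁ / 2))
    -- the range of `r`; for `ε = 0` the upper end of the range is `+∞`
    (hr_lower : Real.artanh (c / (2 - (2 - c ^ 2 / 2) * M.lambdaMax ^ 2)) ≤ r)
    (hr_upper : ε = 0 ∨
      (1 ≤ 1 / 8 * Real.log (ε₁ / (ε * (16 + ε₁))) ∧
        r ≤ 1 / 2 * Real.arcosh (1 / 8 * Real.log (ε₁ / (ε * (16 + ε₁))))))
    -- the flow starts from the equidistant surface `Σ(r)`, with initial unit normal `∂/∂r`
    (hflow : M.IsMMCF c T F ν)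
    (hF₀ : ∀ x, F 0 x = M.normalExp x r)
    (hν₀ : ∀ x, ν 0 x = M.normalExpVelocity x r) :
    (∀ t ∈ Set.Ico 0 T, ∀ x, 1 / (1 + ε₁ / 8) ≤ M.angle (F t) (ν t) x) ∧
      (∀ t ∈ Set.Ico 0 T, M.IsGeodesicGraph (F t) (ν t)) := by
  suffices hmain : ∀ t ∈ Set.Ico 0 T, ∀ x, 1 / (1 + ε₁ / 8) ≤ M.angle (F t) (ν t) x from
    ⟨hmain, fun t ht => ⟨1 / (1 + ε₁ / 8), by positivity, hmain t ht⟩⟩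
  obtain ⟨hc0, hc1⟩ := hc
  have hc2 : c < 2 := by linarith
  have hε₁4 : ε₁ ≤ 4 := by linarith
  -- If `ε > 0` and `X` is the upper bound for `cosh (2 r)`, then `δ = ε exp (8 X) / 3`, which is large
  -- compared to `ε cosh³ r`; on the other hand `1 - δ ≥ 1 / (1 + ε₁ / 8)`.
  set δ := ε₁ / (3 * (16 + ε₁)) with hδdef
  have hδ : 0 < δ := by positivity
  have hδ1 : δ ≤ 1 / 15 := by
    rw [hδdef, div_le_iff₀ (by positivity)]; linarith
  have hl0 := M.lambdaMax_nonneg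
  have hlε : M.lambdaMax ^ 2 ≤ ε₁ / 144 := by
    calc M.lambdaMax ^ 2 ≤ (Real.sqrt ε₁ / 12) ^ 2 :=
          pow_le_pow_left₀ hl0 ((AlmostFuchsian.lambdaMax_le hA).trans hε_sqrt) 2
      _ = ε₁ / 144 := by rw [div_pow, Real.sq_sqrt hε₁.le]; norm_num
  have hL : 2 * M.lambdaMax ^ 2 < 2 - c := by linarith
  have hden : 0 < 2 - (2 - c ^ 2 / 2) * M.lambdaMax ^ 2 := by
    nlinarith [sq_nonneg M.lambdaMax]
  have hκ0 : 0 ≤ c / (2 - (2 - c ^ 2 / 2) * M.lambdaMax ^ 2) := by positivity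
  have hκ1 : c / (2 - (2 - c ^ 2 / 2) * M.lambdaMax ^ 2) < 1 := by
    rw [div_lt_one hden]
    nlinarith [sq_nonneg M.lambdaMax, sq_nonneg c, mul_nonneg (sq_nonneg c) (sq_nonneg M.lambdaMax)]
  have hr0 : 0 ≤ r := (Real.artanh_nonneg hκ0).trans hr_lower
  have hr : c / (2 - (2 - c ^ 2 / 2) * M.lambdaMax ^ 2) * Real.cosh r ≤ Real.sinh r := by
    have hmem : Real.tanh r ∈ Set.Ioo (-1 : ℝ) 1 := Real.tanh_bijOn.mapsTo (Set.mem_univ r)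
    have h1 : c / (2 - (2 - c ^ 2 / 2) * M.lambdaMax ^ 2) ≤ Real.tanh r := by
      rw [← Real.artanh_le_artanh_iff ⟨by linarith, hκ1⟩ hmem, Real.artanh_tanh]
      exact hr_lower
    rwa [Real.tanh_eq_sinh_div_cosh, le_div_iff₀ (Real.cosh_pos r)] at h1
  intro t ht x
  have hs := hflow.surface t ht x
  have key := hflow.barrier_lt hA (hε_univ.trans (by norm_num)) hc0 hc2 hL hδ hδ1 hr
    (fun C hC hCr => curvature_small hε₁ hε_nonneg hr0 hr_upper hC hCr) hF₀ hν₀ ht x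
  rw [AlmostFuchsian.angle_eq hs.mem hs.normal_tangent]
  set s := mink (F t x) (M.footNormal (F t x))
  have hC1 : 1 ≤ Real.sqrt (1 + s ^ 2) := Real.one_le_sqrt.2 (by nlinarith [sq_nonneg s])
  have hs1 : 1 ≤ 1 + s ^ 2 := by nlinarith [sq_nonneg s]
  rw [le_div_iff₀ (by linarith)]
  have h1 : δ / (1 + s ^ 2) ≤ δ * Real.sqrt (1 + s ^ 2) :=
    (div_le_self hδ.le hs1).trans (le_mul_of_one_le_right hδ.le hC1)
  have h2 : 1 / (1 + ε₁ / 8) ≤ 1 - δ := by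
    rw [div_le_iff₀ (by positivity), hδdef]
    have : (1 - ε₁ / (3 * (16 + ε₁))) * (1 + ε₁ / 8) - 1
        = ε₁ * (40 + 2 * ε₁) / (24 * (16 + ε₁)) := by
      field_simp
      ring
    have h3 : 0 ≤ ε₁ * (40 + 2 * ε₁) / (24 * (16 + ε₁)) := by positivity
    linarith
  have h3 := mul_le_mul_of_nonneg_right h2 (by linarith : 0 ≤ Real.sqrt (1 + s ^ 2))
  rw [angleBarrier] at key
  linarith
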